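/- **Setting.** Let $1\le\rho\le n$, $R,G,\alpha>0$, $\beta\ge 0$, let $\mathcal B$ be the closed Euclidean unit ball of $\mathbb R^n$, and let $\mathcal K\subseteq R\mathcal B$ be nonempty, convex and compact. Let $f_1,\dots,f_T$ be losses that, over $3R\mathcal B$, are differentiable, have $\beta$-Lipschitz gradients of norm at most $G$, and satisfy the curvature condition with parameter $\alpha$: for all $\eta\ge\max\{12GR,2/\alpha\}$ and $x,y\in 3R\mathcal B$, $$f_t(x)-f_t(y)\le\nabla f_t(x)^\top(x-y)-\tfrac1{2\eta}\big(\nabla f_t(x)^\top(x-y)\big)^2 .$$ $\mathcal K$ is accessed through a linear optimization oracle (LOO), which for a query $g$ returns some $v\in\arg\min_{v\in\mathcal K}v^\top g$. Write $\|x\|_A^2=x^\top Ax$. **Algorithm** (parameters $K,\eta,\epsilon,\epsilon_I$; $K$ is an integer dividing $T$). Start from an arbitrary $x_1=\widetilde y_1\in\mathcal K$, the $(\rho+1)\times n$ matrix $S_0=0$ and $A_0=\epsilon_I I$. For $m=1,\dots,T/K$: in the rounds $t=(m-1)K+1,\dots,mK$ play $x^t=x_m$ and observe $\nabla_t=\nabla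 f_t(\widetilde y_m)$; put $\bar\nabla_m=\sum_t\nabla_t$ over these rounds. *Frequent Directions sketch:* put $\bar\nabla_m$ in the last row of $S_{m-1}$, take an eigendecomposition $V^\top\widehat\Sigma V$ of $S_{m-1}^\top S_{m-1}$, where $V$ has $\rho+1$ orthonormal rows and $\widehat\Sigma$ is diagonal with non-increasing entries (if $\rho=n$, the last row of $V$ and the last entry of $\widehat\Sigma$ are $0$), and with $\sigma_m=\widehat\Sigma(\rho+1,\rho+1)$ set $S_m=(\widehat\Sigma-\sigma_mI)^{1/2}V$ and $A_m=\epsilon_II+S_m^\top S_m$. *Newton step:* $y_{m+1}=\widetilde y_m-\eta A_m^{-1}\bar\nabla_m$. *Approximate projection:* let $(x_{m+1},\widetilde y_{m+1})=\mathrm{AFP}(x_m,y_{m+1})$ with $A=A_m$, where - $\mathrm{AFP}(x_0,y_1)$ returns $(x_0,y_1)$ if $\|x_0-y_1\|_A^2\le3\epsilon$; otherwise, for $i=1,2,\dots$, it puts $x_i=\mathrm{FW}(x_{i-1},y_i)$, returns $(x_i,y_i)$ if $\|x_i-y_i\|_A^2\le3\epsilon$, and else sets $y_{i+1}=y_i-\frac23(y_i-x_i)$;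 - $\mathrm{FW}(z_1,y)$, for $i=1,2,\dots$, calls the LOO to get $v_i\in\arg\min_{v\in\mathcal K}(z_i-y)^\top Av$, returns $z_i$ if $(z_i-y)^\top A(z_i-v_i)\le\epsilon$ or $\|z_i-y\|_A^2\le3\epsilon$, and else sets $z_{i+1}=z_i+\sigma_i(v_i-z_i)$ with $\sigma_i\in\arg\min_{\sigma\in[0,1]}\|y-z_i-\sigma(v_i-z_i)\|_A^2$. **Theorem.** There are universal constants $c,C>0$ such that the following holds whenever $$T\ge T_0=c\log^3\Big(c+\big(c+\tfrac{c}{R^2G^2\alpha^2}\big)\rho^{-4/3}T^{1/3}\Big)$$ and $K=4\rho^{-1/3}T^{2/3}$ is an integer dividing $T$. Set $$\eta=8\max\{6GR,\tfrac1\alpha\}\rho^{-1/3}T^{2/3},\quad \epsilon_I=32G^2T^{4/3},\quad \epsilon=96G^2R^2\log\Big(19+8\big(12+\tfrac1{3R^2G^2\alpha^2}\big)\rho^{-4/3}T^{1/3}\Big)T .$$ Then $\eta\ge\max\{12KGR,2K/\alpha\}$, $\epsilon_I\ge(KG)^2$ and $3\epsilon/\epsilon_I\le4R^2$. For every run of the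 algorithm all played points lie in $\mathcal K$, all gradients are evaluated in $3R\mathcal B$, and, with $\Omega_\rho=\sum_{i=\rho+1}^n\lambda_i\big(\sum_{t=1}^T\nabla_t\nabla_t^\top\big)$ ($\lambda_i$ the $i$-th largest eigenvalue) and $\Lambda=\log\big((c+\frac{c}{R^2G^2\alpha^2})T^{1/3}\big)$, $$\sum_{t=1}^Tf_t(x^t)-\min_{x\in\mathcal K}\sum_{t=1}^Tf_t(x)\le 9\beta R^2T^{2/3}\Lambda+2RG\rho^{1/3}T^{2/3}+\big(36GR+\tfrac4\alpha\big)(\rho+1)^{2/3}T^{2/3}\Lambda+5R\rho^{1/2}T^{1/3}\sqrt{\Omega_\rho}\sqrt\Lambda+\big(6GR+\tfrac1\alpha\big)\frac{\rho^{1/3}\Omega_\rho}{G^2},$$ and the overall number of LOO calls is at most $0.65\,(8\rho^{1/3}T^{2/3}+T)$. Moreover, there is one program, independent of all the data, that always terminates and carries out such a run using at most $C\rho n$ real memory cells and at most $$C\big(\rho nT+\rho^{4/3}nT^{2/3}+\rho^{7/3}nT^{1/3}\big)$$ operations in addition to the internal cost of the LOO and of the gradient evaluations. Here operations are scalar arithmetic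 operations and square roots on reals, comparisons and transfers of single reals (vector and matrix operations are charged at their schoolbook cost), and the eigendecomposition of a symmetric $p\times p$ matrix is a primitive of cost $p^3$. -/

import Mathlib

open scoped Matrix

noncomputable section

namespace LooOns

/-- `ℝⁿ` with the Euclidean norm. -/
abbrev Vec (n : ℕ) : Type := EuclideanSpace ℝ (Fin n)

/-- The matrix-vector product `A v`. -/
def mv {m n : ℕ} (A : Matrix (Fin m) (Fin n) ℝ) (v : Vec n) : Vec m :=
  WithLp.toLp 2 (A *ᵥ v.ofLp)

/-- The bilinear form `uᵀ A v`. -/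
def bil {n : ℕ} (A : Matrix (Fin n) (Fin n) ℝ) (u v : Vec n) : ℝ :=
  u.ofLp ⬝ᵥ (A *ᵥ v.ofLp)

/-- The squared matrix-induced norm `‖v‖_A² = vᵀ A v`. -/
def normSqA {n : ℕ} (A : Matrix (Fin n) (Fin n) ℝ) (v : Vec n) : ℝ :=
  bil A v v

/-! ### The losses -/

/-- The curvature condition with parameter `α` for `f`, with gradient field `g` bounded by `G`, over
the ball of radius `r` centered at the origin. -/
def CurvatureCondition {n : ℕ} (r G α : ℝ) (f : Vec n → ℝ) (g : Vec n → Vec n) : Prop :=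
  ∀ η : ℝ, max (4 * G * r) (2 / α) ≤ η →
    ∀ x ∈ Metric.closedBall (0 : Vec n) r, ∀ y ∈ Metric.closedBall (0 : Vec n) r,
      f x - f y ≤ inner ℝ (g x) (x - y) - 1 / (2 * η) * (inner ℝ (g x) (x - y)) ^ 2

/-- The assumptions on a loss `f` with gradient field `g`: over the ball `3R𝓑` it is differentiable,
`β`-smooth, has gradients bounded by `G`, and satisfies the curvature condition with parameter `α`. -/
structure IsAdmissibleLoss {n : ℕ} (R G α β : ℝ) (f : Vec n → ℝ) (g : Vec n → Vec n) : Prop where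
  hasGradient : ∀ x ∈ Metric.closedBall (0 : Vec n) (3 * R),
    HasGradientWithinAt f (g x) (Metric.closedBall (0 : Vec n) (3 * R)) x
  smooth : ∀ x ∈ Metric.closedBall (0 : Vec n) (3 * R),
    ∀ y ∈ Metric.closedBall (0 : Vec n) (3 * R), ‖g x - g y‖ ≤ β * ‖x - y‖
  bounded : ∀ x ∈ Metric.closedBall (0 : Vec n) (3 * R), ‖g x‖ ≤ G
  curvature : CurvatureCondition (3 * R) G α f g

/-! ### The algorithms

All runs are described as relations, so that every admissible answer of the linear optimization
oracle, every eigendecomposition and every initial point is covered. -/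

/-- `v` is an admissible answer of the linear optimization oracle (LOO) of `𝒦` to the query `g`. -/
def IsLOOAnswer {n : ℕ} (𝒦 : Set (Vec n)) (g v : Vec n) : Prop :=
  v ∈ 𝒦 ∧ ∀ z ∈ 𝒦, inner ℝ v g ≤ inner ℝ z g

/-- The stopping test of the Frank-Wolfe routine at the iterate `x` with oracle answer `v`. -/
def FWStop {n : ℕ} (A : Matrix (Fin n) (Fin n) ℝ) (ε : ℝ) (y x v : Vec n) : Prop :=
  bil A (x - y) (x - v) ≤ ε ∨ normSqA A (x - y) ≤ 3 * ε

/-- `FWRun 𝒦 A ε y x x' k`: the separating-hyperplane routine (Frank-Wolfe with line search for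
`min_{x ∈ 𝒦} ‖x - y‖_A²`), started at `x`, returns `x'` after exactly `k` calls to the LOO. -/
inductive FWRun {n : ℕ} (𝒦 : Set (Vec n)) (A : Matrix (Fin n) (Fin n) ℝ) (ε : ℝ) (y : Vec n) :
    Vec n → Vec n → ℕ → Prop
  | finish (x v : Vec n) (hv : IsLOOAnswer 𝒦 (mv A (x - y)) v) (hs : FWStop A ε y x v) :
      FWRun 𝒦 A ε y x x 1
  | step (x v x' : Vec n) (σ : ℝ) (k : ℕ) (hv : IsLOOAnswer 𝒦 (mv A (x - y)) v)
      (hs : ¬ FWStop A ε y x v) (hσ : σ ∈ Set.Icc (0 : ℝ) 1)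
      (hmin : ∀ τ ∈ Set.Icc (0 : ℝ) 1,
        normSqA A (y - x - σ • (v - x)) ≤ normSqA A (y - x - τ • (v - x)))
      (hrun : FWRun 𝒦 A ε y (x + σ • (v - x)) x' k) :
      FWRun 𝒦 A ε y x x' (k + 1)

/-- The loop of the approximately-feasible projection with step size `γ`:
`AFPLoop 𝒦 A ε γ x y x' y' k` says that, entered with previous feasible point `x` and current
point `y`, it returns `(x', y')` after exactly `k` calls to the LOO. -/
inductive AFPLoop {n : ℕ} (𝒦 : Set (Vec n)) (A : Matrix (Fin n) (Fin n) ℝ) (ε γ : ℝ) :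
    Vec n → Vec n → Vec n → Vec n → ℕ → Prop
  | done (x y x' : Vec n) (k : ℕ) (hfw : FWRun 𝒦 A ε y x x' k)
      (hclose : normSqA A (x' - y) ≤ 3 * ε) :
      AFPLoop 𝒦 A ε γ x y x' y k
  | pull (x y x₁ x' y' : Vec n) (k j : ℕ) (hfw : FWRun 𝒦 A ε y x x₁ k)
      (hfar : 3 * ε < normSqA A (x₁ - y))
      (hloop : AFPLoop 𝒦 A ε γ x₁ (y - γ • (y - x₁)) x' y' j) :
      AFPLoop 𝒦 A ε γ x y x' y' (k + j)

/-- The approximately-feasible projection via the LOO: on input `(x₀, y₁)` it returns `(x', y')`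
after exactly `k` calls to the LOO. -/
inductive AFPRun {n : ℕ} (𝒦 : Set (Vec n)) (A : Matrix (Fin n) (Fin n) ℝ) (ε γ : ℝ)
    (x₀ y₁ : Vec n) : Vec n → Vec n → ℕ → Prop
  | immediate (h : normSqA A (x₀ - y₁) ≤ 3 * ε) : AFPRun 𝒦 A ε γ x₀ y₁ x₀ y₁ 0
  | loop (x' y' : Vec n) (k : ℕ) (h : 3 * ε < normSqA A (x₀ - y₁))
      (hloop : AFPLoop 𝒦 A ε γ x₀ y₁ x' y' k) : AFPRun 𝒦 A ε γ x₀ y₁ x' y' k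

/-- `MᵀM = Vᵀ diag(d) V` is a (thin) eigendecomposition of `MᵀM` for a `p × n` matrix `M`: the
eigenvalues `d` are in non-increasing order and the rows of `V` are orthonormal. If `p > n`, there
are only `n` orthonormal rows; the remaining rows are zero and belong to the value `0`. -/
structure IsThinEigen {p n : ℕ} (M V : Matrix (Fin p) (Fin n) ℝ) (d : Fin p → ℝ) : Prop where
  antitone : Antitone d
  decomp : Vᵀ * Matrix.diagonal d * V = Mᵀ * M
  orthonormal : V * Vᵀ = Matrix.diagonal (fun i : Fin p => if (i : ℕ) < n then (1 : ℝ) else 0)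
  pad : ∀ i : Fin p, n ≤ (i : ℕ) → d i = 0

/-- One step of the Frequent Directions sketch of size `ρ`: the vector `g` becomes the last row of
`S`, and `S' = (Σ̂ - σ I)^{1/2} V`, where `Vᵀ Σ̂ V` is an eigendecomposition of `SᵀS` after the
insertion and `σ` is the last entry of `Σ̂`. -/
def FDStep {n ρ : ℕ} (S : Matrix (Fin (ρ + 1)) (Fin n) ℝ) (g : Vec n)
    (S' : Matrix (Fin (ρ + 1)) (Fin n) ℝ) : Prop :=
  ∃ (V : Matrix (Fin (ρ + 1)) (Fin n) ℝ) (d : Fin (ρ + 1) → ℝ),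
    IsThinEigen (S.updateRow (Fin.last ρ) g.ofLp) V d ∧
    S' = Matrix.diagonal (fun i => Real.sqrt (d i - d (Fin.last ρ))) * V

/-- The matrix `A = ε_I I + SᵀS` generated by the sketch `S`. -/
def sketchA {n ρ : ℕ} (εI : ℝ) (S : Matrix (Fin (ρ + 1)) (Fin n) ℝ) : Matrix (Fin n) (Fin n) ℝ :=
  εI • (1 : Matrix (Fin n) (Fin n) ℝ) + Sᵀ * S

/-- The parameters of the online Newton step: learning rate, error tolerance, initialization
parameter, block length and number of blocks. -/
structure Params where
  η : ℝ
  ε : ℝ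
  εI : ℝ
  K : ℕ
  M : ℕ

/-- The data of a run. Blocks are numbered `m = 0, …, M - 1` and rounds `t = 0, …, MK - 1`; block `m`
consists of the rounds `mK, …, mK + K - 1`. `x m` and `yt m` are the feasible and the infeasible
iterate used in block `m`, `y (m + 1)` is the point that is projected at the end of block `m`,
`S m` is the sketch before block `m`, and `calls m` is the number of LOO calls made in block `m`. -/
structure Run (n ρ : ℕ) where
  x : ℕ → Vec n
  yt : ℕ → Vec n
  y : ℕ → Vec n
  S : ℕ → Matrix (Fin (ρ + 1)) (Fin n) ℝ
  calls : ℕ → ℕ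

/-- The gradient `∇_t` observed in round `t` by a run with block length `K`. -/
def Run.grad {n ρ : ℕ} (r : Run n ρ) (K : ℕ) (g : ℕ → Vec n → Vec n) (t : ℕ) : Vec n :=
  g t (r.yt (t / K))

/-- The sum of the gradients observed in block `m`. -/
def Run.blockGrad {n ρ : ℕ} (r : Run n ρ) (K : ℕ) (g : ℕ → Vec n → Vec n) (m : ℕ) : Vec n :=
  ∑ s ∈ Finset.range K, g (m * K + s) (r.yt m)

/-- `r` is a run of the LOO-based online Newton step with the Frequent Directions sketch of size `ρ`,
on losses with gradient fields `g t`, from the initial point `x₁`. -/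
structure IsRun {n ρ : ℕ} (𝒦 : Set (Vec n)) (g : ℕ → Vec n → Vec n) (x₁ : Vec n) (P : Params)
    (r : Run n ρ) : Prop where
  x_init : r.x 0 = x₁
  yt_init : r.yt 0 = x₁
  S_init : r.S 0 = 0
  sketch : ∀ m < P.M, FDStep (r.S m) (r.blockGrad P.K g m) (r.S (m + 1))
  newton : ∀ m < P.M, r.y (m + 1) =
    r.yt m - P.η • mv (sketchA P.εI (r.S (m + 1)))⁻¹ (r.blockGrad P.K g m)
  project : ∀ m < P.M, AFPRun 𝒦 (sketchA P.εI (r.S (m + 1))) P.ε (2 / 3) (r.x m) (r.y (m + 1))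
    (r.x (m + 1)) (r.yt (m + 1)) (r.calls m)

/-- The overall number of LOO calls of a run with `M` blocks. -/
def Run.totalCalls {n ρ : ℕ} (r : Run n ρ) (M : ℕ) : ℕ := ∑ m ∈ Finset.range M, r.calls m

/-- The regret after `T` rounds when `r.x (t / K)` is played in round `t`. -/
def Run.regret {n ρ : ℕ} (r : Run n ρ) (𝒦 : Set (Vec n)) (f : ℕ → Vec n → ℝ) (T K : ℕ) : ℝ :=
  ∑ t ∈ Finset.range T, f t (r.x (t / K)) -
    sInf ((fun z => ∑ t ∈ Finset.range T, f t z) '' 𝒦)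

/-- The matrix `∑_{t < T} v_t v_tᵀ`. -/
def gramSum {n : ℕ} (v : ℕ → Vec n) (T : ℕ) : Matrix (Fin n) (Fin n) ℝ :=
  ∑ t ∈ Finset.range T, Matrix.vecMulVec (v t).ofLp (v t).ofLp

theorem gramSum_isHermitian {n : ℕ} (v : ℕ → Vec n) (T : ℕ) : (gramSum v T).IsHermitian := by
  unfold gramSum Matrix.IsHermitian
  rw [Matrix.conjTranspose_sum]
  refine Finset.sum_congr rfl fun t _ => ?_
  ext i j
  simp [Matrix.vecMulVec_apply, mul_comm]

/-- `Ω_ρ`: the sum of all but the `ρ` largest eigenvalues of `∑_{t < T} v_t v_tᵀ`. -/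
def tailEigen {n : ℕ} (v : ℕ → Vec n) (T ρ : ℕ) : ℝ :=
  ∑ i : Fin (Fintype.card (Fin n)),
    if ρ ≤ (i : ℕ) then (gramSum_isHermitian v T).eigenvalues₀ i else 0

/-! ### The choice of parameters -/

/-- `η = 8 max{6GR, 1/α} ρ^{-1/3} T^{2/3}` -/
def etaChoice (ρ T : ℕ) (R G α : ℝ) : ℝ :=
  8 * max (6 * G * R) (1 / α) * (ρ : ℝ) ^ (-(1 / 3) : ℝ) * (T : ℝ) ^ (2 / 3 : ℝ)

/-- `ε_I = 32 G² T^{4/3}` -/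
def epsIChoice (T : ℕ) (G : ℝ) : ℝ := 32 * G ^ 2 * (T : ℝ) ^ (4 / 3 : ℝ)

/-- `ε = 96 G² R² log(19 + 8 (12 + 1 / (3R²G²α²)) ρ^{-4/3} T^{1/3}) T` -/
def epsChoice (ρ T : ℕ) (R G α : ℝ) : ℝ :=
  96 * G ^ 2 * R ^ 2 *
    Real.log (19 + 8 * (12 + 1 / (3 * R ^ 2 * G ^ 2 * α ^ 2)) *
      (ρ : ℝ) ^ (-(4 / 3) : ℝ) * (T : ℝ) ^ (1 / 3 : ℝ)) * T

/-- The parameters for sketch size `ρ`, horizon `T` and block length `K`. -/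
def paramChoice (ρ T K : ℕ) (R G α : ℝ) : Params where
  η := etaChoice ρ T R G α
  ε := epsChoice ρ T R G α
  εI := epsIChoice T G
  K := K
  M := T / K

/-- `T₀ = c log³(c + (c + c / (R²G²α²)) ρ^{-4/3} T^{1/3})` -/
def horizonThreshold (c : ℝ) (ρ T : ℕ) (R G α : ℝ) : ℝ :=
  c * Real.log (c + (c + c / (R ^ 2 * G ^ 2 * α ^ 2)) *
    (ρ : ℝ) ^ (-(4 / 3) : ℝ) * (T : ℝ) ^ (1 / 3 : ℝ)) ^ 3

/-- `log((c + c / (R²G²α²)) T^{1/3})` -/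
def logFactor (c : ℝ) (T : ℕ) (R G α : ℝ) : ℝ :=
  Real.log ((c + c / (R ^ 2 * G ^ 2 * α ^ 2)) * (T : ℝ) ^ (1 / 3 : ℝ))

/-- The regret bound; `Ω` stands for `Ω_ρ`. -/
def regretBound (c : ℝ) (ρ T : ℕ) (R G α β Ω : ℝ) : ℝ :=
  9 * β * R ^ 2 * (T : ℝ) ^ (2 / 3 : ℝ) * logFactor c T R G α
    + 2 * R * G * (ρ : ℝ) ^ (1 / 3 : ℝ) * (T : ℝ) ^ (2 / 3 : ℝ)
    + (36 * G * R + 4 / α) * ((ρ : ℝ) + 1) ^ (2 / 3 : ℝ) * (T : ℝ) ^ (2 / 3 : ℝ)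
        * logFactor c T R G α
    + 5 * R * (ρ : ℝ) ^ (1 / 2 : ℝ) * (T : ℝ) ^ (1 / 3 : ℝ) * Real.sqrt Ω
        * Real.sqrt (logFactor c T R G α)
    + (6 * G * R + 1 / α) * ((ρ : ℝ) ^ (1 / 3 : ℝ) * Ω / G ^ 2)

/-! ### The machine model

A real-arithmetic machine for running time and space. It has `r` registers of each of five kinds:
scalars, `n`-vectors, `(ρ+1)`-vectors, `(ρ+1) × n` matrices and `(ρ+1) × (ρ+1)` matrices. The cost of
an instruction is the number of scalar operations of its schoolbook execution; space is the number
of real memory cells. A program is a finite object that does not depend on `n`, `ρ` or `T`.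
The only non-arithmetic primitive is the eigendecomposition of a symmetric `p × p` matrix, at the
customary cost `p³`. -/

/-- Binary arithmetic on scalars (with `a / 0 = 0`). -/
inductive Arith
  | add
  | sub
  | mul
  | div

/-- The value of an arithmetic operation. -/
def Arith.eval : Arith → ℝ → ℝ → ℝ
  | .add, a, b => a + b
  | .sub, a, b => a - b
  | .mul, a, b => a * b
  | .div, a, b => a / b

/-- The scalar inputs of a program. -/
inductive Input
  | eta
  | eps
  | epsI
  | blockLen
  | blocks

/-- The value of a scalar input. -/
def Input.eval (P : Params) : Input → ℝ
  | .eta => P.η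
  | .eps => P.ε
  | .epsI => P.εI
  | .blockLen => P.K
  | .blocks => P.M

/-- Instructions; the destination is the first argument, except for `round`. -/
inductive Instr (r : ℕ)
  /-- load a scalar input -/
  | input (d : Fin r) (k : Input)
  /-- load the initial point -/
  | start (d : Fin r)
  /-- load a rational constant -/
  | const (d : Fin r) (q : ℚ)
  /-- scalar arithmetic -/
  | arith (op : Arith) (d a b : Fin r)
  /-- `d ← a x + y` for a scalar `a` and `n`-vectors `x`, `y` -/
  | axpy (d a x y : Fin r)
  /-- scalar `d ← xᵀ y` for `n`-vectors -/
  | dot (d x y : Fin r)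
  /-- short vector `d ← M x` -/
  | mulVec (d M x : Fin r)
  /-- `n`-vector `d ← Mᵀ w` -/
  | mulVecT (d M w : Fin r)
  /-- entrywise arithmetic on short vectors -/
  | shortArith (op : Arith) (d a b : Fin r)
  /-- entrywise square root of a short vector -/
  | shortSqrt (d a : Fin r)
  /-- fill a short vector with a scalar -/
  | shortFill (d a : Fin r)
  /-- scalar `d ←` last entry of a short vector -/
  | shortLast (d a : Fin r)
  /-- overwrite the last row of the matrix `d` by the `n`-vector `x` -/
  | setLastRow (d x : Fin r)
  /-- small matrix `d ← M Mᵀ` -/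
  | gram (d M : Fin r)
  /-- eigenvalues (short vector `d`) and eigenvectors (small matrix `u`) of the small matrix `a` -/
  | eigen (d u a : Fin r)
  /-- `d ← Uᵀ M` for a small matrix `U` -/
  | smallTMul (d u M : Fin r)
  /-- `d ← diag(w) M` for a short vector `w` -/
  | diagMul (d w M : Fin r)
  /-- call the LOO with the `n`-vector `a`; the answer goes to `d` -/
  | loo (d a : Fin r)
  /-- one round of the online protocol: play the point `x`, then observe the gradient of the loss of
  this round at the point `y`; it goes to `d` -/
  | round (x y d : Fin r)

/-- Number of scalar operations of an instruction (without the internal cost of the LOO and of the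
gradient evaluation, which are charged only for the transfer of a vector). -/
def Instr.cost {r : ℕ} (n ρ : ℕ) : Instr r → ℕ
  | .input _ _ => 1
  | .start _ => n
  | .const _ _ => 1
  | .arith _ _ _ _ => 1
  | .axpy _ _ _ _ => 2 * n
  | .dot _ _ _ => 2 * n
  | .mulVec _ _ _ => 2 * (ρ + 1) * n
  | .mulVecT _ _ _ => 2 * (ρ + 1) * n
  | .shortArith _ _ _ _ => ρ + 1
  | .shortSqrt _ _ => ρ + 1
  | .shortFill _ _ => ρ + 1
  | .shortLast _ _ => 1
  | .setLastRow _ _ => n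
  | .gram _ _ => 2 * (ρ + 1) ^ 2 * n
  | .eigen _ _ _ => (ρ + 1) ^ 3
  | .smallTMul _ _ _ => 2 * (ρ + 1) ^ 2 * n
  | .diagMul _ _ _ => (ρ + 1) * n
  | .loo _ _ => n
  | .round _ _ _ => n

/-- What a program interacts with: its inputs, the LOO, the gradient fields of the losses, and the
eigendecomposition primitive. -/
structure Env (n ρ : ℕ) where
  params : Params
  x₁ : Vec n
  loo : Vec n → Vec n
  grad : ℕ → Vec n → Vec n
  eig : Matrix (Fin (ρ + 1)) (Fin (ρ + 1)) ℝ →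
    (Fin (ρ + 1) → ℝ) × Matrix (Fin (ρ + 1)) (Fin (ρ + 1)) ℝ

/-- `eig` returns, for every symmetric matrix, its eigenvalues in non-increasing order and an
orthogonal matrix of eigenvectors (as columns). -/
def IsEigenSolver {p : ℕ}
    (eig : Matrix (Fin p) (Fin p) ℝ → (Fin p → ℝ) × Matrix (Fin p) (Fin p) ℝ) : Prop :=
  ∀ B : Matrix (Fin p) (Fin p) ℝ, B.IsSymm →
    Antitone (eig B).1 ∧ (eig B).2 * (eig B).2ᵀ = 1 ∧
      B = (eig B).2 * Matrix.diagonal (eig B).1 * (eig B).2ᵀ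

/-- Machine states. Besides the registers: the number of LOO calls and the elapsed time so far, and
the pairs (played point, point of gradient evaluation) of the rounds so far, in order. -/
structure State (r n ρ : ℕ) where
  sc : Fin r → ℝ
  vec : Fin r → Vec n
  short : Fin r → Fin (ρ + 1) → ℝ
  mat : Fin r → Matrix (Fin (ρ + 1)) (Fin n) ℝ
  small : Fin r → Matrix (Fin (ρ + 1)) (Fin (ρ + 1)) ℝ
  log : List (Vec n × Vec n)
  looCalls : ℕ
  time : ℕ

/-- The number of real memory cells of a machine with `r` registers of each kind. -/
def memoryCells (r n ρ : ℕ) : ℕ := r * (1 + n + (ρ + 1) + (ρ + 1) * n + (ρ + 1) * (ρ + 1))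

/-- The initial state: all registers are zero. -/
def State.init (r n ρ : ℕ) : State r n ρ where
  sc := fun _ => 0
  vec := fun _ => 0
  short := fun _ => 0
  mat := fun _ => 0
  small := fun _ => 0
  log := []
  looCalls := 0
  time := 0

/-- The effect of an instruction, except for the elapsed time. -/
def Instr.effect {r n ρ : ℕ} (e : Env n ρ) (s : State r n ρ) : Instr r → State r n ρ
  | .input d k => { s with sc := Function.update s.sc d (k.eval e.params) }
  | .start d => { s with vec := Function.update s.vec d e.x₁ }
  | .const d q => { s with sc := Function.update s.sc d (q : ℝ) }
  | .arith op d a b => { s with sc := Function.update s.sc d (op.eval (s.sc a) (s.sc b)) }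
  | .axpy d a x y => { s with vec := Function.update s.vec d (s.sc a • s.vec x + s.vec y) }
  | .dot d x y => { s with sc := Function.update s.sc d (inner ℝ (s.vec x) (s.vec y)) }
  | .mulVec d M x =>
      { s with short := Function.update s.short d (s.mat M *ᵥ (s.vec x).ofLp) }
  | .mulVecT d M w =>
      { s with vec := Function.update s.vec d (WithLp.toLp 2 ((s.mat M)ᵀ *ᵥ s.short w)) }
  | .shortArith op d a b =>
      { s with
        short := Function.update s.short d (fun i => op.eval (s.short a i) (s.short b i)) }
  | .shortSqrt d a =>
      { s with short := Function.update s.short d (fun i => Real.sqrt (s.short a i)) }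
  | .shortFill d a => { s with short := Function.update s.short d (fun _ => s.sc a) }
  | .shortLast d a => { s with sc := Function.update s.sc d (s.short a (Fin.last ρ)) }
  | .setLastRow d x =>
      { s with
        mat := Function.update s.mat d ((s.mat d).updateRow (Fin.last ρ) (s.vec x).ofLp) }
  | .gram d M => { s with small := Function.update s.small d (s.mat M * (s.mat M)ᵀ) }
  | .eigen d u a =>
      { s with
        short := Function.update s.short d (e.eig (s.small a)).1
        small := Function.update s.small u (e.eig (s.small a)).2 }
  | .smallTMul d u M =>
      { s with mat := Function.update s.mat d ((s.small u)ᵀ * s.mat M) }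
  | .diagMul d w M =>
      { s with mat := Function.update s.mat d (Matrix.diagonal (s.short w) * s.mat M) }
  | .loo d a =>
      { s with vec := Function.update s.vec d (e.loo (s.vec a)), looCalls := s.looCalls + 1 }
  | .round x y d =>
      { s with
        vec := Function.update s.vec d (e.grad s.log.length (s.vec y))
        log := s.log ++ [(s.vec x, s.vec y)] }

/-- Let `k` time units elapse. -/
def State.tick {r n ρ : ℕ} (s : State r n ρ) (k : ℕ) : State r n ρ :=
  { s with time := s.time + k }

/-- Programs. Tests compare two scalar registers. -/
inductive Prog (r : ℕ)
  | instr (i : Instr r)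
  | seq (p q : Prog r)
  /-- if `a ≤ b` then `p` else `q` -/
  | ite (a b : Fin r) (p q : Prog r)
  /-- as long as `a < b`, repeat `p` -/
  | loop (a b : Fin r) (p : Prog r)

/-- `Exec e p s s'`: in the environment `e`, the program `p` started in state `s` terminates in
state `s'`. -/
inductive Exec {r n ρ : ℕ} (e : Env n ρ) : Prog r → State r n ρ → State r n ρ → Prop
  | instr (i : Instr r) (s : State r n ρ) :
      Exec e (.instr i) s ((i.effect e s).tick (i.cost n ρ))
  | seq (p q : Prog r) (s s₁ s₂ : State r n ρ) (hp : Exec e p s s₁) (hq : Exec e q s₁ s₂) :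
      Exec e (.seq p q) s s₂
  | ite_true (a b : Fin r) (p q : Prog r) (s s₁ : State r n ρ) (h : s.sc a ≤ s.sc b)
      (hp : Exec e p (s.tick 1) s₁) : Exec e (.ite a b p q) s s₁
  | ite_false (a b : Fin r) (p q : Prog r) (s s₁ : State r n ρ) (h : ¬ s.sc a ≤ s.sc b)
      (hq : Exec e q (s.tick 1) s₁) : Exec e (.ite a b p q) s s₁
  | loop_false (a b : Fin r) (p : Prog r) (s : State r n ρ) (h : ¬ s.sc a < s.sc b) :
      Exec e (.loop a b p) s (s.tick 1)
  | loop_true (a b : Fin r) (p : Prog r) (s s₁ s₂ : State r n ρ) (h : s.sc a < s.sc b)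
      (hp : Exec e p (s.tick 1) s₁) (hw : Exec e (.loop a b p) s₁ s₂) :
      Exec e (.loop a b p) s s₂

/-- The sequence of played points and gradient-evaluation points of a run over `T` rounds. -/
def Run.protocol {n ρ : ℕ} (r : Run n ρ) (T K : ℕ) : List (Vec n × Vec n) :=
  (List.range T).map fun t => (r.x (t / K), r.yt (t / K))

end LooOns

end

open LooOns

/-! A feasible `z` is fixed and each block is split at the infeasible iterate `ỹ_m`. For `f(ỹ_m) -
f(z)` the online Newton step argument applies. Cauchy-Schwarz turns the curvature conditions of the
`K` losses into one for the block gradient `b_m` (`block_sub_le`). Frequent Directions gives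
`A_{m+1} ≤ A_m + b_m b_mᵀ`, so the negative square from the curvature pays for the change of norm,
and the approximate projection does not increase the `A_{m+1}`-distance to any feasible point. Hence
the squared distances telescope (`IsRun.newton_step_le`) and `η/2 · ∑ b_mᵀ A_{m+1}⁻¹ b_m` remains.
For `f(x_m) - f(ỹ_m)`, smoothness moves the gradient to `ỹ_m`; as `‖x_m - ỹ_m‖²` is at most `3ε` in
the norm of `A_m`, Young's inequality leaves `∑ b_mᵀ A_m⁻¹ b_m` (`IsRun.block_loss_le`).

Both sums are controlled by `log det`. A sketch step changes `A` by `b bᵀ - σ VᵀV`, and concavity of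
`log det` converts each summand (or its logarithm) into an increment of `log det A` plus
`(ρ+1)σ/ε_I` (`FDStep.spec`). The sketch has rank at most `ρ`, so `log det` grows by at most `ρ
log(1 + trace/(ρ ε_I))` (`log_det_sketchA_le`). The trace loses `(ρ+1)σ` per step while no direction
loses more than `σ`; comparing the two on the top `ρ` eigenvectors gives `∑ σ ≤ K Ω_ρ`
(`sum_shrinkage_le_tailEigen`).

For the oracle calls, one Frank-Wolfe run needs at most `4D/ε + 2` calls, `D` being a bound on the
squared diameter (`FWRun.calls_le`). If it ends far from `y`, its small dual gap is an approximate
separating hyperplane, and the pull shrinks a bound on the squared distance from `y` to `𝒦` by the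
factor `5/9` (`exists_near_pull`). No pull happens once that distance is at most `ε`, so the number
of pulls is logarithmic. The logarithm inside `ε` is chosen to dominate this number, which removes
it from the total.

The program never forms an `n × n` matrix: it applies `A` as `ε_I + SᵀS`, diagonalizes the small
Gram matrix of the sketch (`fdStep_eigSketch`) and inverts `A` by `woodbury`. Its execution produces
a run together with a time bound in terms of that run's own oracle calls (`main_exec`), so the bound
valid for all runs also bounds the time. -/

namespace LooOns

/-! ### The bilinear form -/

section Bil

variable {n : ℕ} (A : Matrix (Fin n) (Fin n) ℝ)

theorem bil_sub_left (u v w : Vec n) : bil A (u - v) w = bil A u w - bil A v w := by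
  simp [bil, sub_dotProduct]

theorem bil_sub_right (u v w : Vec n) : bil A u (v - w) = bil A u v - bil A u w := by
  simp [bil, Matrix.mulVec_sub, dotProduct_sub]

theorem bil_smul_left (a : ℝ) (u v : Vec n) : bil A (a • u) v = a * bil A u v := by
  simp [bil]

theorem bil_smul_right (a : ℝ) (u v : Vec n) : bil A u (a • v) = a * bil A u v := by
  simp [bil, Matrix.mulVec_smul]

theorem bil_add_matrix (B : Matrix (Fin n) (Fin n) ℝ) (u v : Vec n) :
    bil (A + B) u v = bil A u v + bil B u v := by
  simp [bil, Matrix.add_mulVec, dotProduct_add]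

theorem bil_sub_matrix (B : Matrix (Fin n) (Fin n) ℝ) (u v : Vec n) :
    bil (A - B) u v = bil A u v - bil B u v := by
  simp [bil, Matrix.sub_mulVec, dotProduct_sub]

theorem bil_smul_matrix (a : ℝ) (u v : Vec n) : bil (a • A) u v = a * bil A u v := by
  simp [bil, Matrix.smul_mulVec]

theorem inner_eq_dotProduct {m : ℕ} (u v : Vec m) : inner ℝ u v = u.ofLp ⬝ᵥ v.ofLp := by
  rw [EuclideanSpace.inner_eq_star_dotProduct, dotProduct_comm]
  simp

theorem bil_eq_inner (u v : Vec n) : bil A u v = inner ℝ u (mv A v) := by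
  rw [inner_eq_dotProduct]; rfl

theorem bil_one (u v : Vec n) : bil 1 u v = inner ℝ u v := by
  rw [inner_eq_dotProduct]; simp [bil]

theorem bil_transpose_mul {m : ℕ} (S : Matrix (Fin m) (Fin n) ℝ) (u v : Vec n) :
    bil (Sᵀ * S) u v = inner ℝ (mv S u) (mv S v) := by
  rw [inner_eq_dotProduct]
  simp only [bil, mv, ← Matrix.mulVec_mulVec]
  rw [Matrix.dotProduct_mulVec, Matrix.vecMul_transpose]

theorem bil_vecMulVec (g u v : Vec n) :
    bil (Matrix.vecMulVec g.ofLp g.ofLp) u v = inner ℝ g u * inner ℝ g v := by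
  rw [inner_eq_dotProduct, inner_eq_dotProduct]
  simp only [bil, Matrix.vecMulVec_mulVec]
  simp [dotProduct_comm, mul_comm]

variable {A}

theorem bil_comm (hA : A.IsSymm) (u v : Vec n) : bil A u v = bil A v u := by
  unfold bil
  rw [Matrix.dotProduct_mulVec, dotProduct_comm, ← Matrix.mulVec_transpose, hA.eq]

theorem normSqA_sub_smul (hA : A.IsSymm) (u v : Vec n) (a : ℝ) :
    normSqA A (u - a • v) = normSqA A u - 2 * a * bil A u v + a ^ 2 * normSqA A v := by
  simp only [normSqA, bil_sub_left, bil_sub_right, bil_smul_left, bil_smul_right]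
  rw [bil_comm hA v u]; ring

theorem normSqA_sub (hA : A.IsSymm) (u v : Vec n) :
    normSqA A (u - v) = normSqA A u - 2 * bil A u v + normSqA A v := by
  simp only [normSqA, bil_sub_left, bil_sub_right]
  rw [bil_comm hA v u]; ring

theorem normSqA_smul (a : ℝ) (v : Vec n) : normSqA A (a • v) = a ^ 2 * normSqA A v := by
  simp only [normSqA, bil_smul_left, bil_smul_right]; ring

theorem normSqA_sub_comm (u v : Vec n) : normSqA A (u - v) = normSqA A (v - u) := by
  simp only [normSqA, bil_sub_left, bil_sub_right]; ring

/-- Parallelogram law; the discarded term is `‖u + v‖_A²`. -/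
theorem normSqA_sub_le (hA : A.IsSymm) (hpos : ∀ v, 0 ≤ normSqA A v) (u v : Vec n) :
    normSqA A (u - v) ≤ 2 * normSqA A u + 2 * normSqA A v := by
  have h := hpos (u - (-1 : ℝ) • v)
  rw [normSqA_sub_smul hA] at h
  rw [normSqA_sub hA]
  linarith

/-- Young's inequality for the form `A`. -/
theorem bil_le_young (hA : A.IsSymm) (hpos : ∀ v, 0 ≤ normSqA A v) (u v : Vec n) {l : ℝ}
    (hl : 0 < l) : bil A u v ≤ (l * normSqA A u + normSqA A v / l) / 2 := by
  have h := hpos (u - l⁻¹ • v)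
  rw [normSqA_sub_smul hA] at h
  have h2 := mul_nonneg hl.le h
  have : l * (normSqA A u - 2 * l⁻¹ * bil A u v + l⁻¹ ^ 2 * normSqA A v)
      = l * normSqA A u - 2 * bil A u v + normSqA A v / l := by
    field_simp
  linarith

end Bil

/-! ### The Frank-Wolfe routine -/

section FrankWolfe

variable {n : ℕ} {𝒦 : Set (Vec n)} {A : Matrix (Fin n) (Fin n) ℝ} {ε : ℝ} {y : Vec n}

theorem convex_step_mem (h𝒦 : Convex ℝ 𝒦) {x v : Vec n} (hx : x ∈ 𝒦) (hv : v ∈ 𝒦) {σ : ℝ}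
    (hσ : σ ∈ Set.Icc (0 : ℝ) 1) : x + σ • (v - x) ∈ 𝒦 :=
  h𝒦.add_smul_sub_mem hx hv hσ

theorem FWRun.mem (h𝒦 : Convex ℝ 𝒦) {x x' : Vec n} {k : ℕ} (h : FWRun 𝒦 A ε y x x' k)
    (hx : x ∈ 𝒦) : x' ∈ 𝒦 := by
  induction h with
  | finish x v hv hs => exact hx
  | step x v x' σ k hv hs hσ hmin hrun ih => exact ih (convex_step_mem h𝒦 hx hv.1 hσ)

theorem FWRun.exists_last_oracle_answer {x x' : Vec n} {k : ℕ} (h : FWRun 𝒦 A ε y x x' k) :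
    ∃ v, IsLOOAnswer 𝒦 (mv A (x' - y)) v ∧ FWStop A ε y x' v := by
  induction h with
  | finish x v hv hs => exact ⟨v, hv, hs⟩
  | step x v x' σ k hv hs hσ hmin hrun ih => exact ih

theorem FWRun.one_le {x x' : Vec n} {k : ℕ} (h : FWRun 𝒦 A ε y x x' k) : 1 ≤ k := by
  cases h <;> omega

theorem IsLOOAnswer.bil_sub_le (hA : A.IsSymm) {x v : Vec n}
    (hv : IsLOOAnswer 𝒦 (mv A (x - y)) v) {z : Vec n} (hz : z ∈ 𝒦) :
    bil A (x - y) (x - z) ≤ bil A (x - y) (x - v) := by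
  have := hv.2 z hz
  rw [← bil_eq_inner, ← bil_eq_inner, bil_comm hA v, bil_comm hA z] at this
  rw [bil_sub_right, bil_sub_right]
  linarith

/-- The dual gap bounds the primal suboptimality. -/
theorem normSqA_sub_normSqA_le (hA : A.IsSymm) (hpos : ∀ v, 0 ≤ normSqA A v) (x y z : Vec n) :
    normSqA A (x - y) - normSqA A (z - y) ≤ 2 * bil A (x - y) (x - z) := by
  have h := hpos (x - z)
  have e : z - y = (x - y) - (x - z) := by abel
  rw [e, normSqA_sub hA (x - y)]
  linarith

/-- Exact line search is at least as good as any fixed step `τ`; suitable choices of `τ` give the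
two progress estimates below. -/
theorem lineSearch_le (hA : A.IsSymm) {x v : Vec n} {σ D : ℝ}
    (hD : normSqA A (x - v) ≤ D)
    (hmin : ∀ τ ∈ Set.Icc (0 : ℝ) 1,
        normSqA A (y - x - σ • (v - x)) ≤ normSqA A (y - x - τ • (v - x)))
    {τ : ℝ} (hτ : τ ∈ Set.Icc (0 : ℝ) 1) :
    normSqA A (x + σ • (v - x) - y) ≤
      normSqA A (x - y) - 2 * τ * bil A (x - y) (x - v) + τ ^ 2 * D := by
  have h := hmin τ hτ
  rw [normSqA_sub_smul hA (y - x) (v - x) τ] at h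
  have e1 : normSqA A (x + σ • (v - x) - y) = normSqA A (y - x - σ • (v - x)) := by
    rw [normSqA_sub_comm]; congr 1; abel
  have e2 : bil A (y - x) (v - x) = bil A (x - y) (x - v) := by
    simp only [bil_sub_left, bil_sub_right]; ring
  rw [normSqA_sub_comm v x, e2, normSqA_sub_comm y x] at h
  rw [e1]
  have := mul_le_mul_of_nonneg_left hD (sq_nonneg τ)
  linarith

/-- The quadratic in `τ` is minimal at `g / D`; if this exceeds `1`, the full step `τ = 1` already
gains `D / 2`. This is the progress available when nothing but `g > ε` is known. -/
theorem linear_progress {w w' g D ε : ℝ} (hε : 0 < ε) (hεD : ε ≤ D) (hg : ε < g)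
    (h : ∀ τ ∈ Set.Icc (0 : ℝ) 1, w' ≤ w - τ * g + τ ^ 2 * D / 2) :
    w' ≤ w - ε ^ 2 / (2 * D) := by
  have hD : 0 < D := hε.trans_le hεD
  by_cases hgD : g ≤ D
  · have := h (g / D) ⟨div_nonneg (hε.trans hg).le hD.le, (div_le_one hD).2 hgD⟩
    have e : w - g / D * g + (g / D) ^ 2 * D / 2 = w - g ^ 2 / (2 * D) := by field_simp; ring
    have h2 : ε ^ 2 / (2 * D) ≤ g ^ 2 / (2 * D) := by gcongr
    linarith
  · have := h 1 ⟨zero_le_one, le_rfl⟩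
    have h2 : ε ^ 2 / (2 * D) ≤ D / 2 := by
      rw [div_le_div_iff₀ (by positivity) (by positivity)]
      nlinarith
    push Not at hgD
    linarith

/-- The usual `O(1/k)` rate of Frank-Wolfe: when the gap `g` dominates the suboptimality `w`, the
potential `2D / w` grows by at least one per step. -/
theorem reciprocal_progress {w w' g D : ℝ} (hD : 0 < D) (hw : 0 < w) (hw' : 0 < w') (hg : w ≤ g)
    (h : ∀ τ ∈ Set.Icc (0 : ℝ) 1, w' ≤ w - τ * g + τ ^ 2 * D / 2) :
    2 * D / w + 1 ≤ 2 * D / w' := by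
  -- The claim with denominators cleared. For `g ≤ D` take `τ = g / D`. Otherwise `τ = 1` gives `w'
  -- ≤ w - D/2` from `g > D`, and `w' ≤ D/2` from `g ≥ w`; the smaller one is used.
  have key : (2 * D + w) * w' ≤ 2 * D * w := by
    by_cases hgD : g ≤ D
    · have h1 := h (g / D) ⟨div_nonneg (hw.le.trans hg) hD.le, (div_le_one hD).2 hgD⟩
      have e : w - g / D * g + (g / D) ^ 2 * D / 2 = w - g ^ 2 / (2 * D) := by field_simp; ring
      have h2 : w ^ 2 / (2 * D) ≤ g ^ 2 / (2 * D) := by gcongr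
      have h3 : w' ≤ w - w ^ 2 / (2 * D) := by linarith
      calc (2 * D + w) * w' ≤ (2 * D + w) * (w - w ^ 2 / (2 * D)) := by gcongr
        _ = 2 * D * w - w ^ 3 / (2 * D) := by field_simp; ring
        _ ≤ 2 * D * w := by
          have : 0 ≤ w ^ 3 / (2 * D) := by positivity
          linarith
    · push Not at hgD
      have h1 := h 1 ⟨zero_le_one, le_rfl⟩
      by_cases hwD : w ≤ D
      · have h3 : w' ≤ w - D / 2 := by linarith
        calc (2 * D + w) * w' ≤ (2 * D + w) * (w - D / 2) := by gcongr
          _ ≤ 2 * D * w := by nlinarith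
      · push Not at hwD
        have h3 : w' ≤ D / 2 := by linarith
        calc (2 * D + w) * w' ≤ (2 * D + w) * (D / 2) := by gcongr
          _ ≤ 2 * D * w := by nlinarith
  rw [div_add_one hw.ne', div_le_div_iff₀ hw hw']
  linarith

/-- The assumptions in the analysis of Frank-Wolfe for `min_{x ∈ 𝒦} ‖x - y‖_A²`; `D` bounds the
squared diameter of `𝒦`. -/
structure FWData (𝒦 : Set (Vec n)) (A : Matrix (Fin n) (Fin n) ℝ) (D : ℝ) : Prop where
  convex : Convex ℝ 𝒦
  symm : A.IsSymm
  nonneg : ∀ v, 0 ≤ normSqA A v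
  diam : ∀ u ∈ 𝒦, ∀ v ∈ 𝒦, normSqA A (u - v) ≤ D

/-- The optimal value enters only as a greatest lower bound `q`, so no minimizer has to exist. -/
theorem FWData.gap_ge {D : ℝ} (h : FWData 𝒦 A D) {q : ℝ}
    (hq : IsGLB ((fun z => normSqA A (z - y)) '' 𝒦) q) {x v : Vec n}
    (hv : IsLOOAnswer 𝒦 (mv A (x - y)) v) :
    (normSqA A (x - y) - q) / 2 ≤ bil A (x - y) (x - v) := by
  have : normSqA A (x - y) - 2 * bil A (x - y) (x - v) ≤ q := by
    refine hq.2 ?_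
    rintro _ ⟨z, hz, rfl⟩
    have h1 := normSqA_sub_normSqA_le h.symm h.nonneg x y z
    have h2 := hv.bil_sub_le h.symm hz
    simp only
    linarith
  linarith

/-- Every call but the last lowers half the suboptimality by `ε² / (2D)`, because the gap test has
failed. -/
theorem FWRun.calls_le_linear {D : ℝ} (h : FWData 𝒦 A D) (hε : 0 < ε) (hεD : ε ≤ D) {q : ℝ}
    (hq : IsGLB ((fun z => normSqA A (z - y)) '' 𝒦) q) {x x' : Vec n} {k : ℕ}
    (hrun : FWRun 𝒦 A ε y x x' k) (hx : x ∈ 𝒦) :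
    (k : ℝ) ≤ 1 + 2 * D / ε ^ 2 * ((normSqA A (x - y) - q) / 2) := by
  have hD : 0 < D := hε.trans_le hεD
  induction hrun with
  | finish x v hv hs =>
    have : q ≤ normSqA A (x - y) := hq.1 ⟨x, hx, rfl⟩
    have h2 : 0 ≤ 2 * D / ε ^ 2 * ((normSqA A (x - y) - q) / 2) :=
      mul_nonneg (by positivity) (by linarith)
    push_cast; linarith
  | step x v x' σ k hv hs hσ hmin hrun ih =>
    have ih := ih (convex_step_mem h.convex hx hv.1 hσ)
    unfold FWStop at hs
    push Not at hs
    have hp := linear_progress (w := (normSqA A (x - y) - q) / 2)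
      (w' := (normSqA A (x + σ • (v - x) - y) - q) / 2) hε hεD hs.1 (fun τ hτ => by
        have := lineSearch_le h.symm (h.diam x hx v hv.1) hmin hτ
        linarith)
    have h3 := mul_le_mul_of_nonneg_left hp (a := 2 * D / ε ^ 2) (by positivity)
    have e : 2 * D / ε ^ 2 * ((normSqA A (x - y) - q) / 2 - ε ^ 2 / (2 * D)) =
      2 * D / ε ^ 2 * ((normSqA A (x - y) - q) / 2) - 1 := by field_simp
    push_cast; linarith

/-- Two phases: while half the suboptimality is at least `ε`, `2D / w` grows by one per call and
cannot pass `2D / ε`; afterwards the linear count allows at most `1 + 2D / ε` further calls. -/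
theorem FWRun.calls_le_reciprocal {D : ℝ} (h : FWData 𝒦 A D) (hε : 0 < ε) (hεD : ε ≤ D) {q : ℝ}
    (hq : IsGLB ((fun z => normSqA A (z - y)) '' 𝒦) q) {x x' : Vec n} {k : ℕ}
    (hrun : FWRun 𝒦 A ε y x x' k) (hx : x ∈ 𝒦) (hw : ε ≤ (normSqA A (x - y) - q) / 2) :
    (k : ℝ) ≤ 2 + 4 * D / ε - 2 * D / ((normSqA A (x - y) - q) / 2) := by
  have hD : 0 < D := hε.trans_le hεD
  have key : ∀ w : ℝ, ε ≤ w → 2 * D / w ≤ 2 * D / ε := fun w hw => by gcongr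
  have e4 : 4 * D / ε = 2 * D / ε + 2 * D / ε := by ring
  induction hrun with
  | finish x v hv hs =>
    have := key _ hw
    have : 0 < 2 * D / ε := by positivity
    push_cast; linarith
  | step x v x' σ k hv hs hσ hmin hrun ih =>
    have hx' := convex_step_mem h.convex hx hv.1 hσ
    by_cases hw' : ε ≤ (normSqA A (x + σ • (v - x) - y) - q) / 2
    · have ih := ih hx' hw'
      have := reciprocal_progress (w := (normSqA A (x - y) - q) / 2)
        (w' := (normSqA A (x + σ • (v - x) - y) - q) / 2) hD (hε.trans_le hw) (hε.trans_le hw')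
        (h.gap_ge hq hv) (fun τ hτ => by
          have := lineSearch_le h.symm (h.diam x hx v hv.1) hmin hτ
          linarith)
      push_cast; linarith
    · have h1 := hrun.calls_le_linear h hε hεD hq hx'
      push Not at hw'
      have h2 : 2 * D / ε ^ 2 * ((normSqA A (x + σ • (v - x) - y) - q) / 2)
          ≤ 2 * D / ε ^ 2 * ε := by gcongr
      have e : 2 * D / ε ^ 2 * ε = 2 * D / ε := by field_simp
      have := key _ hw
      push_cast; linarith

/-- The Frank-Wolfe routine makes at most `4D/ε + 2` calls to the LOO. -/
theorem FWRun.calls_le {D : ℝ} (h : FWData 𝒦 A D) (hε : 0 < ε) (hεD : ε ≤ D) {x x' : Vec n} {k : ℕ}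
    (hrun : FWRun 𝒦 A ε y x x' k) (hx : x ∈ 𝒦) : (k : ℝ) ≤ 4 * D / ε + 2 := by
  have hD : 0 < D := hε.trans_le hεD
  obtain ⟨q, hq⟩ : ∃ q, IsGLB ((fun z => normSqA A (z - y)) '' 𝒦) q :=
    ⟨_, isGLB_csInf ⟨_, x, hx, rfl⟩ ⟨0, by rintro _ ⟨z, hz, rfl⟩; exact h.nonneg _⟩⟩
  have e4 : 4 * D / ε = 2 * D / ε + 2 * D / ε := by ring
  have h0 : 0 < 2 * D / ε := by positivity
  rcases le_total ε ((normSqA A (x - y) - q) / 2) with hw | hw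
  · have h1 := hrun.calls_le_reciprocal h hε hεD hq hx hw
    have : 0 < 2 * D / ((normSqA A (x - y) - q) / 2) := by
      have := hε.trans_le hw
      positivity
    linarith
  · have h1 := hrun.calls_le_linear h hε hεD hq hx
    have h2 : 2 * D / ε ^ 2 * ((normSqA A (x - y) - q) / 2) ≤ 2 * D / ε ^ 2 * ε := by gcongr
    have e : 2 * D / ε ^ 2 * ε = 2 * D / ε := by field_simp
    linarith

end FrankWolfe

/-! ### The approximately-feasible projection -/

section Projection

variable {n : ℕ} {𝒦 : Set (Vec n)} {A : Matrix (Fin n) (Fin n) ℝ} {ε : ℝ}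

/-- A routine that ends far from `y` must have ended by the gap test, and the last oracle answer
maximizes the gap over `𝒦`. -/
theorem FWRun.gap_le_of_far (hA : A.IsSymm) {y x x' : Vec n} {k : ℕ}
    (h : FWRun 𝒦 A ε y x x' k) (hfar : 3 * ε < normSqA A (x' - y)) {z : Vec n} (hz : z ∈ 𝒦) :
    bil A (x' - y) (x' - z) ≤ ε := by
  obtain ⟨v, hv, hs⟩ := h.exists_last_oracle_answer
  rcases hs with hs | hs
  · exact (hv.bil_sub_le hA hz).trans hs
  · exact absurd hs (not_le.2 hfar)

/-- Pulling `y` towards an almost optimal point of `𝒦` decreases the distance to every feasible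
point. -/
theorem normSqA_pull_le (hA : A.IsSymm) {x y z : Vec n} (hfar : 3 * ε < normSqA A (x - y))
    (hgap : bil A (x - y) (x - z) ≤ ε) :
    normSqA A (y - (2 / 3 : ℝ) • (y - x) - z) ≤
      normSqA A (y - z) - 4 / 9 * normSqA A (x - y) := by
  have e : y - (2 / 3 : ℝ) • (y - x) - z = (y - z) - (2 / 3 : ℝ) • (y - x) := by abel
  have e2 : bil A (y - z) (y - x) = normSqA A (x - y) - bil A (x - y) (x - z) := by
    simp only [normSqA, bil_sub_left, bil_sub_right]
    rw [bil_comm hA z y, bil_comm hA z x, bil_comm hA y x]; ring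
  rw [e, normSqA_sub_smul hA, e2, normSqA_sub_comm y x]
  -- With `w = ‖x - y‖_A²` the change is `-(4/3)(w - gap) + (4/9) w`, and `gap ≤ ε < w / 3`.
  linarith

theorem normSqA_pull_self {x y : Vec n} :
    normSqA A (y - (2 / 3 : ℝ) • (y - x) - x) = 1 / 9 * normSqA A (x - y) := by
  have e : y - (2 / 3 : ℝ) • (y - x) - x = (-(1 / 3) : ℝ) • (x - y) := by module
  rw [e, normSqA_smul]; norm_num

/-- After a pull there is a feasible point whose squared distance is smaller by a factor `5/9`. -/
theorem exists_near_pull (hA : A.IsSymm) {x y z : Vec n} (hx : x ∈ 𝒦) (hz : z ∈ 𝒦)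
    (hfar : 3 * ε < normSqA A (x - y)) (hgap : bil A (x - y) (x - z) ≤ ε) {δ : ℝ}
    (hδ0 : 0 ≤ δ) (hδ : normSqA A (y - z) ≤ δ) :
    ∃ z' ∈ 𝒦, normSqA A (y - (2 / 3 : ℝ) • (y - x) - z') ≤ 5 / 9 * δ := by
  -- If `x` is at least as far from `y` as the bound `δ`, the old witness `z` gains `4/9` of it; if
  -- `x` is closer, `x` itself is the new witness, at a ninth of its old squared distance.
  rcases le_total δ (normSqA A (x - y)) with h | h
  · exact ⟨z, hz, by linarith [normSqA_pull_le hA hfar hgap]⟩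
  · exact ⟨x, hx, by rw [normSqA_pull_self]; linarith⟩

/-- This stops the pulling: a pull is impossible once some feasible point is within squared distance
`ε`. -/
theorem near_of_far (hA : A.IsSymm) (hpos : ∀ v, 0 ≤ normSqA A v) {x y z : Vec n}
    (hfar : 3 * ε < normSqA A (x - y)) (hgap : bil A (x - y) (x - z) ≤ ε) :
    ε < normSqA A (y - z) := by
  have := normSqA_sub_normSqA_le hA hpos x y z
  rw [normSqA_sub_comm y z]
  linarith

/-- `N` bounds the number of pulls still possible: each one shrinks the bound on the distance by
`5/9`, and at level `ε` a pull contradicts `near_of_far`. With `N` pulls there are `N + 1`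
Frank-Wolfe runs. -/
theorem AFPLoop.calls_le {D : ℝ} (h : FWData 𝒦 A D) (hε : 0 < ε) (hεD : ε ≤ D)
    {x y x' y' : Vec n} {k : ℕ} (hrun : AFPLoop 𝒦 A ε (2 / 3) x y x' y' k) (hx : x ∈ 𝒦)
    (N : ℕ) (hN : ∃ z ∈ 𝒦, normSqA A (y - z) ≤ (9 / 5) ^ N * ε) :
    (k : ℝ) ≤ (N + 1) * (4 * D / ε + 2) := by
  have hD : 0 < D := hε.trans_le hεD
  have hB : 0 < 4 * D / ε + 2 := by positivity
  induction hrun generalizing N with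
  | done x y x' k hfw hclose =>
    have := hfw.calls_le h hε hεD hx
    have : 0 ≤ N * (4 * D / ε + 2) := by positivity
    linarith
  | pull x y x₁ x' y' k j hfw hfar hloop ih =>
    obtain ⟨z, hz, hzN⟩ := hN
    have hx₁ := hfw.mem h.convex hx
    have hgap := hfw.gap_le_of_far h.symm hfar hz
    cases N with
    | zero =>
      have := near_of_far h.symm h.nonneg hfar hgap
      simp only [pow_zero, one_mul] at hzN
      linarith
    | succ N =>
      obtain ⟨z', hz', hd⟩ := exists_near_pull h.symm hx₁ hz hfar hgap (by positivity) hzN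
      have h1 := ih hx₁ N ⟨z', hz', hd.trans_eq (by rw [pow_succ]; ring)⟩
      have h2 := hfw.calls_le h hε hεD hx
      push_cast; linarith

theorem AFPRun.calls_le {D : ℝ} (h : FWData 𝒦 A D) (hε : 0 < ε) (hεD : ε ≤ D)
    {x y x' y' : Vec n} {k : ℕ} (hrun : AFPRun 𝒦 A ε (2 / 3) x y x' y' k) (hx : x ∈ 𝒦)
    (N : ℕ) (hN : normSqA A (x - y) ≤ (9 / 5) ^ N * ε) :
    (k : ℝ) ≤ (N + 1) * (4 * D / ε + 2) := by
  have hD : 0 < D := hε.trans_le hεD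
  cases hrun with
  | immediate h => simp only [Nat.cast_zero]; positivity
  | loop x' y' k h' hloop =>
    exact hloop.calls_le h hε hεD hx N ⟨x, hx, by rwa [normSqA_sub_comm]⟩

/-- The last clause replaces the nonexpansiveness of an exact projection: each pull brings `y`
closer to all feasible points at once. -/
theorem AFPLoop.spec (hA : A.IsSymm) (hpos : ∀ v, 0 ≤ normSqA A v) (h𝒦 : Convex ℝ 𝒦)
    {x y x' y' : Vec n} {k : ℕ} (hrun : AFPLoop 𝒦 A ε (2 / 3) x y x' y' k) (hx : x ∈ 𝒦) :
    x' ∈ 𝒦 ∧ normSqA A (x' - y') ≤ 3 * ε ∧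
      ∀ z ∈ 𝒦, normSqA A (y' - z) ≤ normSqA A (y - z) := by
  induction hrun with
  | done x y x' k hfw hclose => exact ⟨hfw.mem h𝒦 hx, hclose, fun z _ => le_rfl⟩
  | pull x y x₁ x' y' k j hfw hfar hloop ih =>
    obtain ⟨h1, h2, h3⟩ := ih (hfw.mem h𝒦 hx)
    refine ⟨h1, h2, fun z hz => (h3 z hz).trans ?_⟩
    have := normSqA_pull_le hA hfar (hfw.gap_le_of_far hA hfar hz)
    linarith [hpos (x₁ - y)]

theorem AFPRun.spec (hA : A.IsSymm) (hpos : ∀ v, 0 ≤ normSqA A v) (h𝒦 : Convex ℝ 𝒦)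
    {x y x' y' : Vec n} {k : ℕ} (hrun : AFPRun 𝒦 A ε (2 / 3) x y x' y' k) (hx : x ∈ 𝒦) :
    x' ∈ 𝒦 ∧ normSqA A (x' - y') ≤ 3 * ε ∧
      ∀ z ∈ 𝒦, normSqA A (y' - z) ≤ normSqA A (y - z) := by
  cases hrun with
  | immediate h => exact ⟨hx, h, fun z _ => le_rfl⟩
  | loop x' y' k h' hloop => exact hloop.spec hA hpos h𝒦 hx

end Projection

/-! ### Determinants and traces of positive definite matrices -/

section LogDet

variable {n : ℕ}

/-- `log λ ≤ λ - 1`, summed over the eigenvalues. -/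
theorem log_det_le_trace_sub {Z : Matrix (Fin n) (Fin n) ℝ} (hZ : Z.PosDef) :
    Real.log Z.det ≤ Z.trace - n := by
  have h1 := hZ.isHermitian.det_eq_prod_eigenvalues
  have h2 := hZ.isHermitian.trace_eq_sum_eigenvalues
  simp only [RCLike.ofReal_real_eq_id, id_eq] at h1 h2
  rw [h1, h2, Real.log_prod (fun i _ => (hZ.eigenvalues_pos i).ne')]
  have : ∑ i, Real.log (hZ.isHermitian.eigenvalues i) ≤
      ∑ i, (hZ.isHermitian.eigenvalues i - 1) :=
    Finset.sum_le_sum fun i _ => Real.log_le_sub_one_of_pos (hZ.eigenvalues_pos i)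
  simpa using this

open scoped MatrixOrder in
/-- Concavity of `log det`. -/
theorem log_det_sub_log_det_le {X Y : Matrix (Fin n) (Fin n) ℝ} (hX : X.PosDef) (hY : Y.PosDef) :
    Real.log Y.det - Real.log X.det ≤ (X⁻¹ * (Y - X)).trace := by
  -- Factoring `X⁻¹ = C Cᵀ` replaces `X⁻¹ Y`, which need not be symmetric, by the positive definite
  -- `Cᵀ Y C` with the same trace and determinant.
  obtain ⟨C, hC, hXC⟩ : ∃ C : Matrix (Fin n) (Fin n) ℝ, IsUnit C ∧ X⁻¹ = C * Cᵀ := by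
    have hXi := hX.inv.posSemidef
    obtain ⟨a, ha⟩ := CStarAlgebra.nonneg_iff_eq_star_mul_self.1 hXi.nonneg
    have ha' : X⁻¹ = aᵀ * a := by
      rw [ha, Matrix.star_eq_conjTranspose, Matrix.conjTranspose_eq_transpose_of_trivial]
    refine ⟨aᵀ, ?_, by rw [ha', Matrix.transpose_transpose]⟩
    have hdet : X⁻¹.det ≠ 0 := hX.inv.det_pos.ne'
    rw [ha', Matrix.det_mul] at hdet
    exact (Matrix.isUnit_iff_isUnit_det _).2 (left_ne_zero_of_mul hdet).isUnit
  have hdet : X⁻¹.det = C.det ^ 2 := by rw [hXC]; simp [sq]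
  have hZ : (Cᵀ * Y * C).PosDef := by
    have := (Matrix.IsUnit.posDef_star_left_conjugate_iff (x := Y) hC).2 hY
    simpa [Matrix.star_eq_conjTranspose] using this
  have h := log_det_le_trace_sub hZ
  have hXu : IsUnit X.det := (Matrix.isUnit_iff_isUnit_det _).1 hX.isUnit
  have e1 : (Cᵀ * Y * C).det = Y.det / X.det := by
    rw [Matrix.det_mul, Matrix.det_mul, Matrix.det_transpose]
    have : X⁻¹.det = (X.det)⁻¹ := by simp [Matrix.det_nonsing_inv]
    rw [div_eq_mul_inv, ← this, hdet]; ring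
  have e2 : (Cᵀ * Y * C).trace = (X⁻¹ * Y).trace := by
    rw [hXC, Matrix.mul_assoc, Matrix.trace_mul_comm, Matrix.mul_assoc,
      Matrix.trace_mul_comm Y, ]
  rw [e1, Real.log_div hY.det_pos.ne' hX.det_pos.ne', e2] at h
  rw [Matrix.mul_sub, Matrix.nonsing_inv_mul _ hXu, Matrix.trace_sub, Matrix.trace_one]
  simpa using h


theorem trace_mul_vecMulVec (A : Matrix (Fin n) (Fin n) ℝ) (g : Vec n) :
    (A * Matrix.vecMulVec g.ofLp g.ofLp).trace = bil A g g := by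
  rw [Matrix.mul_vecMulVec, Matrix.trace_vecMulVec, dotProduct_comm]; rfl

theorem trace_mul_transpose_mul {p : ℕ} (A : Matrix (Fin n) (Fin n) ℝ)
    (V : Matrix (Fin p) (Fin n) ℝ) :
    (A * (Vᵀ * V)).trace = ∑ i, bil A (WithLp.toLp 2 (V i)) (WithLp.toLp 2 (V i)) := by
  rw [← Matrix.mul_assoc, Matrix.trace_mul_comm, Matrix.trace]
  refine Finset.sum_congr rfl fun i _ => ?_
  rw [Matrix.diag_apply, Matrix.mul_apply]
  rfl

/-- The matrix determinant lemma in logarithmic form. -/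
theorem log_det_add_vecMulVec {A : Matrix (Fin n) (Fin n) ℝ} (hA : A.PosDef) (g : Vec n) :
    Real.log (A + Matrix.vecMulVec g.ofLp g.ofLp).det =
      Real.log A.det + Real.log (1 + bil A⁻¹ g g) := by
  have hu : IsUnit A.det := (Matrix.isUnit_iff_isUnit_det _).1 hA.isUnit
  have h0 : 0 ≤ bil A⁻¹ g g := by
    have := hA.inv.posSemidef.dotProduct_mulVec_nonneg g.ofLp
    simpa [bil] using this
  rw [Matrix.vecMulVec_eq Unit, Matrix.det_add_replicateCol_mul_replicateRow hu,
    Real.log_mul hA.det_pos.ne']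
  · congr 2
    rw [Matrix.det_unique, Matrix.add_apply, Matrix.one_apply_eq, Matrix.mul_assoc,
      ← Matrix.replicateCol_mulVec, Matrix.mul_apply]
    simp [bil, dotProduct, Matrix.replicateRow, Matrix.replicateCol]
  · rw [Matrix.det_unique, Matrix.add_apply, Matrix.one_apply_eq, Matrix.mul_assoc,
      ← Matrix.replicateCol_mulVec, Matrix.mul_apply]
    have : (0:ℝ) < 1 + bil A⁻¹ g g := by linarith
    simpa [bil, dotProduct, Matrix.replicateRow, Matrix.replicateCol] using this.ne'

end LogDet

/-! ### The matrix generated by the sketch -/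

section Sketch

variable {n ρ : ℕ} {εI : ℝ} (S : Matrix (Fin (ρ + 1)) (Fin n) ℝ)

theorem sketchA_isSymm : (sketchA εI S).IsSymm := by
  unfold sketchA Matrix.IsSymm
  simp [Matrix.transpose_mul]

theorem bil_sketchA (u v : Vec n) :
    bil (sketchA εI S) u v = εI * inner ℝ u v + inner ℝ (mv S u) (mv S v) := by
  rw [sketchA, bil_add_matrix, bil_smul_matrix, bil_one, bil_transpose_mul]

theorem normSqA_sketchA (v : Vec n) :
    normSqA (sketchA εI S) v = εI * ‖v‖ ^ 2 + ‖mv S v‖ ^ 2 := by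
  rw [normSqA, bil_sketchA, real_inner_self_eq_norm_sq, real_inner_self_eq_norm_sq]

theorem normSqA_sketchA_ge (v : Vec n) : εI * ‖v‖ ^ 2 ≤ normSqA (sketchA εI S) v := by
  rw [normSqA_sketchA]
  linarith [sq_nonneg ‖mv S v‖]

theorem normSqA_sketchA_nonneg (hε : 0 < εI) (v : Vec n) : 0 ≤ normSqA (sketchA εI S) v :=
  le_trans (by positivity) (normSqA_sketchA_ge S v)

theorem sketchA_posDef (hε : 0 < εI) : (sketchA εI S).PosDef := by
  refine Matrix.PosDef.of_dotProduct_mulVec_pos ?_ fun x hx => ?_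
  · rw [Matrix.IsHermitian, Matrix.conjTranspose_eq_transpose_of_trivial]
    exact sketchA_isSymm S
  · have h := normSqA_sketchA_ge (εI := εI) S (WithLp.toLp 2 x)
    have hx' : (WithLp.toLp 2 x : Vec n) ≠ 0 := by
      intro h0; exact hx (by simpa using congrArg WithLp.ofLp h0)
    have : 0 < εI * ‖(WithLp.toLp 2 x : Vec n)‖ ^ 2 := by positivity
    simpa [normSqA, bil] using this.trans_le h

theorem mv_sketchA_inv (hε : 0 < εI) (v : Vec n) :
    mv (sketchA εI S) (mv (sketchA εI S)⁻¹ v) = v := by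
  have hu := (Matrix.isUnit_iff_isUnit_det _).1 (sketchA_posDef S hε).isUnit
  simp [mv, Matrix.mulVec_mulVec, Matrix.mul_nonsing_inv _ hu]

theorem bil_sketchA_inv_left (hε : 0 < εI) (g v : Vec n) :
    bil (sketchA εI S) (mv (sketchA εI S)⁻¹ g) v = inner ℝ g v := by
  rw [bil_comm (sketchA_isSymm S), bil_eq_inner, mv_sketchA_inv S hε, real_inner_comm]

theorem normSqA_sketchA_inv (hε : 0 < εI) (g : Vec n) :
    normSqA (sketchA εI S) (mv (sketchA εI S)⁻¹ g) = bil (sketchA εI S)⁻¹ g g := by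
  rw [normSqA, bil_sketchA_inv_left S hε, bil_eq_inner]

theorem bil_sketchA_inv_nonneg (hε : 0 < εI) (g : Vec n) : 0 ≤ bil (sketchA εI S)⁻¹ g g := by
  rw [← normSqA_sketchA_inv S hε]; exact normSqA_sketchA_nonneg S hε _

/-- From `A ≥ ε_I`, without spectral theory: `w = A⁻¹ g` satisfies `ε_I ‖w‖² ≤ ⟨g, w⟩ ≤ ‖g‖ ‖w‖`. -/
theorem bil_sketchA_inv_le (hε : 0 < εI) (g : Vec n) :
    bil (sketchA εI S)⁻¹ g g ≤ ‖g‖ ^ 2 / εI := by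
  set w := mv (sketchA εI S)⁻¹ g
  have h1 : εI * ‖w‖ ^ 2 ≤ inner ℝ g w := by
    rw [← bil_sketchA_inv_left S hε]; exact normSqA_sketchA_ge S w
  have h2 : bil (sketchA εI S)⁻¹ g g = inner ℝ g w := bil_eq_inner _ _ _
  have h3 := real_inner_le_norm g w
  have h4 : εI * ‖w‖ ≤ ‖g‖ := by
    rcases (norm_nonneg w).eq_or_lt with h | h
    · rw [← h]; simp
    · nlinarith
  rw [h2, le_div_iff₀ hε]
  nlinarith [norm_nonneg g]

end Sketch

/-! ### One step of the Frequent Directions sketch -/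

section FrequentDirections

variable {n ρ : ℕ}

/-- Overwriting the last row loses nothing because it is zero; this is why vanishing of the last row
is carried along as an invariant. -/
theorem updateRow_transpose_mul {S : Matrix (Fin (ρ + 1)) (Fin n) ℝ} (hS : S (Fin.last ρ) = 0)
    (g : Fin n → ℝ) :
    (S.updateRow (Fin.last ρ) g)ᵀ * S.updateRow (Fin.last ρ) g =
      Sᵀ * S + Matrix.vecMulVec g g := by
  ext i j
  simp only [Matrix.mul_apply, Matrix.transpose_apply, Matrix.add_apply, Matrix.vecMulVec_apply,
    Fin.sum_univ_castSucc, Matrix.updateRow_self, hS]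
  simp [Matrix.updateRow_apply, Fin.castSucc_ne_last]

theorem IsThinEigen.nonneg {p : ℕ} {M V : Matrix (Fin p) (Fin n) ℝ} {d : Fin p → ℝ}
    (h : IsThinEigen M V d) (i : Fin p) : 0 ≤ d i := by
  by_cases hi : (i : ℕ) < n
  · have e : V * (Mᵀ * M) * Vᵀ =
        (V * Vᵀ) * Matrix.diagonal d * (V * Vᵀ) := by
      rw [← h.decomp]; simp only [Matrix.mul_assoc]
    have e2 : (V * (Mᵀ * M) * Vᵀ) i i = d i := by
      rw [e, h.orthonormal]; simp [hi]
    have hp : (V * (Mᵀ * M) * Vᵀ).PosSemidef := by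
      have := Matrix.posSemidef_self_mul_conjTranspose (V * Mᵀ)
      simpa [Matrix.mul_assoc] using this
    rw [← e2]; exact hp.diag_nonneg
  · exact (h.pad i (not_lt.1 hi)).ge

/-- The properties of one step of the sketch used in the analysis; `σ` is the shrinkage. -/
structure FDSpec (S : Matrix (Fin (ρ + 1)) (Fin n) ℝ) (g : Vec n)
    (S' : Matrix (Fin (ρ + 1)) (Fin n) ℝ) (σ : ℝ) : Prop where
  nonneg : 0 ≤ σ
  last : S' (Fin.last ρ) = 0
  lower : ∀ x, ‖mv S x‖ ^ 2 + (inner ℝ g x) ^ 2 - σ * ‖x‖ ^ 2 ≤ ‖mv S' x‖ ^ 2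
  upper : ∀ x, ‖mv S' x‖ ^ 2 ≤ ‖mv S x‖ ^ 2 + (inner ℝ g x) ^ 2
  trace : (S'ᵀ * S').trace = (Sᵀ * S).trace + ‖g‖ ^ 2 - (ρ + 1) * σ
  -- This bound concerns the matrix after the update, which the Newton step uses; the next one
  -- concerns the matrix before the update, in whose norm `x_m` is close to `ỹ_m`, at the price of a
  -- logarithm.
  bil_inv : ∀ εI : ℝ, 0 < εI → bil (sketchA εI S')⁻¹ g g ≤
    Real.log (sketchA εI S').det - Real.log (sketchA εI S).det + (ρ + 1) * σ / εI
  log_bil_inv : ∀ εI : ℝ, 0 < εI → Real.log (1 + bil (sketchA εI S)⁻¹ g g) ≤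
    Real.log (sketchA εI S').det - Real.log (sketchA εI S).det + (ρ + 1) * σ / εI
  diag : ∃ e : Fin (ρ + 1) → ℝ, (∀ i, 0 ≤ e i) ∧ e (Fin.last ρ) = 0 ∧
    S' * S'ᵀ = Matrix.diagonal e

/-- Bessel's inequality for rows that are orthonormal or zero, by expanding `‖x - Vᵀ V x‖² ≥ 0`. -/
theorem norm_sq_mv_le_of_orthonormal {p : ℕ} {V : Matrix (Fin p) (Fin n) ℝ} {q : Fin p → Prop}
    [DecidablePred q] (h : V * Vᵀ = Matrix.diagonal fun i => if q i then (1 : ℝ) else 0)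
    (x : Vec n) : ‖mv V x‖ ^ 2 ≤ ‖x‖ ^ 2 := by
  have h0 : 0 ≤ inner ℝ (x - mv Vᵀ (mv V x)) (x - mv Vᵀ (mv V x)) := real_inner_self_nonneg
  have e1 : inner ℝ x (mv Vᵀ (mv V x)) = ‖mv V x‖ ^ 2 := by
    rw [← real_inner_self_eq_norm_sq, inner_eq_dotProduct, inner_eq_dotProduct]
    simp only [mv]
    rw [Matrix.dotProduct_mulVec, Matrix.vecMul_transpose]
  have e2 : inner ℝ (mv Vᵀ (mv V x)) (mv Vᵀ (mv V x)) ≤ ‖mv V x‖ ^ 2 := by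
    have : inner ℝ (mv Vᵀ (mv V x)) (mv Vᵀ (mv V x)) =
        inner ℝ (mv V x) (mv (V * Vᵀ) (mv V x)) := by
      rw [inner_eq_dotProduct, inner_eq_dotProduct]
      simp only [mv]
      rw [← Matrix.mulVec_mulVec, Matrix.dotProduct_mulVec (V *ᵥ x.ofLp) V,
        ← Matrix.mulVec_transpose]
    rw [this, h, ← real_inner_self_eq_norm_sq, inner_eq_dotProduct, inner_eq_dotProduct]
    refine Finset.sum_le_sum fun i _ => ?_
    simp only [mv, Matrix.mulVec_diagonal]
    split_ifs <;> nlinarith [mul_self_nonneg ((V *ᵥ x.ofLp) i)]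
  rw [inner_sub_left, inner_sub_right, inner_sub_right, real_inner_comm x (mv Vᵀ (mv V x)), e1,
    real_inner_self_eq_norm_sq] at h0
  linarith

/-- Everything rests on `S'ᵀS' = SᵀS + g gᵀ - σ VᵀV`. The determinant bounds are the tangent
inequality for `log det` at the new matrix, evaluated at the old matrix and at the old matrix plus
`g gᵀ`. -/
theorem FDStep.spec (hρ : ρ ≤ n) {S S' : Matrix (Fin (ρ + 1)) (Fin n) ℝ} {g : Vec n}
    (h : FDStep S g S') (hS : S (Fin.last ρ) = 0) : ∃ σ, FDSpec S g S' σ := by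
  obtain ⟨V, d, hV, rfl⟩ := h
  set σ := d (Fin.last ρ) with hσ
  have hσ0 : 0 ≤ σ := hV.nonneg _
  have hd : ∀ i, 0 ≤ d i - σ := fun i => sub_nonneg.2 (hV.antitone (Fin.le_last i))
  set D := Matrix.diagonal (fun i => Real.sqrt (d i - σ)) with hD
  have hDD : D * D = Matrix.diagonal d - σ • 1 := by
    rw [hD, Matrix.diagonal_mul_diagonal, ← Matrix.diagonal_one, ← Matrix.diagonal_smul,
      Matrix.diagonal_sub]
    congr 1
    ext i
    simp [Real.mul_self_sqrt (hd i)]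
  have hDt : Dᵀ = D := Matrix.diagonal_transpose _
  have hgram : (D * V)ᵀ * (D * V) =
      Sᵀ * S + Matrix.vecMulVec g.ofLp g.ofLp - σ • (Vᵀ * V) := by
    rw [← updateRow_transpose_mul hS, ← hV.decomp, Matrix.transpose_mul, hDt]
    calc Vᵀ * D * (D * V) = Vᵀ * (D * D) * V := by simp only [Matrix.mul_assoc]
      _ = _ := by rw [hDD, Matrix.mul_sub, Matrix.sub_mul]; simp
  have hsum : ∀ x, ‖mv (D * V) x‖ ^ 2 =
      ‖mv S x‖ ^ 2 + (inner ℝ g x) ^ 2 - σ * ‖mv V x‖ ^ 2 := by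
    intro x
    have : ∀ {p : ℕ} (M : Matrix (Fin p) (Fin n) ℝ), ‖mv M x‖ ^ 2 = bil (Mᵀ * M) x x := by
      intro p M; rw [bil_transpose_mul, real_inner_self_eq_norm_sq]
    rw [this, hgram, bil_sub_matrix, bil_add_matrix, bil_smul_matrix, ← this, ← this,
      bil_vecMulVec]
    ring
  -- `V` has `ρ + 1` unit rows unless `ρ = n`; in that case one row is missing, but then `σ = 0`.
  have htr : σ * (V * Vᵀ).trace = (ρ + 1) * σ := by
    rw [hV.orthonormal, Matrix.trace_diagonal]
    rcases hρ.lt_or_eq with hlt | heq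
    · have : ∀ i : Fin (ρ + 1), (i : ℕ) < n := fun i => lt_of_le_of_lt (Nat.lt_succ_iff.1 i.2) hlt
      simp only [this, if_true]
      simp; ring
    · have : σ = 0 := hV.pad _ (by simp [heq])
      simp [this]
  have hA' : ∀ εI : ℝ, sketchA εI (D * V) + σ • (Vᵀ * V) =
      sketchA εI S + Matrix.vecMulVec g.ofLp g.ofLp := by
    intro εI
    rw [sketchA, hgram, sketchA]; abel
  have htrinv : ∀ εI : ℝ, 0 < εI →
      σ * ((sketchA εI (D * V))⁻¹ * (Vᵀ * V)).trace ≤ (ρ + 1) * σ / εI := by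
    intro εI hε
    rw [← htr, mul_div_assoc]
    refine mul_le_mul_of_nonneg_left ?_ hσ0
    rw [trace_mul_transpose_mul, Matrix.trace, Finset.sum_div]
    refine Finset.sum_le_sum fun i _ => (bil_sketchA_inv_le _ hε _).trans_eq ?_
    rw [← real_inner_self_eq_norm_sq, inner_eq_dotProduct]
    rfl
  refine ⟨σ, hσ0, ?_, ?_, ?_, ?_, ?_, ?_, ?_⟩
  · ext j; simp [hD, Matrix.diagonal_mul, hσ]
  · intro x
    rw [hsum]
    have := mul_le_mul_of_nonneg_left (norm_sq_mv_le_of_orthonormal hV.orthonormal x) hσ0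
    linarith
  · intro x
    rw [hsum]
    have : 0 ≤ σ * ‖mv V x‖ ^ 2 := by positivity
    linarith
  · rw [hgram, Matrix.trace_sub, Matrix.trace_add, Matrix.trace_smul, Matrix.trace_vecMulVec,
      Matrix.trace_mul_comm Vᵀ V, smul_eq_mul, htr, ← inner_eq_dotProduct,
      real_inner_self_eq_norm_sq]
  · intro εI hε
    -- The trace term is `σ tr(A'⁻¹ VᵀV) - gᵀ A'⁻¹ g`, where `A'` is the new matrix; its negative
    -- part is the quantity to be bounded.
    have h1 := log_det_sub_log_det_le (sketchA_posDef (D * V) hε) (sketchA_posDef S hε)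
    have e : sketchA εI S - sketchA εI (D * V) =
        σ • (Vᵀ * V) - Matrix.vecMulVec g.ofLp g.ofLp := by
      have := hA' εI
      rw [sub_eq_sub_iff_add_eq_add, ← this]; abel
    rw [e, Matrix.mul_sub, Matrix.trace_sub, trace_mul_vecMulVec, Matrix.mul_smul,
      Matrix.trace_smul, smul_eq_mul] at h1
    linarith [htrinv εI hε]
  · intro εI hε
    have hpd : (sketchA εI S + Matrix.vecMulVec g.ofLp g.ofLp).PosDef := by
      refine (sketchA_posDef S hε).add_posSemidef ?_
      simpa using Matrix.posSemidef_vecMulVec_self_star g.ofLp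
    -- Here the difference to the new matrix is just `σ VᵀV`, and the determinant lemma produces
    -- `log(1 + gᵀ A⁻¹ g)`.
    have h1 := log_det_sub_log_det_le (sketchA_posDef (D * V) hε) hpd
    rw [log_det_add_vecMulVec (sketchA_posDef S hε), ← hA', add_sub_cancel_left, Matrix.mul_smul,
      Matrix.trace_smul, smul_eq_mul] at h1
    linarith [htrinv εI hε]
  · refine ⟨fun i => (d i - σ) * (if (i : ℕ) < n then (1 : ℝ) else 0), fun i => ?_, by simp [hσ], ?_⟩
    · exact mul_nonneg (hd i) (by split_ifs <;> norm_num)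
    · rw [Matrix.transpose_mul, hDt]
      calc D * V * (Vᵀ * D) = D * (V * Vᵀ) * D := by simp only [Matrix.mul_assoc]
        _ = _ := by
          rw [hV.orthonormal, hD, Matrix.diagonal_mul_diagonal, Matrix.diagonal_mul_diagonal]
          congr 1
          ext i
          rw [mul_right_comm, Real.mul_self_sqrt (hd i)]

end FrequentDirections

/-! ### The sketch over many steps -/

section SketchSequence

variable {n ρ : ℕ}

/-- Squared Frobenius norm, computed in an arbitrary orthonormal basis; it will be the eigenbasis of
the gradient Gram matrix. -/
theorem trace_transpose_mul_eq_sum (b : OrthonormalBasis (Fin n) ℝ (Vec n)) {p : ℕ}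
    (S : Matrix (Fin p) (Fin n) ℝ) : (Sᵀ * S).trace = ∑ i, ‖mv S (b i)‖ ^ 2 := by
  have h1 : (Sᵀ * S).trace = ∑ r, ‖(WithLp.toLp 2 (S r) : Vec n)‖ ^ 2 := by
    rw [Matrix.trace_mul_comm, Matrix.trace]
    refine Finset.sum_congr rfl fun r _ => ?_
    rw [← real_inner_self_eq_norm_sq, inner_eq_dotProduct]
    rfl
  rw [h1]
  simp_rw [← b.sum_sq_inner_right, EuclideanSpace.real_norm_sq_eq]
  rw [Finset.sum_comm]
  refine Finset.sum_congr rfl fun i _ => Finset.sum_congr rfl fun r _ => ?_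
  rw [inner_eq_dotProduct, dotProduct_comm]
  rfl

variable {S : ℕ → Matrix (Fin (ρ + 1)) (Fin n) ℝ} {g : ℕ → Vec n} {σ : ℕ → ℝ} {M : ℕ}

theorem sketch_upper (h0 : S 0 = 0) (h : ∀ m < M, FDSpec (S m) (g m) (S (m + 1)) (σ m))
    (x : Vec n) : ∀ m ≤ M, ‖mv (S m) x‖ ^ 2 ≤ ∑ j ∈ Finset.range m, (inner ℝ (g j) x) ^ 2 := by
  intro m
  induction m with
  | zero => intro _; simp [h0, mv]
  | succ m ih =>
    intro hm
    rw [Finset.sum_range_succ]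
    linarith [(h m hm).upper x, ih (by omega)]

theorem sketch_lower (h0 : S 0 = 0) (h : ∀ m < M, FDSpec (S m) (g m) (S (m + 1)) (σ m))
    (x : Vec n) : ∀ m ≤ M, ∑ j ∈ Finset.range m, (inner ℝ (g j) x) ^ 2
      - (∑ j ∈ Finset.range m, σ j) * ‖x‖ ^ 2 ≤ ‖mv (S m) x‖ ^ 2 := by
  intro m
  induction m with
  | zero => intro _; simp [h0, mv]
  | succ m ih =>
    intro hm
    rw [Finset.sum_range_succ, Finset.sum_range_succ]
    linarith [(h m hm).lower x, ih (by omega)]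

theorem sketch_trace (h0 : S 0 = 0) (h : ∀ m < M, FDSpec (S m) (g m) (S (m + 1)) (σ m)) :
    ∀ m ≤ M, ((S m)ᵀ * S m).trace =
      ∑ j ∈ Finset.range m, ‖g j‖ ^ 2 - (ρ + 1) * ∑ j ∈ Finset.range m, σ j := by
  intro m
  induction m with
  | zero => intro _; simp [h0]
  | succ m ih =>
    intro hm
    rw [Finset.sum_range_succ, Finset.sum_range_succ, (h m hm).trace, ih (by omega)]
    ring

theorem sum_bil_inv_le {εI : ℝ} (hε : 0 < εI)
    (h : ∀ m < M, FDSpec (S m) (g m) (S (m + 1)) (σ m)) :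
    ∑ m ∈ Finset.range M, bil (sketchA εI (S (m + 1)))⁻¹ (g m) (g m) ≤
      Real.log (sketchA εI (S M)).det - Real.log (sketchA εI (S 0)).det
        + (ρ + 1) * (∑ m ∈ Finset.range M, σ m) / εI := by
  rw [← Finset.sum_range_sub (fun m => Real.log (sketchA εI (S m)).det), Finset.mul_sum,
    Finset.sum_div, ← Finset.sum_add_distrib]
  exact Finset.sum_le_sum fun m hm => (h m (Finset.mem_range.1 hm)).bil_inv εI hε

theorem sum_log_bil_inv_le {εI : ℝ} (hε : 0 < εI)
    (h : ∀ m < M, FDSpec (S m) (g m) (S (m + 1)) (σ m)) :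
    ∑ m ∈ Finset.range M, Real.log (1 + bil (sketchA εI (S m))⁻¹ (g m) (g m)) ≤
      Real.log (sketchA εI (S M)).det - Real.log (sketchA εI (S 0)).det
        + (ρ + 1) * (∑ m ∈ Finset.range M, σ m) / εI := by
  rw [← Finset.sum_range_sub (fun m => Real.log (sketchA εI (S m)).det), Finset.mul_sum,
    Finset.sum_div, ← Finset.sum_add_distrib]
  exact Finset.sum_le_sum fun m hm => (h m (Finset.mem_range.1 hm)).log_bil_inv εI hε

/-- Tangent of `log(1 + x)` at `a`; summed with `a` an upper bound for the mean, it serves as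
Jensen's inequality. -/
theorem log_one_add_le_tangent {x a : ℝ} (hx : 0 ≤ x) (ha : 0 ≤ a) :
    Real.log (1 + x) ≤ Real.log (1 + a) + (x - a) / (1 + a) := by
  have h := Real.log_le_sub_one_of_pos (x := (1 + x) / (1 + a)) (by positivity)
  rw [Real.log_div (by positivity) (by positivity)] at h
  have : (1 + x) / (1 + a) - 1 = (x - a) / (1 + a) := by field_simp; ring
  linarith

/-- Since `det(1 + SᵀS/ε_I) = det(1 + SSᵀ/ε_I)` and the last diagonal entry vanishes, only `ρ`
eigenvalues contribute; concavity makes equal eigenvalues the worst case. -/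
theorem log_det_sketchA_le (hρ : 1 ≤ ρ) {εI B : ℝ} (hε : 0 < εI) (hB : 0 ≤ B)
    {S' : Matrix (Fin (ρ + 1)) (Fin n) ℝ} {e : Fin (ρ + 1) → ℝ} (he : ∀ i, 0 ≤ e i)
    (hl : e (Fin.last ρ) = 0) (hdiag : S' * S'ᵀ = Matrix.diagonal e)
    (htr : (S'ᵀ * S').trace ≤ B) :
    Real.log (sketchA εI S').det - Real.log (sketchA εI (0 : Matrix (Fin (ρ + 1)) (Fin n) ℝ)).det ≤
      ρ * Real.log (1 + B / (ρ * εI)) := by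
  have hρ' : (0 : ℝ) < ρ := by exact_mod_cast hρ
  have e0 : (sketchA εI (0 : Matrix (Fin (ρ + 1)) (Fin n) ℝ)).det = εI ^ n := by
    simp [sketchA]
  have e1 : (sketchA εI S').det = εI ^ n * ∏ i, (1 + e i / εI) := by
    have : sketchA εI S' = εI • (1 + (εI⁻¹ • S'ᵀ) * S') := by
      rw [sketchA, smul_add, Matrix.smul_mul, smul_smul, mul_inv_cancel₀ hε.ne', one_smul]
    rw [this, Matrix.det_smul, Matrix.det_one_add_mul_comm, Matrix.mul_smul, hdiag,
      ← Matrix.diagonal_smul, ← Matrix.diagonal_one, Matrix.diagonal_add, Matrix.det_diagonal]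
    simp [div_eq_inv_mul]
  have hpos : ∀ i, 0 < 1 + e i / εI := fun i => by
    have := div_nonneg (he i) hε.le
    linarith
  rw [e0, e1, Real.log_mul (by positivity) (Finset.prod_pos fun i _ => hpos i).ne',
    add_sub_cancel_left, Real.log_prod fun i _ => (hpos i).ne', Fin.sum_univ_castSucc, hl]
  have hsum : ∑ i : Fin ρ, e i.castSucc ≤ B := by
    have : (S'ᵀ * S').trace = ∑ i : Fin ρ, e i.castSucc := by
      rw [Matrix.trace_mul_comm, hdiag, Matrix.trace_diagonal, Fin.sum_univ_castSucc, hl, add_zero]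
    linarith
  set a := B / (ρ * εI) with ha
  have ha0 : 0 ≤ a := by positivity
  calc ∑ i : Fin ρ, Real.log (1 + e i.castSucc / εI) + Real.log (1 + 0 / εI)
      = ∑ i : Fin ρ, Real.log (1 + e i.castSucc / εI) := by simp
    _ ≤ ∑ i : Fin ρ, (Real.log (1 + a) + (e i.castSucc / εI - a) / (1 + a)) :=
        Finset.sum_le_sum fun i _ => log_one_add_le_tangent (div_nonneg (he _) hε.le) ha0
    _ = ρ * Real.log (1 + a) + ((∑ i : Fin ρ, e i.castSucc) / εI - ρ * a) / (1 + a) := by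
        rw [Finset.sum_add_distrib, ← Finset.sum_div, Finset.sum_sub_distrib, ← Finset.sum_div]
        simp
    _ ≤ ρ * Real.log (1 + a) := by
        have h1 : ρ * a = B / εI := by rw [ha]; field_simp
        have h2 : (∑ i : Fin ρ, e i.castSucc) / εI ≤ B / εI := by gcongr
        have : ((∑ i : Fin ρ, e i.castSucc) / εI - ρ * a) / (1 + a) ≤ 0 :=
          div_nonpos_of_nonpos_of_nonneg (by linarith) (by linarith)
        linarith

/-- The total shrinkage is at most the energy of the vectors outside any `ρ` directions. -/
theorem sum_shrinkage_le (h0 : S 0 = 0) (h : ∀ m < M, FDSpec (S m) (g m) (S (m + 1)) (σ m))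
    (b : OrthonormalBasis (Fin n) ℝ (Vec n)) (s : Finset (Fin n)) (hs : s.card ≤ ρ) :
    ∑ m ∈ Finset.range M, σ m ≤ ∑ i ∈ sᶜ, ∑ m ∈ Finset.range M, (inner ℝ (g m) (b i)) ^ 2 := by
  set tot := ∑ m ∈ Finset.range M, σ m with htot
  have htot0 : 0 ≤ tot := Finset.sum_nonneg fun m hm => (h m (Finset.mem_range.1 hm)).nonneg
  have h1 := sketch_trace h0 h M le_rfl
  -- In each of the at most `ρ` directions of `s` the sketch keeps all energy except at most `tot`,
  -- whereas the trace misses `(ρ + 1) tot` in total. The surplus `tot` must come from the energy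
  -- outside `s`.
  have h2 : ∑ i ∈ s, (∑ m ∈ Finset.range M, (inner ℝ (g m) (b i)) ^ 2 - tot) ≤
      ((S M)ᵀ * S M).trace := by
    rw [trace_transpose_mul_eq_sum b]
    calc _ ≤ ∑ i ∈ s, ‖mv (S M) (b i)‖ ^ 2 := by
          refine Finset.sum_le_sum fun i _ => ?_
          have := sketch_lower h0 h (b i) M le_rfl
          simpa using this
      _ ≤ _ := Finset.sum_le_univ_sum_of_nonneg fun i => sq_nonneg _
  have h3 : ∑ m ∈ Finset.range M, ‖g m‖ ^ 2 =
      ∑ i ∈ s, ∑ m ∈ Finset.range M, (inner ℝ (g m) (b i)) ^ 2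
        + ∑ i ∈ sᶜ, ∑ m ∈ Finset.range M, (inner ℝ (g m) (b i)) ^ 2 := by
    rw [Finset.sum_add_sum_compl, Finset.sum_comm]
    simp_rw [← b.sum_sq_inner_left]
  rw [Finset.sum_sub_distrib, Finset.sum_const, nsmul_eq_mul] at h2
  have h4 : (s.card : ℝ) * tot ≤ ρ * tot := by
    have : (s.card : ℝ) ≤ ρ := by exact_mod_cast hs
    gcongr
  linarith

end SketchSequence

/-! ### Tail eigenvalues of the gradient Gram matrix and the total shrinkage -/

theorem normSqA_gramSum {n : ℕ} (v : ℕ → Vec n) (T : ℕ) (x : Vec n) :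
    normSqA (gramSum v T) x = ∑ t ∈ Finset.range T, (inner ℝ (v t) x) ^ 2 := by
  rw [normSqA, bil, gramSum, Matrix.sum_mulVec, dotProduct_sum]
  refine Finset.sum_congr rfl fun t _ => ?_
  have := bil_vecMulVec (v t) x x
  rw [bil] at this
  rw [this]; ring

theorem exists_tailEigen_eq {n : ℕ} (v : ℕ → Vec n) (T ρ : ℕ) :
    ∃ (b : OrthonormalBasis (Fin n) ℝ (Vec n)) (s : Finset (Fin n)), s.card ≤ ρ ∧
      tailEigen v T ρ = ∑ i ∈ sᶜ, ∑ t ∈ Finset.range T, (inner ℝ (v t) (b i)) ^ 2 := by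
  classical
  have hA := gramSum_isHermitian v T
  -- This is the reindexing by which `eigenvalues` is defined from the sorted `eigenvalues₀`, so
  -- that the last identification below holds by `rfl`.
  set ψ : Fin (Fintype.card (Fin n)) ≃ Fin n := Fintype.equivOfCardEq (Fintype.card_fin _) with hψ
  refine ⟨hA.eigenvectorBasis, Finset.univ.filter fun i => ((ψ.symm i : ℕ) < ρ), ?_, ?_⟩
  · calc _ = ((Finset.univ.filter fun i => ((ψ.symm i : ℕ) < ρ)).image
            fun i => (ψ.symm i : ℕ)).card := by
          rw [Finset.card_image_of_injective]
          intro i j hij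
          exact ψ.symm.injective (Fin.ext hij)
      _ ≤ (Finset.range ρ).card := by
          refine Finset.card_le_card fun k hk => ?_
          simp only [Finset.mem_image, Finset.mem_filter, Finset.mem_univ, true_and] at hk
          obtain ⟨i, hi, rfl⟩ := hk
          exact Finset.mem_range.2 hi
      _ = ρ := Finset.card_range ρ
  · have hev : ∀ i, hA.eigenvalues₀ (ψ.symm i) =
        ∑ t ∈ Finset.range T, (inner ℝ (v t) (hA.eigenvectorBasis i)) ^ 2 := by
      intro i
      have h1 : normSqA (gramSum v T) (hA.eigenvectorBasis i) = hA.eigenvalues i := by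
        rw [normSqA, bil, hA.mulVec_eigenvectorBasis, dotProduct_smul, ← inner_eq_dotProduct,
          real_inner_self_eq_norm_sq]
        simp
      have h2 : normSqA (gramSum v T) (hA.eigenvectorBasis i) =
          ∑ t ∈ Finset.range T, (inner ℝ (v t) (hA.eigenvectorBasis i)) ^ 2 :=
        normSqA_gramSum v T _
      rw [← h2, h1]
      rfl
    rw [tailEigen, ← Equiv.sum_comp ψ.symm, Finset.compl_filter, Finset.sum_filter]
    refine Finset.sum_congr rfl fun i _ => ?_
    simp only [not_lt, hev]

theorem sum_range_mul_eq {β : Type*} [AddCommMonoid β] (F : ℕ → β) (M K : ℕ) :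
    ∑ t ∈ Finset.range (M * K), F t =
      ∑ m ∈ Finset.range M, ∑ s ∈ Finset.range K, F (m * K + s) := by
  induction M with
  | zero => simp
  | succ M ih => rw [Nat.succ_mul, Finset.sum_range_add, ih, Finset.sum_range_succ]

theorem block_div {K s : ℕ} (m : ℕ) (hs : s < K) : (m * K + s) / K = m := by
  rw [Nat.add_comm, Nat.add_mul_div_right _ _ (by omega), Nat.div_eq_of_lt hs, Nat.zero_add]

/-- The total shrinkage in terms of the observed gradients. -/
theorem sum_shrinkage_le_tailEigen {n ρ M K : ℕ} {S : ℕ → Matrix (Fin (ρ + 1)) (Fin n) ℝ}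
    {σ : ℕ → ℝ} (v : ℕ → Vec n) (h0 : S 0 = 0)
    (h : ∀ m < M, FDSpec (S m) (∑ s ∈ Finset.range K, v (m * K + s)) (S (m + 1)) (σ m)) :
    ∑ m ∈ Finset.range M, σ m ≤ K * tailEigen v (M * K) ρ := by
  obtain ⟨b, s, hs, hb⟩ := exists_tailEigen_eq v (M * K) ρ
  refine (sum_shrinkage_le h0 h b s hs).trans ?_
  rw [hb, Finset.mul_sum]
  refine Finset.sum_le_sum fun i _ => ?_
  rw [sum_range_mul_eq, Finset.mul_sum]
  refine Finset.sum_le_sum fun m _ => ?_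
  rw [sum_inner]
  -- Cauchy-Schwarz within a block; passing from block gradients to single gradients costs the
  -- factor `K`.
  have := sq_sum_le_card_mul_sum_sq (s := Finset.range K)
    (f := fun j => inner ℝ (v (m * K + j)) (b i))
  simpa using this

theorem tailEigen_nonneg {n : ℕ} (v : ℕ → Vec n) (T ρ : ℕ) : 0 ≤ tailEigen v T ρ := by
  obtain ⟨b, s, hs, hb⟩ := exists_tailEigen_eq v T ρ
  rw [hb]
  exact Finset.sum_nonneg fun i _ => Finset.sum_nonneg fun t _ => sq_nonneg _

/-! ### Analysis of a run -/

/-- The standing assumptions on the feasible set, the losses and the parameters. -/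
structure Setting {n : ℕ} (ρ : ℕ) (𝒦 : Set (Vec n)) (f : ℕ → Vec n → ℝ) (g : ℕ → Vec n → Vec n)
    (R G α β : ℝ) (P : Params) : Prop where
  one_le_rank : 1 ≤ ρ
  rank_le : ρ ≤ n
  R_pos : 0 < R
  G_pos : 0 < G
  α_pos : 0 < α
  β_nonneg : 0 ≤ β
  convex : Convex ℝ 𝒦
  subset : 𝒦 ⊆ Metric.closedBall 0 R
  loss : ∀ t < P.M * P.K, IsAdmissibleLoss R G α β (f t) (g t)
  K_pos : 0 < P.K
  ε_pos : 0 < P.ε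
  εI_pos : 0 < P.εI
  η_ge : max (12 * P.K * G * R) (2 * P.K / α) ≤ P.η
  εI_ge : (P.K * G) ^ 2 ≤ P.εI / 2
  ratio_le : 3 * P.ε / P.εI ≤ 4 * R ^ 2

/-! ### Inequalities for single losses and for blocks -/

section Losses

variable {n : ℕ} {R G α β : ℝ} {f : Vec n → ℝ} {g : Vec n → Vec n}

/-- Dropping the square in the curvature condition leaves the first-order convexity inequality at
`x`; smoothness then exchanges the gradient at `x` for the observed one at `y`. -/
theorem IsAdmissibleLoss.sub_le_feasible (h : IsAdmissibleLoss R G α β f g)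
    (hR : 0 < R) (hG : 0 < G) {x y : Vec n}
    (hx : x ∈ Metric.closedBall (0 : Vec n) (3 * R))
    (hy : y ∈ Metric.closedBall (0 : Vec n) (3 * R)) :
    f x - f y ≤ inner ℝ (g y) (x - y) + β * ‖x - y‖ ^ 2 := by
  have hc := h.curvature _ le_rfl x hx y hy
  have hη : 0 < max (4 * G * (3 * R)) (2 / α) := lt_of_lt_of_le (by positivity) (le_max_left _ _)
  have h1 : 0 ≤ 1 / (2 * max (4 * G * (3 * R)) (2 / α)) * (inner ℝ (g x) (x - y)) ^ 2 := by
    positivity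
  have h2 : inner ℝ (g x) (x - y) = inner ℝ (g y) (x - y) + inner ℝ (g x - g y) (x - y) := by
    rw [inner_sub_left]; ring
  have h3 : inner ℝ (g x - g y) (x - y) ≤ β * ‖x - y‖ ^ 2 :=
    (real_inner_le_norm _ _).trans (by
      have := mul_le_mul_of_nonneg_right (h.smooth x hx y hy) (norm_nonneg (x - y))
      linarith)
  linarith

end Losses

/-- The curvature condition over a block of losses. -/
theorem block_sub_le {n K : ℕ} (hK : 0 < K) {R G α β η : ℝ} (hR : 0 < R) (hG : 0 < G)
    {f : ℕ → Vec n → ℝ} {g : ℕ → Vec n → Vec n}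
    (h : ∀ s < K, IsAdmissibleLoss R G α β (f s) (g s))
    (hη : max (12 * K * G * R) (2 * K / α) ≤ η) {y z : Vec n}
    (hy : y ∈ Metric.closedBall (0 : Vec n) (3 * R))
    (hz : z ∈ Metric.closedBall (0 : Vec n) (3 * R)) :
    ∑ s ∈ Finset.range K, (f s y - f s z) ≤
      inner ℝ (∑ s ∈ Finset.range K, g s y) (y - z)
        - 1 / (2 * η) * (inner ℝ (∑ s ∈ Finset.range K, g s y) (y - z)) ^ 2 := by
  have hK' : (0 : ℝ) < K := by exact_mod_cast hK
  have hη0 : 0 < η := lt_of_lt_of_le (by positivity) ((le_max_left _ _).trans hη)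
  have hη' : max (4 * G * (3 * R)) (2 / α) ≤ η / K := by
    rw [le_div_iff₀ hK', max_mul_of_nonneg _ _ hK'.le]
    refine le_trans (le_of_eq ?_) hη
    congr 1 <;> ring
  have h1 : ∀ s ∈ Finset.range K, f s y - f s z ≤
      inner ℝ (g s y) (y - z) - 1 / (2 * (η / K)) * (inner ℝ (g s y) (y - z)) ^ 2 :=
    fun s hs => (h s (Finset.mem_range.1 hs)).curvature _ hη' y hy z hz
  refine (Finset.sum_le_sum h1).trans ?_
  rw [Finset.sum_sub_distrib, ← Finset.mul_sum, sum_inner]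
  -- The square of the summed inner products is at most `K` times the sum of squares, which is why
  -- each loss is used with `η / K`.
  have h2 := sq_sum_le_card_mul_sum_sq (s := Finset.range K)
    (f := fun s => inner ℝ (g s y) (y - z))
  rw [Finset.card_range] at h2
  have h3 := mul_le_mul_of_nonneg_left h2 (a := 1 / (2 * η)) (by positivity)
  have e : 1 / (2 * (η / K)) * ∑ s ∈ Finset.range K, (inner ℝ (g s y) (y - z)) ^ 2 =
      1 / (2 * η) * (K * ∑ s ∈ Finset.range K, (inner ℝ (g s y) (y - z)) ^ 2) := by
    field_simp
  linarith

/-! ### Invariants, regret and oracle calls of a run -/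

section Run

variable {n ρ : ℕ} {𝒦 : Set (Vec n)} {f : ℕ → Vec n → ℝ} {g : ℕ → Vec n → Vec n}
  {R G α β : ℝ} {P : Params} {x₁ : Vec n} {r : Run n ρ}

/-- The invariants of a run at the start of block `m`. -/
structure RunInvariant (𝒦 : Set (Vec n)) (R : ℝ) (P : Params) (r : Run n ρ) (m : ℕ) : Prop where
  last : r.S m (Fin.last ρ) = 0
  x_mem : r.x m ∈ 𝒦
  near : normSqA (sketchA P.εI (r.S m)) (r.x m - r.yt m) ≤ 3 * P.ε
  dist : ‖r.x m - r.yt m‖ ^ 2 ≤ 3 * P.ε / P.εI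
  yt_mem : r.yt m ∈ Metric.closedBall (0 : Vec n) (3 * R)

theorem Setting.mem_ball (hs : Setting ρ 𝒦 f g R G α β P) {z : Vec n} (hz : z ∈ 𝒦) :
    z ∈ Metric.closedBall (0 : Vec n) (3 * R) :=
  Metric.closedBall_subset_closedBall (by linarith [hs.R_pos]) (hs.subset hz)

/-- `A ≥ ε_I` converts the distance in the `A`-norm into a Euclidean distance of at most `2R`, and
`R + 2R = 3R`. -/
theorem RunInvariant.of_near (hs : Setting ρ 𝒦 f g R G α β P) {m : ℕ}
    (hlast : r.S m (Fin.last ρ) = 0) (hx : r.x m ∈ 𝒦)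
    (hnear : normSqA (sketchA P.εI (r.S m)) (r.x m - r.yt m) ≤ 3 * P.ε) :
    RunInvariant 𝒦 R P r m := by
  have hd : ‖r.x m - r.yt m‖ ^ 2 ≤ 3 * P.ε / P.εI := by
    rw [le_div_iff₀ hs.εI_pos, mul_comm]
    exact (normSqA_sketchA_ge _ _).trans hnear
  refine ⟨hlast, hx, hnear, hd, ?_⟩
  have h1 : ‖r.x m‖ ≤ R := by simpa using hs.subset hx
  have h2 : ‖r.x m - r.yt m‖ ≤ 2 * R := by
    refine abs_le_of_sq_le_sq' ?_ (by linarith [hs.R_pos]) |>.2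
    linarith [hs.ratio_le]
  rw [mem_closedBall_zero_iff]
  have h3 : ‖r.yt m‖ ≤ ‖r.x m‖ + ‖r.x m - r.yt m‖ := by
    have := norm_sub_le (r.x m) (r.x m - r.yt m)
    simpa using this
  linarith

theorem IsRun.invariant (hs : Setting ρ 𝒦 f g R G α β P) (hr : IsRun 𝒦 g x₁ P r) (hx₁ : x₁ ∈ 𝒦) :
    ∀ m ≤ P.M, RunInvariant 𝒦 R P r m := by
  intro m
  induction m with
  | zero =>
    intro _
    refine RunInvariant.of_near hs (by rw [hr.S_init]; rfl) (by rwa [hr.x_init]) ?_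
    rw [hr.x_init, hr.yt_init]
    simp only [sub_self, normSqA, bil]
    simpa using hs.ε_pos.le
  | succ m ih =>
    intro hm
    have ih := ih (by omega)
    obtain ⟨σ, hσ⟩ := (hr.sketch m hm).spec hs.rank_le ih.last
    obtain ⟨h1, h2, -⟩ := (hr.project m hm).spec (sketchA_isSymm _)
      (normSqA_sketchA_nonneg _ hs.εI_pos) hs.convex ih.x_mem
    exact RunInvariant.of_near hs hσ.last h1 h2

theorem IsRun.exists_shrinkage (hs : Setting ρ 𝒦 f g R G α β P) (hr : IsRun 𝒦 g x₁ P r)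
    (hx₁ : x₁ ∈ 𝒦) : ∃ σ : ℕ → ℝ, ∀ m < P.M,
      FDSpec (r.S m) (r.blockGrad P.K g m) (r.S (m + 1)) (σ m) := by
  have h : ∀ m, ∃ σ : ℝ, m < P.M →
      FDSpec (r.S m) (r.blockGrad P.K g m) (r.S (m + 1)) σ := by
    intro m
    by_cases hm : m < P.M
    · obtain ⟨σ, hσ⟩ := (hr.sketch m hm).spec hs.rank_le (hr.invariant hs hx₁ m hm.le).last
      exact ⟨σ, fun _ => hσ⟩
    · exact ⟨0, fun h => absurd h hm⟩
  choose σ hσ using h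
  exact ⟨σ, hσ⟩

theorem block_index_lt {m s : ℕ} (hm : m < P.M) (hsK : s < P.K) : m * P.K + s < P.M * P.K := by
  calc m * P.K + s < m * P.K + P.K := by omega
    _ = (m + 1) * P.K := by ring
    _ ≤ P.M * P.K := Nat.mul_le_mul_right _ hm

theorem IsRun.norm_blockGrad_le (hs : Setting ρ 𝒦 f g R G α β P) {m : ℕ} (hm : m < P.M)
    (hi : RunInvariant 𝒦 R P r m) : ‖r.blockGrad P.K g m‖ ≤ P.K * G := by
  calc ‖r.blockGrad P.K g m‖ ≤ ∑ s ∈ Finset.range P.K, ‖g (m * P.K + s) (r.yt m)‖ :=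
        norm_sum_le _ _
    _ ≤ ∑ s ∈ Finset.range P.K, G := Finset.sum_le_sum fun s h =>
        (hs.loss _ (block_index_lt hm (Finset.mem_range.1 h))).bounded _ hi.yt_mem
    _ = P.K * G := by simp

theorem IsRun.normSq_blockGrad_le (hs : Setting ρ 𝒦 f g R G α β P) {m : ℕ} (hm : m < P.M)
    (hi : RunInvariant 𝒦 R P r m) : ‖r.blockGrad P.K g m‖ ^ 2 ≤ (P.K * G) ^ 2 :=
  pow_le_pow_left₀ (norm_nonneg _) (IsRun.norm_blockGrad_le hs hm hi) 2

theorem normSqA_succ_le {S S' : Matrix (Fin (ρ + 1)) (Fin n) ℝ} {b : Vec n} {σ : ℝ}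
    (h : FDSpec S b S' σ) (εI : ℝ) (x : Vec n) :
    normSqA (sketchA εI S') x ≤ normSqA (sketchA εI S) x + (inner ℝ b x) ^ 2 := by
  rw [normSqA_sketchA, normSqA_sketchA]
  linarith [h.upper x]

theorem inner_sq_le (b x : Vec n) : (inner ℝ b x) ^ 2 ≤ ‖b‖ ^ 2 * ‖x‖ ^ 2 := by
  rw [← mul_pow, ← sq_abs]
  exact pow_le_pow_left₀ (abs_nonneg _) (abs_real_inner_le_norm b x) 2

/-- One online Newton step with approximate projection. -/
theorem IsRun.newton_step_le (hs : Setting ρ 𝒦 f g R G α β P) (hr : IsRun 𝒦 g x₁ P r)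
    (hx₁ : x₁ ∈ 𝒦) {z : Vec n} (hz : z ∈ 𝒦) {m : ℕ} (hm : m < P.M) {σ : ℝ}
    (hσ : FDSpec (r.S m) (r.blockGrad P.K g m) (r.S (m + 1)) σ) (hη : 0 < P.η) :
    inner ℝ (r.blockGrad P.K g m) (r.yt m - z)
        - 1 / (2 * P.η) * (inner ℝ (r.blockGrad P.K g m) (r.yt m - z)) ^ 2 ≤
      (normSqA (sketchA P.εI (r.S m)) (r.yt m - z)
        - normSqA (sketchA P.εI (r.S (m + 1))) (r.yt (m + 1) - z)) / (2 * P.η)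
      + P.η / 2 * bil (sketchA P.εI (r.S (m + 1)))⁻¹ (r.blockGrad P.K g m)
          (r.blockGrad P.K g m) := by
  have hε := hs.εI_pos
  set b := r.blockGrad P.K g m
  set A := sketchA P.εI (r.S (m + 1))
  have h1 := ((hr.project m hm).spec (sketchA_isSymm _) (normSqA_sketchA_nonneg _ hε) hs.convex
    (hr.invariant hs hx₁ m hm.le).x_mem).2.2 z hz
  have e1 : r.y (m + 1) - z = (r.yt m - z) - P.η • mv A⁻¹ b := by
    rw [hr.newton m hm]; abel
  have e2 : bil A (r.yt m - z) (mv A⁻¹ b) = inner ℝ b (r.yt m - z) := by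
    rw [bil_comm (sketchA_isSymm _), bil_sketchA_inv_left _ hε]
  rw [e1, normSqA_sub_smul (sketchA_isSymm _), e2, normSqA_sketchA_inv _ hε] at h1
  -- The square appearing here, divided by `2η`, is exactly the one subtracted on the left-hand side
  -- by the curvature condition.
  have h2 := normSqA_succ_le hσ P.εI (r.yt m - z)
  have h3 : normSqA A (r.yt (m + 1) - z) ≤ normSqA (sketchA P.εI (r.S m)) (r.yt m - z)
      + (inner ℝ b (r.yt m - z)) ^ 2 - 2 * P.η * inner ℝ b (r.yt m - z)
      + P.η ^ 2 * bil A⁻¹ b b := by linarith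
  have e3 : (normSqA (sketchA P.εI (r.S m)) (r.yt m - z) - normSqA A (r.yt (m + 1) - z))
        / (2 * P.η) + P.η / 2 * bil A⁻¹ b b
      - (inner ℝ b (r.yt m - z) - 1 / (2 * P.η) * (inner ℝ b (r.yt m - z)) ^ 2) =
      (normSqA (sketchA P.εI (r.S m)) (r.yt m - z)
      + (inner ℝ b (r.yt m - z)) ^ 2 - 2 * P.η * inner ℝ b (r.yt m - z)
      + P.η ^ 2 * bil A⁻¹ b b - normSqA A (r.yt (m + 1) - z)) / (2 * P.η) := by
    field_simp; ring
  have : 0 ≤ (normSqA (sketchA P.εI (r.S m)) (r.yt m - z)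
      + (inner ℝ b (r.yt m - z)) ^ 2 - 2 * P.η * inner ℝ b (r.yt m - z)
      + P.η ^ 2 * bil A⁻¹ b b - normSqA A (r.yt (m + 1) - z)) / (2 * P.η) :=
    div_nonneg (by linarith) (by positivity)
  linarith

/-- The excess loss of one block. -/
theorem IsRun.block_loss_le (hs : Setting ρ 𝒦 f g R G α β P) {z : Vec n} (hz : z ∈ 𝒦) {m : ℕ}
    (hm : m < P.M) (hi : RunInvariant 𝒦 R P r m) {l : ℝ} (hl : 0 < l) :
    ∑ s ∈ Finset.range P.K, (f (m * P.K + s) (r.x m) - f (m * P.K + s) z) ≤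
      P.K * (β * (3 * P.ε / P.εI))
      + (l * bil (sketchA P.εI (r.S m))⁻¹ (r.blockGrad P.K g m) (r.blockGrad P.K g m)
          + 3 * P.ε / l) / 2
      + (inner ℝ (r.blockGrad P.K g m) (r.yt m - z)
        - 1 / (2 * P.η) * (inner ℝ (r.blockGrad P.K g m) (r.yt m - z)) ^ 2) := by
  have hε := hs.εI_pos
  have hloss : ∀ s < P.K, IsAdmissibleLoss R G α β (f (m * P.K + s)) (g (m * P.K + s)) :=
    fun s h => hs.loss _ (block_index_lt hm h)
  have h1 := block_sub_le hs.K_pos hs.R_pos hs.G_pos (f := fun s => f (m * P.K + s))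
    (g := fun s => g (m * P.K + s)) hloss hs.η_ge hi.yt_mem (hs.mem_ball hz)
  have h2 : ∑ s ∈ Finset.range P.K, (f (m * P.K + s) (r.x m) - f (m * P.K + s) (r.yt m)) ≤
      ∑ s ∈ Finset.range P.K, (inner ℝ (g (m * P.K + s) (r.yt m)) (r.x m - r.yt m)
        + β * (3 * P.ε / P.εI)) := by
    refine Finset.sum_le_sum fun s h => ?_
    have h3 := (hloss s (Finset.mem_range.1 h)).sub_le_feasible hs.R_pos hs.G_pos
      (hs.mem_ball hi.x_mem) hi.yt_mem
    have := mul_le_mul_of_nonneg_left hi.dist hs.β_nonneg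
    linarith
  rw [Finset.sum_add_distrib, ← sum_inner, Finset.sum_const, Finset.card_range, nsmul_eq_mul] at h2
  -- The inner product equals the `A_m`-product of `A_m⁻¹ b` and `x - ỹ`, to which Young's
  -- inequality with weight `l` applies.
  have h4 : inner ℝ (r.blockGrad P.K g m) (r.x m - r.yt m) ≤
      (l * bil (sketchA P.εI (r.S m))⁻¹ (r.blockGrad P.K g m) (r.blockGrad P.K g m)
          + 3 * P.ε / l) / 2 := by
    rw [← bil_sketchA_inv_left (r.S m) hε, ← normSqA_sketchA_inv _ hε]
    refine (bil_le_young (sketchA_isSymm _) (normSqA_sketchA_nonneg _ hε) _ _ hl).trans ?_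
    have : normSqA (sketchA P.εI (r.S m)) (r.x m - r.yt m) / l ≤ 3 * P.ε / l := by
      gcongr; exact hi.near
    linarith
  have h5 : ∑ s ∈ Finset.range P.K, (f (m * P.K + s) (r.x m) - f (m * P.K + s) z) =
      ∑ s ∈ Finset.range P.K, (f (m * P.K + s) (r.x m) - f (m * P.K + s) (r.yt m)) +
      ∑ s ∈ Finset.range P.K, (f (m * P.K + s) (r.yt m) - f (m * P.K + s) z) := by
    rw [← Finset.sum_add_distrib]
    exact Finset.sum_congr rfl fun s _ => by ring
  rw [h5]
  unfold Run.blockGrad at h4 ⊢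
  linarith

/-- Removes the logarithm from the potential bound for the matrix before the update, where the
summands are at most `1/2`. -/
theorem le_log_one_add {u : ℝ} (h0 : 0 ≤ u) (h1 : u ≤ 1 / 2) : u ≤ 5 / 4 * Real.log (1 + u) := by
  have h := Real.le_log_one_add_of_nonneg h0
  have : 4 / 5 * u ≤ 2 * u / (u + 2) := by
    rw [le_div_iff₀ (by linarith)]; nlinarith
  linarith

/-- The regret of a run with free parameter `l`; `E` is the bound on the elliptic potential. -/
theorem IsRun.regret_le (hs : Setting ρ 𝒦 f g R G α β P) (hr : IsRun 𝒦 g x₁ P r)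
    (hx₁ : x₁ ∈ 𝒦) {l E : ℝ} (hl : 0 < l)
    (hE : ρ * Real.log (1 + P.M * (P.K * G) ^ 2 / (ρ * P.εI))
      + (ρ + 1) * (P.K * tailEigen (r.grad P.K g) (P.M * P.K) ρ) / P.εI ≤ E) :
    r.regret 𝒦 f (P.M * P.K) P.K ≤
      P.M * P.K * (β * (3 * P.ε / P.εI)) + 2 * R ^ 2 * P.εI / P.η + P.η / 2 * E
        + (l * (5 / 4 * E) + P.M * (3 * P.ε) / l) / 2 := by
  have hε := hs.εI_pos
  have hη : 0 < P.η := by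
    have hK : (0 : ℝ) < P.K := by exact_mod_cast hs.K_pos
    have := hs.R_pos
    have := hs.G_pos
    exact lt_of_lt_of_le (by positivity) ((le_max_left _ _).trans hs.η_ge)
  obtain ⟨σ, hσ⟩ := hr.exists_shrinkage hs hx₁
  have hinv := hr.invariant hs hx₁
  set b := r.blockGrad P.K g with hb
  have hbσ : ∀ m < P.M, FDSpec (r.S m)
      (∑ s ∈ Finset.range P.K, r.grad P.K g (m * P.K + s)) (r.S (m + 1)) (σ m) := by
    intro m hm
    have : ∑ s ∈ Finset.range P.K, r.grad P.K g (m * P.K + s) = b m := by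
      refine Finset.sum_congr rfl fun s h => ?_
      rw [Run.grad, block_div m (Finset.mem_range.1 h)]
    rw [this]; exact hσ m hm
  have htail := sum_shrinkage_le_tailEigen (r.grad P.K g) hr.S_init hbσ
  have hdet : Real.log (sketchA P.εI (r.S P.M)).det - Real.log (sketchA P.εI (r.S 0)).det ≤
      ρ * Real.log (1 + P.M * (P.K * G) ^ 2 / (ρ * P.εI)) := by
    rw [hr.S_init]
    have htr := sketch_trace hr.S_init hσ P.M le_rfl
    have hσ0 : 0 ≤ ∑ j ∈ Finset.range P.M, σ j :=
      Finset.sum_nonneg fun m hm => (hσ m (Finset.mem_range.1 hm)).nonneg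
    have hn : ∑ j ∈ Finset.range P.M, ‖b j‖ ^ 2 ≤ P.M * (P.K * G) ^ 2 := by
      refine (Finset.sum_le_sum fun m hm => IsRun.normSq_blockGrad_le hs
        (Finset.mem_range.1 hm) (hinv m (Finset.mem_range.1 hm).le)).trans ?_
      simp
    have htr' : ((r.S P.M)ᵀ * r.S P.M).trace ≤ P.M * (P.K * G) ^ 2 := by
      have : 0 ≤ ((ρ : ℝ) + 1) * ∑ j ∈ Finset.range P.M, σ j := by positivity
      linarith
    -- The diagonal form of `S Sᵀ` is a property of an updated sketch, so a run without blocks is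
    -- treated apart.
    rcases Nat.eq_zero_or_pos P.M with h0 | h0
    · rw [h0, hr.S_init]; simp
    · obtain ⟨m, hm⟩ : ∃ m, P.M = m + 1 := ⟨P.M - 1, by omega⟩
      obtain ⟨e, he, hl, hd⟩ := (hσ m (by omega)).diag
      rw [← hm] at hd
      exact log_det_sketchA_le hs.one_le_rank hε (by positivity) he hl hd htr'
  have hpot : Real.log (sketchA P.εI (r.S P.M)).det - Real.log (sketchA P.εI (r.S 0)).det
      + (ρ + 1) * (∑ m ∈ Finset.range P.M, σ m) / P.εI ≤ E := by
    refine le_trans (add_le_add hdet ?_) hE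
    gcongr
  have hQ := (sum_bil_inv_le hε hσ).trans hpot
  have hQlog := (sum_log_bil_inv_le hε hσ).trans hpot
  -- The hypothesis `(KG)² ≤ ε_I / 2` makes every summand at most `1/2`.
  have hQ' : ∑ m ∈ Finset.range P.M, bil (sketchA P.εI (r.S m))⁻¹ (b m) (b m) ≤ 5 / 4 * E := by
    refine le_trans ?_ (mul_le_mul_of_nonneg_left hQlog (by norm_num))
    rw [Finset.mul_sum]
    refine Finset.sum_le_sum fun m hm => ?_
    have hm := Finset.mem_range.1 hm
    refine le_log_one_add (bil_sketchA_inv_nonneg _ hε _) ((bil_sketchA_inv_le _ hε _).trans ?_)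
    rw [div_le_iff₀ hε]
    linarith [IsRun.normSq_blockGrad_le hs hm (hinv m hm.le), hs.εI_ge]
  have key : ∀ z ∈ 𝒦, ∑ t ∈ Finset.range (P.M * P.K), f t (r.x (t / P.K)) -
      ∑ t ∈ Finset.range (P.M * P.K), f t z ≤
      P.M * P.K * (β * (3 * P.ε / P.εI)) + 2 * R ^ 2 * P.εI / P.η + P.η / 2 * E
        + (l * (5 / 4 * E) + P.M * (3 * P.ε) / l) / 2 := by
    intro z hz
    rw [← Finset.sum_sub_distrib, sum_range_mul_eq]
    have h1 : ∀ m ∈ Finset.range P.M,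
        ∑ s ∈ Finset.range P.K, (f (m * P.K + s) (r.x ((m * P.K + s) / P.K))
          - f (m * P.K + s) z) ≤
        P.K * (β * (3 * P.ε / P.εI))
        + (l * bil (sketchA P.εI (r.S m))⁻¹ (b m) (b m) + 3 * P.ε / l) / 2
        + (-(normSqA (sketchA P.εI (r.S (m + 1))) (r.yt (m + 1) - z)
            - normSqA (sketchA P.εI (r.S m)) (r.yt m - z)) / (2 * P.η)
          + P.η / 2 * bil (sketchA P.εI (r.S (m + 1)))⁻¹ (b m) (b m)) := by
      intro m hm
      have hm := Finset.mem_range.1 hm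
      have h2 := IsRun.block_loss_le hs hz hm (hinv m hm.le) hl
      have h3 := hr.newton_step_le hs hx₁ hz hm (hσ m hm) hη
      rw [neg_sub]
      refine le_trans (le_of_eq ?_) (h2.trans (add_le_add_right h3 _))
      refine Finset.sum_congr rfl fun s h => ?_
      rw [block_div m (Finset.mem_range.1 h)]
    refine (Finset.sum_le_sum h1).trans ?_
    -- The potentials telescope; the initial one is `ε_I ‖x₁ - z‖² ≤ 4R² ε_I` because the sketch
    -- starts at zero.
    have hΦ : -(∑ m ∈ Finset.range P.M, (normSqA (sketchA P.εI (r.S (m + 1))) (r.yt (m + 1) - z)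
            - normSqA (sketchA P.εI (r.S m)) (r.yt m - z))) / (2 * P.η) ≤
        2 * R ^ 2 * P.εI / P.η := by
      rw [Finset.sum_range_sub (fun m => normSqA (sketchA P.εI (r.S m)) (r.yt m - z))]
      have h4 : normSqA (sketchA P.εI (r.S 0)) (r.yt 0 - z) ≤ 4 * R ^ 2 * P.εI := by
        rw [hr.S_init, hr.yt_init, normSqA_sketchA]
        have h5 : ‖x₁ - z‖ ≤ 2 * R := by
          have h6 : ‖x₁‖ ≤ R := by simpa using hs.subset hx₁
          have h7 : ‖z‖ ≤ R := by simpa using hs.subset hz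
          linarith [norm_sub_le x₁ z]
        have h8 : ‖x₁ - z‖ ^ 2 ≤ (2 * R) ^ 2 := pow_le_pow_left₀ (norm_nonneg _) h5 2
        have h9 := mul_le_mul_of_nonneg_left h8 hε.le
        have : ‖mv (0 : Matrix (Fin (ρ + 1)) (Fin n) ℝ) (x₁ - z)‖ = 0 := by simp [mv]
        rw [this]
        linarith
      have h5 := normSqA_sketchA_nonneg (r.S P.M) hε (r.yt P.M - z)
      calc _ ≤ 4 * R ^ 2 * P.εI / (2 * P.η) := by
            apply div_le_div_of_nonneg_right _ (by positivity)
            linarith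
        _ = _ := by field_simp; ring
    rw [Finset.sum_add_distrib, Finset.sum_add_distrib, Finset.sum_add_distrib, ← Finset.sum_div,
      ← Finset.sum_div, Finset.sum_add_distrib, Finset.sum_neg_distrib, Finset.sum_const, Finset.sum_const, Finset.card_range, nsmul_eq_mul,
      nsmul_eq_mul]
    have h6 := mul_le_mul_of_nonneg_left hQ (a := P.η / 2) (by positivity)
    have h7 := mul_le_mul_of_nonneg_left hQ' hl.le
    rw [Finset.mul_sum] at h6 h7
    have h8 : P.M * (3 * P.ε / l) = P.M * (3 * P.ε) / l := by ring
    linarith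
  rw [Run.regret, sub_le_iff_le_add, ← sub_le_iff_le_add']
  refine le_csInf ⟨_, x₁, hx₁, rfl⟩ ?_
  rintro _ ⟨z, hz, rfl⟩
  have := key z hz
  simp only
  linarith

/-- The sketch never exceeds the sum of the `b bᵀ`, so the form is at most `ε_I + M(KG)²` times the
Euclidean one, and `𝒦` has diameter at most `2R`. -/
theorem IsRun.fwData (hs : Setting ρ 𝒦 f g R G α β P) (hr : IsRun 𝒦 g x₁ P r)
    (hx₁ : x₁ ∈ 𝒦) {m : ℕ} (hm : m < P.M) :
    FWData 𝒦 (sketchA P.εI (r.S (m + 1)))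
      (4 * R ^ 2 * (P.εI + P.M * (P.K * G) ^ 2)) := by
  have hε := hs.εI_pos
  obtain ⟨σ, hσ⟩ := hr.exists_shrinkage hs hx₁
  refine ⟨hs.convex, sketchA_isSymm _, normSqA_sketchA_nonneg _ hε, fun u hu v hv => ?_⟩
  have h1 : ‖u - v‖ ^ 2 ≤ 4 * R ^ 2 := by
    have h6 : ‖u‖ ≤ R := by simpa using hs.subset hu
    have h7 : ‖v‖ ≤ R := by simpa using hs.subset hv
    have h5 : ‖u - v‖ ≤ 2 * R := by linarith [norm_sub_le u v]
    exact (pow_le_pow_left₀ (norm_nonneg _) h5 2).trans_eq (by ring)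
  have h2 : ‖mv (r.S (m + 1)) (u - v)‖ ^ 2 ≤ P.M * (P.K * G) ^ 2 * ‖u - v‖ ^ 2 := by
    refine (sketch_upper hr.S_init hσ (u - v) (m + 1) hm).trans ?_
    calc _ ≤ ∑ j ∈ Finset.range (m + 1), (P.K * G) ^ 2 * ‖u - v‖ ^ 2 := by
          refine Finset.sum_le_sum fun j hj => (inner_sq_le _ _).trans ?_
          have hj' : j < P.M := by have := Finset.mem_range.1 hj; omega
          gcongr
          exact IsRun.norm_blockGrad_le hs hj' (hr.invariant hs hx₁ j hj'.le)
      _ = ((m + 1 : ℕ) : ℝ) * ((P.K * G) ^ 2 * ‖u - v‖ ^ 2) := by simp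
      _ ≤ P.M * ((P.K * G) ^ 2 * ‖u - v‖ ^ 2) := by
          have : ((m + 1 : ℕ) : ℝ) ≤ P.M := by exact_mod_cast hm
          gcongr
      _ = _ := by ring
  rw [normSqA_sketchA]
  have h3 := mul_le_mul_of_nonneg_left h1 (a := P.εI + P.M * (P.K * G) ^ 2) (by positivity)
  linarith

/-- The initial distance of a projection, which fixes the number of pulls. The old distance `3ε` at
most doubles when the norm changes to the new matrix, and the Newton step adds `η A⁻¹ b`. -/
theorem IsRun.normSqA_project_le (hs : Setting ρ 𝒦 f g R G α β P) (hr : IsRun 𝒦 g x₁ P r)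
    (hx₁ : x₁ ∈ 𝒦) {m : ℕ} (hm : m < P.M) :
    normSqA (sketchA P.εI (r.S (m + 1))) (r.x m - r.y (m + 1)) ≤
      12 * P.ε + 2 * P.η ^ 2 * (P.K * G) ^ 2 / P.εI := by
  have hε := hs.εI_pos
  obtain ⟨σ, hσ⟩ := hr.exists_shrinkage hs hx₁
  have hi := hr.invariant hs hx₁ m hm.le
  set b := r.blockGrad P.K g m
  have hb : ‖b‖ ^ 2 ≤ (P.K * G) ^ 2 := IsRun.normSq_blockGrad_le hs hm hi
  set A := sketchA P.εI (r.S (m + 1))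
  have e : r.x m - r.y (m + 1) = (r.x m - r.yt m) - (-P.η) • mv A⁻¹ b := by
    rw [hr.newton m hm]; module
  rw [e]
  refine (normSqA_sub_le (sketchA_isSymm _) (normSqA_sketchA_nonneg _ hε) _ _).trans ?_
  rw [normSqA_smul, normSqA_sketchA_inv _ hε]
  have h1 : normSqA A (r.x m - r.yt m) ≤ 6 * P.ε := by
    have h2 := normSqA_succ_le (hσ m hm) P.εI (r.x m - r.yt m)
    have h3 : (inner ℝ b (r.x m - r.yt m)) ^ 2 ≤ P.εI * (3 * P.ε / P.εI) := by
      refine (inner_sq_le _ _).trans ?_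
      have := hs.εI_ge
      exact mul_le_mul (by linarith) hi.dist (sq_nonneg _) hε.le
    have e : P.εI * (3 * P.ε / P.εI) = 3 * P.ε := by field_simp
    linarith [hi.near]
  have h2 : bil A⁻¹ b b ≤ (P.K * G) ^ 2 / P.εI :=
    (bil_sketchA_inv_le _ hε _).trans (by gcongr)
  have h3 := mul_le_mul_of_nonneg_left h2 (sq_nonneg P.η)
  have e2 : 2 * P.η ^ 2 * (P.K * G) ^ 2 / P.εI = 2 * (P.η ^ 2 * ((P.K * G) ^ 2 / P.εI)) := by ring
  rw [e2, neg_sq]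
  linarith

theorem IsRun.totalCalls_le (hs : Setting ρ 𝒦 f g R G α β P) (hr : IsRun 𝒦 g x₁ P r)
    (hx₁ : x₁ ∈ 𝒦) {D : ℝ} (hD : D = 4 * R ^ 2 * (P.εI + P.M * (P.K * G) ^ 2))
    (hεD : P.ε ≤ D) (N : ℕ)
    (hN : 12 * P.ε + 2 * P.η ^ 2 * (P.K * G) ^ 2 / P.εI ≤ (9 / 5) ^ N * P.ε) :
    (r.totalCalls P.M : ℝ) ≤ P.M * ((N + 1) * (4 * D / P.ε + 2)) := by
  rw [Run.totalCalls, Nat.cast_sum]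
  calc _ ≤ ∑ m ∈ Finset.range P.M, ((N : ℝ) + 1) * (4 * D / P.ε + 2) := by
        refine Finset.sum_le_sum fun m hm => ?_
        have hm := Finset.mem_range.1 hm
        have hd := hr.fwData hs hx₁ hm
        rw [← hD] at hd
        exact (hr.project m hm).calls_le hd hs.ε_pos hεD (hr.invariant hs hx₁ m hm.le).x_mem N
          ((hr.normSqA_project_le hs hx₁ hm).trans hN)
    _ = _ := by simp

end Run

/-! ### The choice of parameters -/

theorem rpow_third_mul {x : ℝ} (hx : 0 ≤ x) (k : ℕ) (y : ℝ) (hy : y = k / 3) :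
    x ^ y = (x ^ (1 / 3 : ℝ)) ^ k := by
  rw [← Real.rpow_natCast, ← Real.rpow_mul hx, hy]
  congr 1; ring

theorem rpow_neg_third_mul {x : ℝ} (hx : 0 ≤ x) (k : ℕ) (y : ℝ) (hy : y = -(k / 3)) :
    x ^ y = ((x ^ (1 / 3 : ℝ)) ^ k)⁻¹ := by
  rw [hy, Real.rpow_neg hx, rpow_third_mul hx k _ rfl]

theorem two_le_log {x : ℝ} (hx : 19 ≤ x) : 2 ≤ Real.log x := by
  rw [Real.le_log_iff_exp_le (by linarith)]
  have h := Real.exp_one_lt_d9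
  have : Real.exp 2 = Real.exp 1 ^ 2 := by rw [← Real.exp_nat_mul]; norm_num
  rw [this]
  nlinarith [Real.exp_pos 1]

/-- The parameters in terms of `p = ρ^{1/3}`, `s = T^{1/3}`, the logarithm `L` in the tolerance and
`q = 1 / (R²G²α²)`. -/
structure Scale (ρ T K : ℕ) (R G α p s L q : ℝ) : Prop where
  p_eq : p = (ρ : ℝ) ^ (1 / 3 : ℝ)
  s_eq : s = (T : ℝ) ^ (1 / 3 : ℝ)
  q_eq : q = 1 / (R ^ 2 * G ^ 2 * α ^ 2)
  one_le_p : 1 ≤ p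
  p_cube : (ρ : ℝ) = p ^ 3
  s_cube : (T : ℝ) = s ^ 3
  K_eq : (K : ℝ) = 4 * s ^ 2 / p
  M_eq : ((T / K : ℕ) : ℝ) = p * s / 4
  mul_eq : T / K * K = T
  K_pos : 0 < K
  two_le_L : 2 ≤ L
  L_le : 10 * L ≤ s
  exp_L : Real.exp L = 19 + 8 * (12 + q / 3) * s / p ^ 4
  q_pos : 0 < q
  L_le_log : L ≤ logFactor 1000 T R G α
  log_le_log : Real.log (1 + s / (8 * p ^ 4)) ≤ logFactor 1000 T R G α
  eta : etaChoice ρ T R G α = 8 * max (6 * G * R) (1 / α) * s ^ 2 / p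
  epsI : epsIChoice T G = 32 * G ^ 2 * s ^ 4
  eps : epsChoice ρ T R G α = 96 * G ^ 2 * R ^ 2 * L * s ^ 3

/-- All fractional powers become integer powers of `p` and `s`, so the later estimates are rational
identities plus `L ≤ s / 10`. -/
theorem exists_scale {ρ T K : ℕ} {R G α : ℝ} (hρ : 1 ≤ ρ) (hR : 0 < R) (hG : 0 < G) (hα : 0 < α)
    (hT : horizonThreshold 1000 ρ T R G α ≤ (T : ℝ))
    (hK : (K : ℝ) = 4 * (ρ : ℝ) ^ (-(1 / 3) : ℝ) * (T : ℝ) ^ (2 / 3 : ℝ)) (hKT : K ∣ T) :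
    ∃ p s L q, Scale ρ T K R G α p s L q := by
  have hρ' : (1 : ℝ) ≤ ρ := by exact_mod_cast hρ
  have hρ0 : (0 : ℝ) ≤ ρ := by linarith
  have hT0 : (0 : ℝ) ≤ T := Nat.cast_nonneg T
  set p : ℝ := (ρ : ℝ) ^ (1 / 3 : ℝ) with hp
  set s : ℝ := (T : ℝ) ^ (1 / 3 : ℝ) with hs
  set q : ℝ := 1 / (R ^ 2 * G ^ 2 * α ^ 2) with hq
  have hp1 : 1 ≤ p := Real.one_le_rpow hρ' (by norm_num)
  have hp0 : 0 < p := by linarith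
  have hq0 : 0 < q := by positivity
  have hs0 : 0 ≤ s := Real.rpow_nonneg hT0 _
  have hp3 : (ρ : ℝ) = p ^ 3 := by
    have := rpow_third_mul hρ0 3 1 (by norm_num)
    rwa [Real.rpow_one] at this
  have hs3 : (T : ℝ) = s ^ 3 := by
    have := rpow_third_mul hT0 3 1 (by norm_num)
    rwa [Real.rpow_one] at this
  have hs2 : (T : ℝ) ^ (2 / 3 : ℝ) = s ^ 2 := rpow_third_mul hT0 2 _ (by norm_num)
  have hs4 : (T : ℝ) ^ (4 / 3 : ℝ) = s ^ 4 := rpow_third_mul hT0 4 _ (by norm_num)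
  have hpm1 : (ρ : ℝ) ^ (-(1 / 3) : ℝ) = p⁻¹ := by
    rw [rpow_neg_third_mul hρ0 1 _ (by norm_num), pow_one]
  have hpm4 : (ρ : ℝ) ^ (-(4 / 3) : ℝ) = (p ^ 4)⁻¹ := rpow_neg_third_mul hρ0 4 _ (by norm_num)
  set x : ℝ := 19 + 8 * (12 + q / 3) * s / p ^ 4 with hx
  set x' : ℝ := 1000 + (1000 + 1000 * q) * s / p ^ 4 with hx'
  have hx19 : 19 ≤ x := by
    have : 0 ≤ 8 * (12 + q / 3) * s / p ^ 4 := by positivity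
    linarith
  have hxx' : x ≤ x' := by
    have h1 : 8 * (12 + q / 3) * s / p ^ 4 ≤ (1000 + 1000 * q) * s / p ^ 4 := by
      gcongr; linarith
    linarith
  have hL := two_le_log hx19
  have hL' : Real.log x ≤ Real.log x' := Real.log_le_log (by linarith) hxx'
  have hthr : 1000 * Real.log x' ^ 3 ≤ s ^ 3 := by
    rw [← hs3]
    refine le_trans (le_of_eq ?_) hT
    rw [horizonThreshold, hpm4, ← hs, hx', hq]
    congr 4
    field_simp
  -- The cube root of the horizon condition; the constant `1000` is `10³`.
  have h10 : 10 * Real.log x' ≤ s := by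
    have : (10 * Real.log x') ^ 3 ≤ s ^ 3 := by rw [mul_pow]; linarith
    exact le_of_pow_le_pow_left₀ (by norm_num) hs0 this
  have hs1 : 1 ≤ s := by linarith
  have hsp : 0 < s := by linarith
  have hKeq : (K : ℝ) = 4 * s ^ 2 / p := by rw [hK, hpm1, hs2]; ring
  have hKpos : 0 < K := by
    have : (0 : ℝ) < K := by rw [hKeq]; positivity
    exact_mod_cast this
  have hmul : T / K * K = T := Nat.div_mul_cancel hKT
  have hM : ((T / K : ℕ) : ℝ) = p * s / 4 := by
    have h1 : ((T / K : ℕ) : ℝ) * K = T := by exact_mod_cast hmul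
    rw [hKeq, hs3] at h1
    field_simp at h1
    linarith
  have hlf : logFactor 1000 T R G α = Real.log ((1000 + 1000 * q) * s) := by
    rw [logFactor, ← hs, hq]; congr 2; field_simp
  have hdiv : s / p ^ 4 ≤ s := div_le_self hs0 (one_le_pow₀ hp1)
  refine ⟨p, s, Real.log x, q, rfl, rfl, rfl, hp1, hp3, hs3, hKeq, hM, hmul, hKpos, hL,
    by linarith, Real.exp_log (by linarith), hq0, ?_, ?_, ?_, ?_, ?_⟩
  · rw [hlf]
    refine Real.log_le_log (by linarith) ?_
    have : 8 * (12 + q / 3) * s / p ^ 4 ≤ 8 * (12 + q / 3) * s := by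
      rw [mul_div_assoc]; gcongr
    have : 0 ≤ q * s := by positivity
    linarith
  · rw [hlf]
    refine Real.log_le_log (by positivity) ?_
    have : s / (8 * p ^ 4) ≤ s := div_le_self hs0 (by linarith [one_le_pow₀ hp1 (n := 4)])
    have : 0 ≤ q * s := by positivity
    linarith
  · rw [etaChoice, hpm1, hs2]; ring
  · rw [epsIChoice, hs4]
  · rw [epsChoice, hpm4, ← hs, hs3, hx, hq]
    congr 3
    field_simp

/-- `e ≤ (9/5)²`, so `⌈2L⌉` pulls bring down a factor `exp L`. -/
theorem exp_le_pow_ceil (L : ℝ) : Real.exp L ≤ (9 / 5) ^ ⌈2 * L⌉₊ := by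
  have h1 : Real.exp (1 / 2) ≤ 9 / 5 := by
    refine abs_le_of_sq_le_sq' ?_ (by norm_num) |>.2
    rw [← Real.exp_nat_mul]
    have := Real.exp_one_lt_d9
    norm_num at this ⊢
    linarith
  calc Real.exp L ≤ Real.exp (⌈2 * L⌉₊ * (1 / 2)) := by
        refine Real.exp_le_exp.2 ?_
        linarith [Nat.le_ceil (2 * L)]
    _ = Real.exp (1 / 2) ^ ⌈2 * L⌉₊ := by rw [Real.exp_nat_mul]
    _ ≤ _ := pow_le_pow_left₀ (Real.exp_pos _).le h1 _

/-- The choice of the free parameter in the regret bound. -/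
theorem exists_young {E B W : ℝ} (hE : 0 < E) (hB : 0 < B) (hW : 0 ≤ W)
    (h : E * B ≤ W ^ 2) : ∃ l : ℝ, 0 < l ∧ (l * E + B / l) / 2 ≤ W := by
  have hW' : 0 < W := by
    rcases hW.eq_or_lt with h0 | h0
    · rw [← h0] at h; nlinarith [mul_pos hE hB]
    · exact h0
  refine ⟨W / E, by positivity, ?_⟩
  have e1 : W / E * E = W := by field_simp
  have e2 : B / (W / E) ≤ W := by
    rw [div_le_iff₀ (by positivity)]
    have : W * (W / E) = W ^ 2 / E := by ring
    rw [this, le_div_iff₀ hE]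
    linarith
  linarith

/-! ### Consequences of the choice of parameters -/

namespace Scale

variable {ρ T K : ℕ} {R G α p s L q : ℝ}

theorem s_pos (h : Scale ρ T K R G α p s L q) : 0 < s := by linarith [h.L_le, h.two_le_L]

theorem ratio_eq (h : Scale ρ T K R G α p s L q) (hG : 0 < G) :
    3 * epsChoice ρ T R G α / epsIChoice T G = 9 * R ^ 2 * L / s := by
  have := h.s_pos
  rw [h.eps, h.epsI]; field_simp; ring

theorem max_le_eta (h : Scale ρ T K R G α p s L q) :
    max (12 * K * G * R) (2 * K / α) ≤ etaChoice ρ T R G α := by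
  have hp : 0 < p := by linarith [h.one_le_p]
  have hs := h.s_pos
  rw [h.eta, h.K_eq]
  have e : 8 * max (6 * G * R) (1 / α) * s ^ 2 / p =
      max (6 * G * R) (1 / α) * (8 * s ^ 2 / p) := by ring
  rw [e, max_mul_of_nonneg _ _ (by positivity)]
  refine le_of_eq ?_
  congr 1 <;> ring

theorem sq_eq (h : Scale ρ T K R G α p s L q) (hG : 0 < G) :
    (K * G) ^ 2 = epsIChoice T G / (2 * p ^ 2) := by
  have hp : 0 < p := by linarith [h.one_le_p]
  rw [h.epsI, h.K_eq]; field_simp; ring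

theorem sq_le (h : Scale ρ T K R G α p s L q) (hG : 0 < G) :
    (K * G) ^ 2 ≤ epsIChoice T G / 2 := by
  have hp := one_le_pow₀ h.one_le_p (n := 2)
  rw [h.sq_eq hG, h.epsI]
  have := h.s_pos
  gcongr
  linarith

theorem ratio_le (h : Scale ρ T K R G α p s L q) (hG : 0 < G) :
    3 * epsChoice ρ T R G α / epsIChoice T G ≤ 4 * R ^ 2 := by
  rw [h.ratio_eq hG, div_le_iff₀ h.s_pos]
  nlinarith [sq_nonneg R, h.L_le, h.two_le_L, mul_nonneg (sq_nonneg R) (sub_nonneg.2 h.L_le)]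

theorem setting {n : ℕ} {𝒦 : Set (Vec n)} {f : ℕ → Vec n → ℝ} {g : ℕ → Vec n → Vec n} {β : ℝ}
    (h : Scale ρ T K R G α p s L q) (hρ : 1 ≤ ρ) (hρn : ρ ≤ n) (hR : 0 < R) (hG : 0 < G)
    (hα : 0 < α) (hβ : 0 ≤ β) (h𝒦 : Convex ℝ 𝒦) (hsub : 𝒦 ⊆ Metric.closedBall 0 R)
    (hloss : ∀ t < T, IsAdmissibleLoss R G α β (f t) (g t)) :
    Setting ρ 𝒦 f g R G α β (paramChoice ρ T K R G α) := by
  have hs := h.s_pos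
  have hL := h.two_le_L
  refine ⟨hρ, hρn, hR, hG, hα, hβ, h𝒦, hsub, ?_, h.K_pos, ?_, ?_, h.max_le_eta, h.sq_le hG,
    h.ratio_le hG⟩
  · intro t ht
    refine hloss t ?_
    rwa [show (paramChoice ρ T K R G α).M * (paramChoice ρ T K R G α).K = T from h.mul_eq] at ht
  · change 0 < epsChoice ρ T R G α
    rw [h.eps]; positivity
  · change 0 < epsIChoice T G
    rw [h.epsI]; positivity

theorem totalCalls_le {n : ℕ} {𝒦 : Set (Vec n)} {f : ℕ → Vec n → ℝ} {g : ℕ → Vec n → Vec n} {β : ℝ}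
    (h : Scale ρ T K R G α p s L q) {x₁ : Vec n} {r : Run n ρ}
    (hs : Setting ρ 𝒦 f g R G α β (paramChoice ρ T K R G α))
    (hr : IsRun 𝒦 g x₁ (paramChoice ρ T K R G α) r) (hx₁ : x₁ ∈ 𝒦) :
    (r.totalCalls (T / K) : ℝ) ≤ 0.65 * (8 * p * s ^ 2 + T) := by
  have hR := hs.R_pos
  have hG := hs.G_pos
  have hα := hs.α_pos
  have hs0 := h.s_pos
  have hp1 := h.one_le_p
  have hp : 0 < p := by linarith
  have hL := h.two_le_L
  have hL0 : 0 < L := by linarith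
  have hLs := h.L_le
  set D := 4 * R ^ 2 * (epsIChoice T G + (T / K : ℕ) * (K * G) ^ 2) with hD
  have hX : D / epsChoice ρ T R G α = s * (8 + s / p) / (6 * L) := by
    rw [hD, h.epsI, h.eps, h.M_eq, h.K_eq]; field_simp; ring
  have hε : 0 < epsChoice ρ T R G α := hs.ε_pos
  set X := s * (8 + s / p) / (6 * L) with hXdef
  have hX2 : 2 ≤ X := by
    rw [hXdef, le_div_iff₀ (by positivity)]
    have : 0 ≤ s * (s / p) := by positivity
    nlinarith
  have hεD : epsChoice ρ T R G α ≤ D := by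
    have : D = X * epsChoice ρ T R G α := by rw [← hX]; field_simp
    rw [this]; nlinarith
  have hN : 12 * epsChoice ρ T R G α +
      2 * etaChoice ρ T R G α ^ 2 * (K * G) ^ 2 / epsIChoice T G ≤
      (9 / 5) ^ ⌈2 * L⌉₊ * epsChoice ρ T R G α := by
    -- In `exp L` the constant `19` absorbs the `12`, and the other summand absorbs the Newton step
    -- with a factor `4L` to spare.
    refine le_trans ?_ (mul_le_mul_of_nonneg_right (exp_le_pow_ceil L) hε.le)
    rw [h.exp_L]
    have hμ : max (6 * G * R) (1 / α) ^ 2 ≤ G ^ 2 * R ^ 2 * (36 + q) := by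
      have e : G ^ 2 * R ^ 2 * (36 + q) = (6 * G * R) ^ 2 + (1 / α) ^ 2 := by
        rw [h.q_eq]; field_simp; ring
      rw [e]
      rcases max_choice (6 * G * R) (1 / α) with h | h <;> rw [h]
      · linarith [sq_nonneg (1 / α)]
      · linarith [sq_nonneg (6 * G * R)]
    have e1 : 2 * etaChoice ρ T R G α ^ 2 * (K * G) ^ 2 / epsIChoice T G =
        64 * max (6 * G * R) (1 / α) ^ 2 * (s ^ 4 / p ^ 4) := by
      rw [h.sq_eq hG, h.eta, h.epsI]; field_simp; ring
    have e2 : 64 * (G ^ 2 * R ^ 2 * (36 + q)) * (s ^ 4 / p ^ 4) ≤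
        8 * (12 + q / 3) * s / p ^ 4 * epsChoice ρ T R G α := by
      rw [h.eps]
      have e3 : 8 * (12 + q / 3) * s / p ^ 4 * (96 * G ^ 2 * R ^ 2 * L * s ^ 3) =
          64 * (G ^ 2 * R ^ 2 * (36 + q)) * (s ^ 4 / p ^ 4) * (4 * L) := by
        field_simp; ring
      rw [e3]
      have := h.q_pos
      exact le_mul_of_one_le_right (by positivity) (by linarith)
    have e4 : 64 * max (6 * G * R) (1 / α) ^ 2 * (s ^ 4 / p ^ 4) ≤
        64 * (G ^ 2 * R ^ 2 * (36 + q)) * (s ^ 4 / p ^ 4) := by gcongr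
    rw [e1]
    linarith
  have hcalls := hr.totalCalls_le hs hx₁ (D := D) rfl hεD ⌈2 * L⌉₊ hN
  change (r.totalCalls (T / K) : ℝ) ≤ ((T / K : ℕ) : ℝ) * ((⌈2 * L⌉₊ + 1) *
    (4 * D / epsChoice ρ T R G α + 2)) at hcalls
  refine hcalls.trans ?_
  have e5 : 4 * D / epsChoice ρ T R G α = 4 * X := by rw [← hX]; ring
  have hceil : (⌈2 * L⌉₊ : ℝ) + 1 ≤ 3 * L := by
    linarith [Nat.ceil_lt_add_one (a := 2 * L) (by linarith)]
  rw [e5, h.M_eq, h.s_cube]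
  -- The `L` from the number of pulls cancels against the denominator of `X = D / ε`, so the total
  -- carries no logarithm.
  calc p * s / 4 * ((⌈2 * L⌉₊ + 1) * (4 * X + 2)) ≤ p * s / 4 * (3 * L * (5 * X)) := by
        gcongr; linarith
    _ = 0.625 * (8 * p * s ^ 2 + s ^ 3) := by
        rw [hXdef]; field_simp; norm_num
    _ ≤ 0.65 * (8 * p * s ^ 2 + s ^ 3) := by gcongr; norm_num

theorem regret_le {n : ℕ} {𝒦 : Set (Vec n)} {f : ℕ → Vec n → ℝ} {g : ℕ → Vec n → Vec n} {β : ℝ}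
    (h : Scale ρ T K R G α p s L q) {x₁ : Vec n} {r : Run n ρ}
    (hs : Setting ρ 𝒦 f g R G α β (paramChoice ρ T K R G α))
    (hr : IsRun 𝒦 g x₁ (paramChoice ρ T K R G α) r) (hx₁ : x₁ ∈ 𝒦) :
    r.regret 𝒦 f T K ≤ regretBound 1000 ρ T R G α β (tailEigen (r.grad K g) T ρ) := by
  have hR := hs.R_pos
  have hG := hs.G_pos
  have hα := hs.α_pos
  have hβ := hs.β_nonneg
  have hs0 := h.s_pos
  have hp1 := h.one_le_p
  have hp : 0 < p := by linarith
  have hL := h.two_le_L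
  set Λ := logFactor 1000 T R G α with hΛ
  have hLΛ : L ≤ Λ := h.L_le_log
  have hΛ0 : 0 < Λ := by linarith
  set Ω := tailEigen (r.grad K g) T ρ with hΩ
  have hΩ0 : 0 ≤ Ω := tailEigen_nonneg _ _ _
  set μ := max (6 * G * R) (1 / α) with hμ
  have hμ1 : 6 * G * R ≤ μ := le_max_left _ _
  have hμ0 : 0 < μ := lt_of_lt_of_le (by positivity) hμ1
  have hμ2 : μ ≤ 6 * G * R + 1 / α :=
    max_le (by linarith [show 0 < 1 / α by positivity]) (by
      linarith [show 0 < 6 * G * R by positivity])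
  -- The second summand is the shrinkage term `(ρ + 1) K Ω / ε_I` after `ρ + 1 ≤ 2p³` and `K =
  -- 4s²/p`.
  set E := p ^ 3 * Λ + p ^ 2 * Ω / (4 * s ^ 2 * G ^ 2) with hE
  have hE0 : 0 < E := by positivity
  have hpot : ρ * Real.log (1 + ((T / K : ℕ) : ℝ) * (K * G) ^ 2 / (ρ * epsIChoice T G))
      + (ρ + 1) * (K * Ω) / epsIChoice T G ≤ E := by
    have e1 : ((T / K : ℕ) : ℝ) * (K * G) ^ 2 / (ρ * epsIChoice T G) = s / (8 * p ^ 4) := by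
      rw [h.M_eq, h.K_eq, h.epsI, h.p_cube]; field_simp; ring
    rw [e1, h.p_cube]
    refine add_le_add (mul_le_mul_of_nonneg_left h.log_le_log (by positivity)) ?_
    have h1 : (1 : ℝ) ≤ p ^ 3 := one_le_pow₀ hp1
    have hK0 : (0 : ℝ) ≤ K := Nat.cast_nonneg K
    calc (p ^ 3 + 1) * (K * Ω) / epsIChoice T G ≤ (p ^ 3 + p ^ 3) * (K * Ω) / epsIChoice T G := by
          rw [h.epsI]; gcongr
      _ = _ := by rw [h.K_eq, h.epsI]; field_simp; ring
  set hh := (ρ : ℝ) ^ (1 / 2 : ℝ) with hhh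
  have hh2 : hh ^ 2 = p ^ 3 := by
    rw [hhh, ← Real.sqrt_eq_rpow, Real.sq_sqrt (Nat.cast_nonneg ρ), h.p_cube]
  have hh0 : 0 ≤ hh := Real.rpow_nonneg (Nat.cast_nonneg ρ) _
  -- In the product under the square root of Young's inequality, `a²` covers the part with `Λ²` (`90
  -- ≤ 144`) and `b²` the part with `ΩΛ` (`22.5 ≤ 25`). Later `a` raises the coefficient `24GR` of
  -- the Newton term to `36GR`, and `b` is the term with `√Ω`.
  set a := 12 * G * R * p ^ 2 * s ^ 2 * Λ with ha
  set b := 5 * R * hh * s * Real.sqrt Ω * Real.sqrt Λ with hb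
  have ha0 : 0 ≤ a := by positivity
  have hb0 : 0 ≤ b := by positivity
  obtain ⟨l, hl, hlW⟩ : ∃ l : ℝ, 0 < l ∧
      (l * (5 / 4 * E) + ((T / K : ℕ) : ℝ) * (3 * epsChoice ρ T R G α) / l) / 2 ≤ a + b := by
    have hB : ((T / K : ℕ) : ℝ) * (3 * epsChoice ρ T R G α) = 72 * G ^ 2 * R ^ 2 * p * s ^ 4 * L := by
      rw [h.M_eq, h.eps]; ring
    refine exists_young (by positivity) (by rw [hB]; positivity) (by positivity) ?_
    have hb2 : b ^ 2 = 25 * R ^ 2 * p ^ 3 * s ^ 2 * Ω * Λ := by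
      rw [hb, ← hh2]
      simp only [mul_pow]
      rw [Real.sq_sqrt hΩ0, Real.sq_sqrt hΛ0.le]; norm_num
    have hab : a ^ 2 + b ^ 2 ≤ (a + b) ^ 2 := by nlinarith
    refine le_trans ?_ hab
    rw [hB, hb2]
    calc 5 / 4 * E * (72 * G ^ 2 * R ^ 2 * p * s ^ 4 * L)
        ≤ 5 / 4 * E * (72 * G ^ 2 * R ^ 2 * p * s ^ 4 * Λ) := by gcongr
      _ = 90 * (G ^ 2 * R ^ 2 * p ^ 4 * s ^ 4 * Λ ^ 2)
          + 22.5 * (R ^ 2 * p ^ 3 * s ^ 2 * Ω * Λ) := by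
        rw [hE]; field_simp; ring
      _ ≤ 144 * (G ^ 2 * R ^ 2 * p ^ 4 * s ^ 4 * Λ ^ 2)
          + 25 * (R ^ 2 * p ^ 3 * s ^ 2 * Ω * Λ) := by
        gcongr <;> norm_num
      _ = _ := by rw [ha]; ring
  have hPK : (paramChoice ρ T K R G α).M * (paramChoice ρ T K R G α).K = T := h.mul_eq
  have hreg := hr.regret_le hs hx₁ (l := l) (E := E) hl (by rw [hPK]; exact hpot)
  rw [hPK] at hreg
  change r.regret 𝒦 f T K ≤ ((T / K : ℕ) : ℝ) * (K : ℝ) *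
      (β * (3 * epsChoice ρ T R G α / epsIChoice T G))
      + 2 * R ^ 2 * epsIChoice T G / etaChoice ρ T R G α + etaChoice ρ T R G α / 2 * E
      + (l * (5 / 4 * E) + ((T / K : ℕ) : ℝ) * (3 * epsChoice ρ T R G α) / l) / 2 at hreg
  refine hreg.trans ?_
  have t1 : ((T / K : ℕ) : ℝ) * (K : ℝ) * (β * (3 * epsChoice ρ T R G α / epsIChoice T G)) ≤
      9 * β * R ^ 2 * s ^ 2 * Λ := by
    rw [h.ratio_eq hG, h.M_eq, h.K_eq]
    calc _ = 9 * β * R ^ 2 * s ^ 2 * L := by field_simp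
      _ ≤ _ := by gcongr
  have t2 : 2 * R ^ 2 * epsIChoice T G / etaChoice ρ T R G α ≤ 2 * R * G * p * s ^ 2 := by
    rw [h.epsI, h.eta, ← hμ]
    calc _ = 8 * R ^ 2 * G ^ 2 * s ^ 2 * p / μ := by field_simp; ring
      _ ≤ 8 * R ^ 2 * G ^ 2 * s ^ 2 * p / (6 * G * R) := by gcongr
      _ = 4 / 3 * (R * G * p * s ^ 2) := by field_simp; norm_num
      _ ≤ 2 * (R * G * p * s ^ 2) := by gcongr; norm_num
      _ = _ := by ring
  have t3 : etaChoice ρ T R G α / 2 * E ≤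
      (24 * G * R + 4 / α) * p ^ 2 * s ^ 2 * Λ + (6 * G * R + 1 / α) * (p * Ω / G ^ 2) := by
    rw [h.eta, ← hμ, hE]
    calc _ = 4 * μ * (p ^ 2 * s ^ 2 * Λ) + μ * (p * Ω / G ^ 2) := by field_simp; ring
      _ ≤ 4 * (6 * G * R + 1 / α) * (p ^ 2 * s ^ 2 * Λ)
          + (6 * G * R + 1 / α) * (p * Ω / G ^ 2) := by gcongr
      _ = _ := by ring
  have hρ2 : p ^ 2 ≤ ((ρ : ℝ) + 1) ^ (2 / 3 : ℝ) := by
    have : p ^ 2 = (ρ : ℝ) ^ (2 / 3 : ℝ) := by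
      rw [h.p_eq, rpow_third_mul (Nat.cast_nonneg ρ) 2 (2 / 3) (by norm_num)]
    rw [this]
    exact Real.rpow_le_rpow (Nat.cast_nonneg ρ) (by linarith) (by norm_num)
  have t4 : (36 * G * R + 4 / α) * p ^ 2 * s ^ 2 * Λ ≤
      (36 * G * R + 4 / α) * ((ρ : ℝ) + 1) ^ (2 / 3 : ℝ) * s ^ 2 * Λ := by gcongr
  rw [regretBound, ← hΛ, ← hhh, ← h.p_eq, ← h.s_eq,
    rpow_third_mul (Nat.cast_nonneg T) 2 (2 / 3) (by norm_num), ← h.s_eq]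
  have e : (36 * G * R + 4 / α) * p ^ 2 * s ^ 2 * Λ =
      (24 * G * R + 4 / α) * p ^ 2 * s ^ 2 * Λ + a := by rw [ha]; ring
  linarith

end Scale

/-! ### The program -/

section Straight

variable {r n ρ : ℕ}

/-- A nonempty list of instructions as a program. -/
def straight (i : Instr r) : List (Instr r) → Prog r
  | [] => .instr i
  | j :: l => .seq (.instr i) (straight j l)

/-- The state after one instruction. -/
noncomputable def Instr.step (e : Env n ρ) (s : State r n ρ) (i : Instr r) : State r n ρ :=
  (i.effect e s).tick (i.cost n ρ)

theorem exec_straight (e : Env n ρ) (i : Instr r) (l : List (Instr r)) (s : State r n ρ) :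
    Exec e (straight i l) s ((i :: l).foldl (Instr.step e) s) := by
  induction l generalizing i s with
  | nil => exact Exec.instr i s
  | cons j l ih => exact Exec.seq _ _ _ _ _ (Exec.instr i s) (ih j _)

end Straight

/-- `w ← x - y`, `aw ← A w`, `nrm ← ‖w‖_A²` -/
def residualProg : Prog 17 :=
  -- Register convention. Vectors: 1 `x`, 2 `ỹ`, 3 block gradient, 5 `y`, 6 `x - y`, 7 `A(x - y)`, 8
  -- oracle answer `v`, 9 `x - v`, 4 scratch. Scalars: 0 to 9 constants, 10 block counter, 11 round
  -- counter, 12 squared distance, 13 gap, 14 flag, 15 curvature, 16 step length or `σ`. Matrix 0 is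
  -- the sketch and short vector 1 holds its shifted eigenvalues.
  straight (.axpy 6 9 5 1) [.mulVec 3 0 6, .mulVecT 4 0 3, .axpy 7 4 6 4, .dot 12 6 7]

/-- `dv ← x - v` for the answer `v` of the LOO, and the dual gap -/
def gapProg : Prog 17 := straight (.loo 8 7) [.axpy 9 9 8 1, .dot 13 7 9]

/-- `‖dv‖_A²` -/
def curvProg : Prog 17 :=
  straight (.mulVec 3 0 9) [.mulVecT 4 0 3, .axpy 4 4 9 4, .dot 15 9 4]

/-- `x ← x - σ dv` -/
def moveProg : Prog 17 := straight (.arith .mul 16 16 9) [.axpy 1 16 9 1]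

/-- line search and step -/
def stepProg : Prog 17 :=
  .seq curvProg (.seq (.ite 13 15 (.instr (.arith .div 16 13 15)) (.instr (.arith .add 16 1 0)))
    moveProg)

/-- raise the flag that ends the Frank-Wolfe loop -/
def haltProg : Prog 17 := .instr (.arith .add 14 1 0)

/-- one iteration of Frank-Wolfe -/
def fwBody : Prog 17 :=
  .seq residualProg (.seq gapProg (.ite 13 3 haltProg (.ite 12 7 haltProg stepProg)))

/-- the Frank-Wolfe routine -/
def fwProg : Prog 17 := .seq (.instr (.arith .add 14 0 0)) (.loop 14 1 fwBody)

/-- `y ← y - (2/3) (y - x)` -/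
def pullProg : Prog 17 := straight (.axpy 4 9 1 5) [.axpy 5 8 4 5]

/-- one iteration of the approximately-feasible projection -/
def afpBody : Prog 17 := .seq fwProg (.ite 12 7 (.instr (.arith .add 14 0 0)) pullProg)

/-- the approximately-feasible projection -/
def afpProg : Prog 17 := .seq residualProg (.loop 7 12 afpBody)

/-- one round: play, observe the gradient and add it to the block gradient -/
def roundProg : Prog 17 := straight (.round 1 2 4) [.axpy 3 1 4 3, .arith .add 11 11 1]

/-- the rounds of a block -/
def roundsProg : Prog 17 :=
  .seq (straight (.arith .add 11 0 0) [.axpy 3 0 0 0]) (.loop 11 5 roundProg)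

/-- the Frequent Directions step -/
def sketchProg : Prog 17 :=
  straight (.setLastRow 0 3) [.gram 0 0, .eigen 0 1 0, .smallTMul 0 1 0, .shortLast 16 0,
    .shortFill 1 16, .shortArith .sub 1 0 1, .shortArith .div 2 1 0, .shortSqrt 2 2,
    .diagMul 0 2 0]

/-- the Newton step -/
def newtonProg : Prog 17 :=
  straight (.mulVec 3 0 3) [.shortFill 4 4, .shortArith .add 4 4 1, .shortArith .div 3 3 4,
    .mulVecT 4 0 3, .axpy 4 9 4 3, .axpy 5 2 4 2]

/-- `ỹ ← y` and increment of the block counter -/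
def nextProg : Prog 17 := straight (.axpy 2 0 0 5) [.arith .add 10 10 1]

/-- one block -/
def blockProg : Prog 17 :=
  .seq roundsProg (.seq sketchProg (.seq newtonProg (.seq afpProg nextProg)))

/-- constants and initial points -/
def initProg : Prog 17 :=
  straight (.const 1 1) [.input 3 .eps, .input 4 .epsI, .input 5 .blockLen, .input 6 .blocks,
    .const 7 3, .arith .mul 7 7 3, .const 8 (-2 / 3), .const 9 (-1), .input 2 .eta,
    .arith .mul 2 2 9, .arith .div 2 2 4, .start 1, .start 2]

/-- the online Newton step -/
def mainProg : Prog 17 := .seq initProg (.loop 10 6 blockProg)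

/-! ### Execution of the straight-line parts -/

/-- The registers that are constant after the initialization. -/
structure Consts {n ρ : ℕ} (P : Params) (s : State 17 n ρ) : Prop where
  zero : s.sc 0 = 0
  one : s.sc 1 = 1
  step : s.sc 2 = P.η * (-1) / P.εI
  eps : s.sc 3 = P.ε
  epsI : s.sc 4 = P.εI
  blockLen : s.sc 5 = P.K
  blocks : s.sc 6 = P.M
  eps3 : s.sc 7 = 3 * P.ε
  pull : s.sc 8 = -2 / 3
  negOne : s.sc 9 = -1
  vzero : s.vec 0 = 0

/-- The registers that are constant during a projection. -/
structure ProjInv {n ρ : ℕ} (P : Params) (S : Matrix (Fin (ρ + 1)) (Fin n) ℝ) (c : ℝ)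
    (lg : List (Vec n × Vec n)) (s : State 17 n ρ) : Prop extends Consts P s where
  mat : s.mat 0 = S
  cnt : s.sc 10 = c
  log : s.log = lg

section Segments

variable {n ρ : ℕ} {P : Params} {S : Matrix (Fin (ρ + 1)) (Fin n) ℝ} {c : ℝ}
  {lg : List (Vec n × Vec n)}

theorem mv_sketchA (εI : ℝ) (S : Matrix (Fin (ρ + 1)) (Fin n) ℝ) (w : Vec n) :
    mv (sketchA εI S) w = εI • w + WithLp.toLp 2 (Sᵀ *ᵥ (S *ᵥ w.ofLp)) := by
  simp only [mv, sketchA, Matrix.add_mulVec, Matrix.smul_mulVec, Matrix.one_mulVec,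
    ← Matrix.mulVec_mulVec, WithLp.toLp_add, WithLp.toLp_smul]

theorem Consts.congr {s s' : State 17 n ρ} (h : Consts P s)
    (h0 : s'.sc 0 = s.sc 0) (h1 : s'.sc 1 = s.sc 1) (h2 : s'.sc 2 = s.sc 2)
    (h3 : s'.sc 3 = s.sc 3) (h4 : s'.sc 4 = s.sc 4) (h5 : s'.sc 5 = s.sc 5)
    (h6 : s'.sc 6 = s.sc 6) (h7 : s'.sc 7 = s.sc 7) (h8 : s'.sc 8 = s.sc 8)
    (h9 : s'.sc 9 = s.sc 9) (hv : s'.vec 0 = s.vec 0) : Consts P s' :=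
  ⟨h0.trans h.zero, h1.trans h.one, h2.trans h.step, h3.trans h.eps, h4.trans h.epsI,
    h5.trans h.blockLen, h6.trans h.blocks, h7.trans h.eps3, h8.trans h.pull, h9.trans h.negOne,
    hv.trans h.vzero⟩

theorem residual_exec (e : Env n ρ) {s : State 17 n ρ} (h : ProjInv P S c lg s) :
    ∃ s', Exec e residualProg s s' ∧ ProjInv P S c lg s' ∧ s'.vec 1 = s.vec 1 ∧
      s'.vec 5 = s.vec 5 ∧ s'.vec 7 = mv (sketchA P.εI S) (s.vec 1 - s.vec 5) ∧
      s'.sc 12 = normSqA (sketchA P.εI S) (s.vec 1 - s.vec 5) ∧ s'.sc 14 = s.sc 14 ∧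
      s'.looCalls = s.looCalls ∧ s'.time = s.time + (4 * ((ρ + 1) * n) + 6 * n) := by
  have hw : (-1 : ℝ) • s.vec 5 + s.vec 1 = s.vec 1 - s.vec 5 := by module
  refine ⟨_, exec_straight _ _ _ _, ⟨h.toConsts.congr ?_ ?_ ?_ ?_ ?_ ?_ ?_ ?_ ?_ ?_ ?_, ?_, ?_, ?_⟩,
    ?_, ?_, ?_, ?_, ?_, ?_, ?_⟩
  all_goals simp only [List.foldl_cons, List.foldl_nil, Instr.step, Instr.effect, State.tick,
    Instr.cost, Function.update_apply, Fin.reduceEq, reduceIte, h.negOne, h.epsI, h.mat, h.cnt,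
    h.log, hw, ← mv_sketchA, normSqA, bil_eq_inner]
  ring

theorem gap_exec (e : Env n ρ) {s : State 17 n ρ} (h : ProjInv P S c lg s) :
    ∃ s', Exec e gapProg s s' ∧ ProjInv P S c lg s' ∧ s'.vec 1 = s.vec 1 ∧
      s'.vec 5 = s.vec 5 ∧ s'.vec 9 = s.vec 1 - e.loo (s.vec 7) ∧
      s'.sc 13 = inner ℝ (s.vec 7) (s.vec 1 - e.loo (s.vec 7)) ∧
      s'.sc 12 = s.sc 12 ∧ s'.sc 14 = s.sc 14 ∧
      s'.looCalls = s.looCalls + 1 ∧ s'.time = s.time + 5 * n := by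
  have hw : (-1 : ℝ) • e.loo (s.vec 7) + s.vec 1 = s.vec 1 - e.loo (s.vec 7) := by module
  refine ⟨_, exec_straight _ _ _ _, ⟨h.toConsts.congr ?_ ?_ ?_ ?_ ?_ ?_ ?_ ?_ ?_ ?_ ?_, ?_, ?_, ?_⟩,
    ?_, ?_, ?_, ?_, ?_, ?_, ?_, ?_⟩
  all_goals simp only [List.foldl_cons, List.foldl_nil, Instr.step, Instr.effect, State.tick,
    Instr.cost, Function.update_apply, Fin.reduceEq, reduceIte, h.negOne, h.mat, h.cnt, h.log, hw]
  ring

theorem curv_exec (e : Env n ρ) {s : State 17 n ρ} (h : ProjInv P S c lg s) :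
    ∃ s', Exec e curvProg s s' ∧ ProjInv P S c lg s' ∧ s'.vec 1 = s.vec 1 ∧
      s'.vec 5 = s.vec 5 ∧ s'.vec 9 = s.vec 9 ∧ s'.sc 13 = s.sc 13 ∧ s'.sc 14 = s.sc 14 ∧
      s'.sc 15 = normSqA (sketchA P.εI S) (s.vec 9) ∧
      s'.looCalls = s.looCalls ∧ s'.time = s.time + (4 * ((ρ + 1) * n) + 4 * n) := by
  refine ⟨_, exec_straight _ _ _ _, ⟨h.toConsts.congr ?_ ?_ ?_ ?_ ?_ ?_ ?_ ?_ ?_ ?_ ?_, ?_, ?_, ?_⟩,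
    ?_, ?_, ?_, ?_, ?_, ?_, ?_, ?_⟩
  all_goals simp only [List.foldl_cons, List.foldl_nil, Instr.step, Instr.effect, State.tick,
    Instr.cost, Function.update_apply, Fin.reduceEq, reduceIte, h.epsI, h.mat, h.cnt, h.log, ← mv_sketchA, normSqA, bil_eq_inner]
  ring

theorem move_exec (e : Env n ρ) {s : State 17 n ρ} (h : ProjInv P S c lg s) :
    ∃ s', Exec e moveProg s s' ∧ ProjInv P S c lg s' ∧
      s'.vec 1 = (s.sc 16 * (-1)) • s.vec 9 + s.vec 1 ∧
      s'.vec 5 = s.vec 5 ∧ s'.sc 14 = s.sc 14 ∧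
      s'.looCalls = s.looCalls ∧ s'.time = s.time + (1 + 2 * n) := by
  refine ⟨_, exec_straight _ _ _ _, ⟨h.toConsts.congr ?_ ?_ ?_ ?_ ?_ ?_ ?_ ?_ ?_ ?_ ?_, ?_, ?_, ?_⟩,
    ?_, ?_, ?_, ?_, ?_⟩
  all_goals simp only [List.foldl_cons, List.foldl_nil, Instr.step, Instr.effect, State.tick,
    Instr.cost, Arith.eval, Function.update_apply, Fin.reduceEq, reduceIte, h.negOne, h.mat, h.cnt, h.log]
  ring

theorem pull_exec (e : Env n ρ) {s : State 17 n ρ} (h : ProjInv P S c lg s) :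
    ∃ s', Exec e pullProg s s' ∧ ProjInv P S c lg s' ∧ s'.vec 1 = s.vec 1 ∧
      s'.vec 5 = s.vec 5 - (2 / 3 : ℝ) • (s.vec 5 - s.vec 1) ∧ s'.sc 12 = s.sc 12 ∧
      s'.looCalls = s.looCalls ∧ s'.time = s.time + 4 * n := by
  have hw : (-2 / 3 : ℝ) • ((-1 : ℝ) • s.vec 1 + s.vec 5) + s.vec 5 =
      s.vec 5 - (2 / 3 : ℝ) • (s.vec 5 - s.vec 1) := by module
  refine ⟨_, exec_straight _ _ _ _, ⟨h.toConsts.congr ?_ ?_ ?_ ?_ ?_ ?_ ?_ ?_ ?_ ?_ ?_, ?_, ?_, ?_⟩,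
    ?_, ?_, ?_, ?_, ?_⟩
  all_goals simp only [List.foldl_cons, List.foldl_nil, Instr.step, Instr.effect, State.tick,
    Instr.cost, Function.update_apply, Fin.reduceEq, reduceIte, h.negOne, h.pull, h.mat, h.cnt, h.log, hw]
  ring

/-- The invariant only reads the scalars up to register 10, so any later one may be overwritten
freely. -/
theorem arith_exec (e : Env n ρ) {s : State 17 n ρ} (h : ProjInv P S c lg s) (op : Arith)
    {d : Fin 17} (a b : Fin 17) (hd : 10 < d) :
    ∃ s', Exec e (.instr (.arith op d a b)) s s' ∧ ProjInv P S c lg s' ∧ s'.vec = s.vec ∧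
      s'.sc = Function.update s.sc d (op.eval (s.sc a) (s.sc b)) ∧
      s'.looCalls = s.looCalls ∧ s'.time = s.time + 1 := by
  have hne : ∀ i : Fin 17, i ≤ 10 → i ≠ d := fun i hi => (lt_of_le_of_lt hi hd).ne
  refine ⟨_, .instr _ _, ⟨h.toConsts.congr ?_ ?_ ?_ ?_ ?_ ?_ ?_ ?_ ?_ ?_ ?_, ?_, ?_, ?_⟩,
    rfl, rfl, rfl, rfl⟩
  all_goals simp only [Instr.effect, State.tick, h.mat, h.log]
  all_goals rw [Function.update_of_ne (hne _ (by decide))]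
  exact h.cnt

/-- The sketch computed from the eigendecomposition of `M Mᵀ`. -/
noncomputable def eigSketch
    (eig : Matrix (Fin (ρ + 1)) (Fin (ρ + 1)) ℝ →
      (Fin (ρ + 1) → ℝ) × Matrix (Fin (ρ + 1)) (Fin (ρ + 1)) ℝ)
    (M : Matrix (Fin (ρ + 1)) (Fin n) ℝ) : Matrix (Fin (ρ + 1)) (Fin n) ℝ :=
  Matrix.diagonal (fun i => Real.sqrt
    (((eig (M * Mᵀ)).1 i - (eig (M * Mᵀ)).1 (Fin.last ρ)) / (eig (M * Mᵀ)).1 i)) *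
    ((eig (M * Mᵀ)).2ᵀ * M)

theorem sketch_exec (e : Env n ρ) {s : State 17 n ρ} (h : ProjInv P S c lg s)
    {M : Matrix (Fin (ρ + 1)) (Fin n) ℝ} (hM : S.updateRow (Fin.last ρ) (s.vec 3).ofLp = M) :
    ∃ s', Exec e sketchProg s s' ∧ ProjInv P (eigSketch e.eig M) c lg s' ∧ s'.vec = s.vec ∧
      s'.short 1 = (fun i => (e.eig (M * Mᵀ)).1 i - (e.eig (M * Mᵀ)).1 (Fin.last ρ)) ∧
      s'.looCalls = s.looCalls ∧
      s'.time = s.time + (4 * ((ρ + 1) ^ 2 * n) + (ρ + 1) ^ 3 + (ρ + 1) * n + n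
        + 4 * (ρ + 1) + 1) := by
  refine ⟨_, exec_straight _ _ _ _, ⟨h.toConsts.congr ?_ ?_ ?_ ?_ ?_ ?_ ?_ ?_ ?_ ?_ ?_, ?_, ?_, ?_⟩,
    ?_, ?_, ?_, ?_⟩
  all_goals simp only [List.foldl_cons, List.foldl_nil, Instr.step, Instr.effect, State.tick,
    Instr.cost, Arith.eval, Function.update_apply, Fin.reduceEq, reduceIte, h.mat, h.cnt, h.log, hM, eigSketch]
  ring

theorem newton_exec (e : Env n ρ) {s : State 17 n ρ} (h : ProjInv P S c lg s) :
    ∃ s', Exec e newtonProg s s' ∧ ProjInv P S c lg s' ∧ s'.vec 1 = s.vec 1 ∧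
      s'.vec 5 = (P.η * (-1) / P.εI) • ((-1 : ℝ) • WithLp.toLp 2 (Sᵀ *ᵥ
        (fun i => (S *ᵥ (s.vec 3).ofLp) i / (P.εI + s.short 1 i))) + s.vec 3) + s.vec 2 ∧
      s'.looCalls = s.looCalls ∧
      s'.time = s.time + (4 * ((ρ + 1) * n) + 3 * (ρ + 1) + 4 * n) := by
  refine ⟨_, exec_straight _ _ _ _, ⟨h.toConsts.congr ?_ ?_ ?_ ?_ ?_ ?_ ?_ ?_ ?_ ?_ ?_, ?_, ?_, ?_⟩,
    ?_, ?_, ?_, ?_⟩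
  all_goals simp only [List.foldl_cons, List.foldl_nil, Instr.step, Instr.effect, State.tick,
    Instr.cost, Arith.eval, Function.update_apply, Fin.reduceEq, reduceIte, h.negOne, h.step, h.epsI, h.mat, h.cnt, h.log]
  ring

theorem next_exec (e : Env n ρ) {s : State 17 n ρ} (h : ProjInv P S c lg s) :
    ∃ s', Exec e nextProg s s' ∧ ProjInv P S (c + 1) lg s' ∧ s'.vec 1 = s.vec 1 ∧
      s'.vec 2 = s.vec 5 ∧ s'.looCalls = s.looCalls ∧ s'.time = s.time + (2 * n + 1) := by
  refine ⟨_, exec_straight _ _ _ _, ⟨h.toConsts.congr ?_ ?_ ?_ ?_ ?_ ?_ ?_ ?_ ?_ ?_ ?_, ?_, ?_, ?_⟩,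
    ?_, ?_, ?_, ?_⟩
  all_goals simp only [List.foldl_cons, List.foldl_nil, Instr.step, Instr.effect, State.tick,
    Instr.cost, Arith.eval, Function.update_apply, Fin.reduceEq, reduceIte, h.vzero, h.zero, h.one, h.mat, h.cnt, h.log, zero_smul, zero_add, add_assoc]

theorem roundInit_exec (e : Env n ρ) {s : State 17 n ρ} (h : ProjInv P S c lg s) :
    ∃ s', Exec e (straight (.arith .add 11 0 0) [.axpy 3 0 0 0]) s s' ∧ ProjInv P S c lg s' ∧
      s'.vec 1 = s.vec 1 ∧ s'.vec 2 = s.vec 2 ∧ s'.vec 3 = 0 ∧ s'.sc 11 = 0 ∧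
      s'.looCalls = s.looCalls ∧ s'.time = s.time + (2 * n + 1) := by
  refine ⟨_, exec_straight _ _ _ _, ⟨h.toConsts.congr ?_ ?_ ?_ ?_ ?_ ?_ ?_ ?_ ?_ ?_ ?_, ?_, ?_, ?_⟩,
    ?_, ?_, ?_, ?_, ?_, ?_⟩
  all_goals simp only [List.foldl_cons, List.foldl_nil, Instr.step, Instr.effect, State.tick,
    Instr.cost, Arith.eval, Function.update_apply, Fin.reduceEq, reduceIte, h.vzero, h.zero, h.mat, h.cnt, h.log, smul_zero, add_zero]
  ring

theorem round_exec (e : Env n ρ) {s : State 17 n ρ} (h : ProjInv P S c lg s) :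
    ∃ s', Exec e roundProg s s' ∧ ProjInv P S c (lg ++ [(s.vec 1, s.vec 2)]) s' ∧
      s'.vec 1 = s.vec 1 ∧ s'.vec 2 = s.vec 2 ∧
      s'.vec 3 = e.grad lg.length (s.vec 2) + s.vec 3 ∧ s'.sc 11 = s.sc 11 + 1 ∧
      s'.looCalls = s.looCalls ∧ s'.time = s.time + (3 * n + 1) := by
  refine ⟨_, exec_straight _ _ _ _, ⟨h.toConsts.congr ?_ ?_ ?_ ?_ ?_ ?_ ?_ ?_ ?_ ?_ ?_, ?_, ?_, ?_⟩,
    ?_, ?_, ?_, ?_, ?_, ?_⟩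
  all_goals simp only [List.foldl_cons, List.foldl_nil, Instr.step, Instr.effect, State.tick,
    Instr.cost, Arith.eval, Function.update_apply, Fin.reduceEq, reduceIte, h.one, h.mat, h.cnt, h.log, one_smul]
  ring

theorem init_exec (e : Env n ρ) (he : e.params = P) :
    ∃ s', Exec e initProg (State.init 17 n ρ) s' ∧ ProjInv P 0 0 [] s' ∧
      s'.vec 1 = e.x₁ ∧ s'.vec 2 = e.x₁ ∧ s'.looCalls = 0 ∧ s'.time = 2 * n + 12 := by
  refine ⟨_, exec_straight _ _ _ _, ⟨⟨?_, ?_, ?_, ?_, ?_, ?_, ?_, ?_, ?_, ?_, ?_⟩, ?_, ?_, ?_⟩,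
    ?_, ?_, ?_, ?_⟩
  all_goals simp only [List.foldl_cons, List.foldl_nil, Instr.step, Instr.effect, State.tick,
    Instr.cost, Arith.eval, Function.update_apply, Fin.reduceEq, reduceIte, State.init, Input.eval, he]
  all_goals first | (norm_num; done) | ring

end Segments

/-! ### The sketch from the eigendecomposition -/

section EigSketch

variable {n ρ : ℕ} {eig : Matrix (Fin (ρ + 1)) (Fin (ρ + 1)) ℝ →
      (Fin (ρ + 1) → ℝ) × Matrix (Fin (ρ + 1)) (Fin (ρ + 1)) ℝ}

theorem isSymm_gram (M : Matrix (Fin (ρ + 1)) (Fin n) ℝ) : (M * Mᵀ).IsSymm := by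
  rw [Matrix.IsSymm, Matrix.transpose_mul, Matrix.transpose_transpose]

/-- The rows of `W = UᵀM` are orthogonal with squared norms `d`, and `WᵀW = MᵀM`. -/
theorem eigen_rows {M : Matrix (Fin (ρ + 1)) (Fin n) ℝ}
    {U : Matrix (Fin (ρ + 1)) (Fin (ρ + 1)) ℝ} {d : Fin (ρ + 1) → ℝ} (hU : U * Uᵀ = 1)
    (hM : M * Mᵀ = U * Matrix.diagonal d * Uᵀ) :
    (Uᵀ * M) * (Uᵀ * M)ᵀ = Matrix.diagonal d ∧ (Uᵀ * M)ᵀ * (Uᵀ * M) = Mᵀ * M := by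
  have hU' : Uᵀ * U = 1 := mul_eq_one_comm.1 hU
  constructor
  · calc (Uᵀ * M) * (Uᵀ * M)ᵀ = Uᵀ * (M * Mᵀ) * U := by
          simp only [Matrix.transpose_mul, Matrix.transpose_transpose, Matrix.mul_assoc]
      _ = (Uᵀ * U) * Matrix.diagonal d * (Uᵀ * U) := by rw [hM]; simp only [Matrix.mul_assoc]
      _ = _ := by rw [hU', Matrix.one_mul, Matrix.mul_one]
  · calc (Uᵀ * M)ᵀ * (Uᵀ * M) = Mᵀ * (U * Uᵀ) * M := by
          simp only [Matrix.transpose_mul, Matrix.transpose_transpose, Matrix.mul_assoc]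
      _ = _ := by rw [hU, Matrix.mul_one]

theorem row_inner {W : Matrix (Fin (ρ + 1)) (Fin n) ℝ} {d : Fin (ρ + 1) → ℝ}
    (hW : W * Wᵀ = Matrix.diagonal d) (i j : Fin (ρ + 1)) :
    inner ℝ (WithLp.toLp 2 (W i) : Vec n) (WithLp.toLp 2 (W j)) = if i = j then d i else 0 := by
  rw [inner_eq_dotProduct, ← Matrix.diagonal_apply, ← hW]; rfl

theorem diag_nonneg_of_rows {W : Matrix (Fin (ρ + 1)) (Fin n) ℝ} {d : Fin (ρ + 1) → ℝ}
    (hW : W * Wᵀ = Matrix.diagonal d) (i : Fin (ρ + 1)) : 0 ≤ d i := by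
  have := row_inner hW i i
  rw [if_pos rfl] at this
  rw [← this]; exact real_inner_self_nonneg

theorem row_eq_zero {W : Matrix (Fin (ρ + 1)) (Fin n) ℝ} {d : Fin (ρ + 1) → ℝ}
    (hW : W * Wᵀ = Matrix.diagonal d) {i : Fin (ρ + 1)} (hi : d i = 0) : W i = 0 := by
  have := row_inner hW i i
  rw [if_pos rfl, hi, inner_self_eq_zero] at this
  simpa using congrArg WithLp.ofLp this

/-- An orthogonal family of `ρ + 1` rows extends to a thin eigendecomposition. -/
theorem exists_thinEigen {M W : Matrix (Fin (ρ + 1)) (Fin n) ℝ} {d : Fin (ρ + 1) → ℝ}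
    (hρ : ρ ≤ n) (hd : Antitone d) (hW : W * Wᵀ = Matrix.diagonal d) (hWM : Wᵀ * W = Mᵀ * M) :
    ∃ V : Matrix (Fin (ρ + 1)) (Fin n) ℝ, IsThinEigen M V d ∧
      ∀ i, W i = Real.sqrt (d i) • V i := by
  classical
  have hd0 := diag_nonneg_of_rows hW
  -- Relevant only if `ρ = n`: by monotonicity a nonzero last entry would make all `ρ + 1`
  -- orthogonal rows nonzero, which is too many for `ℝⁿ`.
  have hlast : ∀ i : Fin (ρ + 1), n ≤ (i : ℕ) → d i = 0 := by
    intro i hi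
    have hiρ : (i : ℕ) = ρ := le_antisymm (Nat.lt_succ_iff.1 i.2) (hρ.trans hi)
    have hρn : ρ = n := le_antisymm hρ (hiρ ▸ hi)
    by_contra hne
    have hpos : ∀ j, 0 < d j := fun j =>
      lt_of_lt_of_le (lt_of_le_of_ne (hd0 i) (Ne.symm hne))
        (hd (by rw [Fin.le_def, hiρ]; exact Nat.lt_succ_iff.1 j.2))
    have hrank : (W * Wᵀ).rank = ρ + 1 := by
      have : IsUnit (W * Wᵀ) := by
        rw [hW, Matrix.isUnit_iff_isUnit_det, Matrix.det_diagonal]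
        exact (Finset.prod_pos fun j _ => hpos j).ne'.isUnit
      rw [Matrix.rank_of_isUnit _ this, Fintype.card_fin]
    have h1 := Matrix.rank_mul_le_left W Wᵀ
    have h2 := Matrix.rank_le_width W
    omega
  -- The rows of nonzero length are normalized and completed to an orthonormal basis; the added
  -- basis vectors stand in for the zero rows, where the factor `√d` hides the choice.
  set v : Fin n → Vec n := fun j => if h : (j : ℕ) < ρ + 1 then
    (Real.sqrt (d ⟨j, h⟩))⁻¹ • WithLp.toLp 2 (W ⟨j, h⟩) else 0 with hv
  set t : Set (Fin n) := {j | ∃ h : (j : ℕ) < ρ + 1, 0 < d ⟨j, h⟩} with ht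
  have hon : Orthonormal ℝ (t.domRestrict v) := by
    rw [orthonormal_iff_ite]
    rintro ⟨j, hj, hjd⟩ ⟨k, hk, hkd⟩
    simp only [Set.domRestrict_apply, hv, dif_pos hj, dif_pos hk]
    rw [real_inner_smul_left, real_inner_smul_right, row_inner hW]
    by_cases hjk : j = k
    · subst hjk
      simp only [if_true]
      have := Real.mul_self_sqrt hjd.le
      have h0 : Real.sqrt (d ⟨j, hj⟩) ≠ 0 := (Real.sqrt_pos.2 hjd).ne'
      field_simp
      rw [sq, this]
    · have h1 : (⟨j, hj⟩ : Fin (ρ + 1)) ≠ ⟨k, hk⟩ := fun h => hjk (Fin.ext (Fin.mk.inj h))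
      have h2 : (⟨j, ⟨hj, hjd⟩⟩ : t) ≠ ⟨k, ⟨hk, hkd⟩⟩ := fun h => hjk (Subtype.mk.inj h)
      rw [if_neg h1, if_neg h2]; simp
  obtain ⟨b, hb⟩ := hon.exists_orthonormalBasis_extension_of_card_eq (by simp)
  set V : Matrix (Fin (ρ + 1)) (Fin n) ℝ :=
    fun i => if h : (i : ℕ) < n then (b ⟨i, h⟩).ofLp else 0 with hV
  have hWV : ∀ i, W i = Real.sqrt (d i) • V i := by
    intro i
    rcases (hd0 i).eq_or_lt with h0 | h0
    · rw [row_eq_zero hW h0.symm, ← h0]; simp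
    · have hin : (i : ℕ) < n := by
        by_contra h
        exact h0.ne' (hlast i (not_lt.1 h))
      have h1 : b ⟨i, hin⟩ = v ⟨i, hin⟩ := hb _ ⟨i.2, h0⟩
      have h2 : Real.sqrt (d i) ≠ 0 := (Real.sqrt_pos.2 h0).ne'
      simp only [hV, dif_pos hin, h1, hv, dif_pos i.2]
      simp [smul_smul, mul_inv_cancel₀ h2]
  refine ⟨V, ⟨hd, ?_, ?_, hlast⟩, hWV⟩
  · rw [← hWM]
    ext j k
    rw [Matrix.mul_apply, Matrix.mul_apply]
    refine Finset.sum_congr rfl fun i _ => ?_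
    rw [Matrix.mul_diagonal, Matrix.transpose_apply, Matrix.transpose_apply, hWV i]
    simp only [Pi.smul_apply, smul_eq_mul]
    have := Real.mul_self_sqrt (hd0 i)
    linear_combination (-(V i j * V i k)) * this
  · ext i j
    rw [Matrix.diagonal_apply]
    have : (V * Vᵀ) i j = inner ℝ (WithLp.toLp 2 (V i) : Vec n) (WithLp.toLp 2 (V j)) := by
      rw [inner_eq_dotProduct]; rfl
    rw [this]
    by_cases hi : (i : ℕ) < n
    · by_cases hj : (j : ℕ) < n
      · simp only [hV, dif_pos hi, dif_pos hj, WithLp.toLp_ofLp]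
        rw [b.inner_eq_ite]
        simp [Fin.ext_iff, hi]
      · simp only [hV, dif_neg hj]
        have : i ≠ j := fun h => hj (h ▸ hi)
        simp [this]
    · simp only [hV, dif_neg hi]
      simp [hi]

/-- The machine rescales the unnormalized rows of `UᵀM`, of length `√d`, by the first factor; for `d
= 0` both sides vanish. -/
theorem shrink_sq {d σ : ℝ} (hσ : 0 ≤ σ) (hd : σ ≤ d) :
    Real.sqrt ((d - σ) / d) * Real.sqrt d = Real.sqrt (d - σ) := by
  have hd0 : 0 ≤ d := hσ.trans hd
  rcases hd0.eq_or_lt with h | h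
  · have : σ = 0 := le_antisymm (h ▸ hd) hσ
    rw [this, ← h]; simp
  · rw [← Real.sqrt_mul (div_nonneg (sub_nonneg.2 hd) hd0), div_mul_cancel₀ _ h.ne']

/-- Diagonalizing the small matrix `M Mᵀ` suffices: with `U` its eigenvectors, the rows of `UᵀM` are
orthogonal, and normalizing them gives a thin eigendecomposition of `MᵀM`. -/
theorem fdStep_eigSketch (hρ : ρ ≤ n) (heig : IsEigenSolver eig)
    (S : Matrix (Fin (ρ + 1)) (Fin n) ℝ) (g : Vec n) :
    FDStep S g (eigSketch eig (S.updateRow (Fin.last ρ) g.ofLp)) := by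
  set M := S.updateRow (Fin.last ρ) g.ofLp with hM
  obtain ⟨h1, h2, h3⟩ := heig (M * Mᵀ) (isSymm_gram M)
  obtain ⟨hW, hWM⟩ := eigen_rows h2 h3
  obtain ⟨V, hV, hWV⟩ := exists_thinEigen hρ h1 hW hWM
  refine ⟨V, (eig (M * Mᵀ)).1, hV, ?_⟩
  ext i j
  rw [eigSketch, Matrix.diagonal_mul, Matrix.diagonal_mul, hWV i]
  simp only [Pi.smul_apply, smul_eq_mul]
  rw [← mul_assoc, shrink_sq (hV.nonneg _) (h1 (Fin.le_last i))]

/-- The sketch has orthogonal rows with squared norms `d - σ`, so the inner inverse in `woodbury` is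
an entrywise division by numbers the machine has already computed. -/
theorem eigSketch_mul_transpose (heig : IsEigenSolver eig) (M : Matrix (Fin (ρ + 1)) (Fin n) ℝ) :
    (∀ i, 0 ≤ (eig (M * Mᵀ)).1 i - (eig (M * Mᵀ)).1 (Fin.last ρ)) ∧
    eigSketch eig M * (eigSketch eig M)ᵀ =
      Matrix.diagonal fun i => (eig (M * Mᵀ)).1 i - (eig (M * Mᵀ)).1 (Fin.last ρ) := by
  obtain ⟨h1, h2, h3⟩ := heig (M * Mᵀ) (isSymm_gram M)
  obtain ⟨hW, -⟩ := eigen_rows h2 h3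
  have hd0 := diag_nonneg_of_rows hW
  refine ⟨fun i => sub_nonneg.2 (h1 (Fin.le_last i)), ?_⟩
  set W := (eig (M * Mᵀ)).2ᵀ * M
  set d := (eig (M * Mᵀ)).1
  set D := Matrix.diagonal fun i => Real.sqrt ((d i - d (Fin.last ρ)) / d i) with hD
  change (D * W) * (D * W)ᵀ = _
  have : (D * W) * (D * W)ᵀ = D * (W * Wᵀ) * D := by
    rw [Matrix.transpose_mul, hD, Matrix.diagonal_transpose]; simp only [Matrix.mul_assoc]
  rw [this, hW, hD, Matrix.diagonal_mul_diagonal, Matrix.diagonal_mul_diagonal]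
  congr 1
  ext i
  have h4 := shrink_sq (hd0 (Fin.last ρ)) (h1 (Fin.le_last i))
  have h5 := Real.mul_self_sqrt (hd0 i)
  have h6 := Real.mul_self_sqrt (sub_nonneg.2 (h1 (Fin.le_last i)))
  rw [← h4] at h6
  linear_combination h6 - Real.sqrt ((d i - d (Fin.last ρ)) / d i) ^ 2 * h5

/-- The Woodbury identity for a sketch with orthogonal rows. -/
theorem woodbury {S : Matrix (Fin (ρ + 1)) (Fin n) ℝ} {ev : Fin (ρ + 1) → ℝ}
    (hev : ∀ i, 0 ≤ ev i) (hS : S * Sᵀ = Matrix.diagonal ev) {εI : ℝ} (hε : 0 < εI) (g : Vec n) :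
    mv (sketchA εI S)⁻¹ g = εI⁻¹ • (g - WithLp.toLp 2 (Sᵀ *ᵥ
      (fun i => (S *ᵥ g.ofLp) i / (εI + ev i)))) := by
  set u : Fin (ρ + 1) → ℝ := fun i => (S *ᵥ g.ofLp) i / (εI + ev i) with hu
  have hdet := (Matrix.isUnit_iff_isUnit_det _).1 (sketchA_posDef S hε).isUnit
  -- The candidate is multiplied by `A`; everything reduces to `S` applied to it being `u`, which is
  -- where `S Sᵀ` being diagonal enters.
  have key : mv (sketchA εI S) (εI⁻¹ • (g - WithLp.toLp 2 (Sᵀ *ᵥ u))) = g := by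
    rw [mv_sketchA, smul_smul, mul_inv_cancel₀ hε.ne', one_smul]
    have h1 : S *ᵥ (εI⁻¹ • (g - WithLp.toLp 2 (Sᵀ *ᵥ u))).ofLp = u := by
      have h2 : (εI⁻¹ • (g - WithLp.toLp 2 (Sᵀ *ᵥ u))).ofLp = εI⁻¹ • (g.ofLp - Sᵀ *ᵥ u) := rfl
      rw [h2, Matrix.mulVec_smul, Matrix.mulVec_sub, Matrix.mulVec_mulVec, hS]
      ext i
      have : εI + ev i ≠ 0 := by linarith [hev i]
      simp only [Pi.smul_apply, Pi.sub_apply, Matrix.mulVec_diagonal, smul_eq_mul, hu]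
      field_simp
      ring
    rw [h1]; abel
  conv_lhs => rw [← key]
  simp only [mv, Matrix.mulVec_mulVec, Matrix.nonsing_inv_mul _ hdet, Matrix.one_mulVec,
    WithLp.toLp_ofLp]

end EigSketch

/-! ### Execution of the projection -/

section Projection

variable {n ρ : ℕ} {P : Params} {S : Matrix (Fin (ρ + 1)) (Fin n) ℝ} {c : ℝ}
  {lg : List (Vec n × Vec n)} {𝒦 : Set (Vec n)}

/-- The minimizer over `[0, 1]` of a quadratic with slope `-2a < 0` at zero is `min(a / b, 1)`;
comparing `a` with `b` also avoids dividing by zero. -/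
theorem lineSearch_opt {N a b : ℝ} (ha : 0 < a) {σ : ℝ}
    (hσ : (a ≤ b ∧ σ = a / b) ∨ (b < a ∧ σ = 1)) :
    σ ∈ Set.Icc (0 : ℝ) 1 ∧ ∀ τ ∈ Set.Icc (0 : ℝ) 1,
      N - 2 * σ * a + σ ^ 2 * b ≤ N - 2 * τ * a + τ ^ 2 * b := by
  rcases hσ with ⟨hab, rfl⟩ | ⟨hab, rfl⟩
  · have hb : 0 < b := ha.trans_le hab
    refine ⟨⟨by positivity, (div_le_one hb).2 hab⟩, fun τ _ => ?_⟩
    have e : N - 2 * τ * a + τ ^ 2 * b - (N - 2 * (a / b) * a + (a / b) ^ 2 * b) =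
        b * (τ - a / b) ^ 2 := by field_simp; ring
    have : 0 ≤ b * (τ - a / b) ^ 2 := by positivity
    linarith
  · refine ⟨by simp, fun τ hτ => ?_⟩
    have h0 := hτ.1
    have h1 := hτ.2
    nlinarith [mul_nonneg (sub_nonneg.2 h1) (sub_nonneg.2 hab.le),
      mul_nonneg (mul_nonneg (sub_nonneg.2 h1) h0) (sub_nonneg.2 hab.le),
      mul_nonneg (sub_nonneg.2 h1) (sub_nonneg.2 h1)]

theorem step_exec (e : Env n ρ) {s : State 17 n ρ} (h : ProjInv P S c lg s) {x y v : Vec n}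
    (hx : s.vec 1 = x) (hy : s.vec 5 = y) (hv : s.vec 9 = x - v)
    (hgap : s.sc 13 = bil (sketchA P.εI S) (x - y) (x - v))
    (hpos : 0 < bil (sketchA P.εI S) (x - y) (x - v)) :
    ∃ (s' : State 17 n ρ) (σ : ℝ), Exec e stepProg s s' ∧ ProjInv P S c lg s' ∧
      s'.vec 1 = x + σ • (v - x) ∧ s'.vec 5 = y ∧ s'.sc 14 = s.sc 14 ∧
      s'.looCalls = s.looCalls ∧ s'.time = s.time + (4 * ((ρ + 1) * n) + 6 * n + 3) ∧
      σ ∈ Set.Icc (0 : ℝ) 1 ∧ ∀ τ ∈ Set.Icc (0 : ℝ) 1,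
        normSqA (sketchA P.εI S) (y - x - σ • (v - x)) ≤
          normSqA (sketchA P.εI S) (y - x - τ • (v - x)) := by
  set A := sketchA P.εI S with hA
  obtain ⟨s₁, he₁, h₁, hx₁, hy₁, hv₁, hg₁, hf₁, hd₁, hl₁, ht₁⟩ := curv_exec e h
  have hsym : A.IsSymm := sketchA_isSymm S
  have hexp : ∀ τ : ℝ, normSqA A (y - x - τ • (v - x)) = normSqA A (x - y)
      - 2 * τ * bil A (x - y) (x - v) + τ ^ 2 * normSqA A (x - v) := by
    intro τ
    have e2 : bil A (y - x) (v - x) = bil A (x - y) (x - v) := by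
      simp only [bil_sub_left, bil_sub_right]; ring
    rw [normSqA_sub_smul hsym, e2, normSqA_sub_comm y x, normSqA_sub_comm v x]
  -- Both branches of the step-length test continue identically, so the continuation is proved once
  -- for any admissible `σ`.
  have fin : ∀ (s₂ : State 17 n ρ) (σ : ℝ), ProjInv P S c lg s₂ → s₂.vec = s₁.vec →
      s₂.sc 16 = σ → s₂.sc 14 = s₁.sc 14 → s₂.looCalls = s₁.looCalls → s₂.time = s₁.time + 2 →
      Exec e (.ite 13 15 (.instr (.arith .div 16 13 15)) (.instr (.arith .add 16 1 0))) s₁ s₂ →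
      ((bil A (x - y) (x - v) ≤ normSqA A (x - v) ∧
          σ = bil A (x - y) (x - v) / normSqA A (x - v)) ∨
        (normSqA A (x - v) < bil A (x - y) (x - v) ∧ σ = 1)) →
      ∃ (s' : State 17 n ρ) (σ : ℝ), Exec e stepProg s s' ∧ ProjInv P S c lg s' ∧
      s'.vec 1 = x + σ • (v - x) ∧ s'.vec 5 = y ∧ s'.sc 14 = s.sc 14 ∧
      s'.looCalls = s.looCalls ∧ s'.time = s.time + (4 * ((ρ + 1) * n) + 6 * n + 3) ∧
      σ ∈ Set.Icc (0 : ℝ) 1 ∧ ∀ τ ∈ Set.Icc (0 : ℝ) 1,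
        normSqA A (y - x - σ • (v - x)) ≤ normSqA A (y - x - τ • (v - x)) := by
    intro s₂ σ h₂ hvec hσ hf hl ht hex hopt
    obtain ⟨s₃, he₃, h₃, hx₃, hy₃, hf₃, hl₃, ht₃⟩ := move_exec e h₂
    obtain ⟨hI, hmin⟩ := lineSearch_opt (N := normSqA A (x - y)) hpos hopt
    refine ⟨s₃, σ, .seq _ _ _ _ _ he₁ (.seq _ _ _ _ _ hex he₃), h₃, ?_, ?_, ?_, ?_, ?_, hI,
      fun τ hτ => ?_⟩
    · rw [hx₃, hσ, hvec, hv₁, hx₁, hv, hx]; module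
    · rw [hy₃, hvec, hy₁, hy]
    · rw [hf₃, hf, hf₁]
    · rw [hl₃, hl, hl₁]
    · rw [ht₃, ht, ht₁]; ring
    · rw [hexp, hexp]; exact hmin τ hτ
  have h13 : s₁.sc 13 = bil A (x - y) (x - v) := by rw [hg₁, hgap]
  have h15 : s₁.sc 15 = normSqA A (x - v) := by rw [hd₁, hv]
  have htick : ProjInv P S c lg (s₁.tick 1) :=
    ⟨⟨h₁.zero, h₁.one, h₁.step, h₁.eps, h₁.epsI, h₁.blockLen, h₁.blocks, h₁.eps3, h₁.pull,
      h₁.negOne, h₁.vzero⟩, h₁.mat, h₁.cnt, h₁.log⟩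
  by_cases hc : s₁.sc 13 ≤ s₁.sc 15
  · obtain ⟨s₂, he₂, h₂, hv₂, hs₂, hl₂, ht₂⟩ := arith_exec e htick .div (d := 16) 13 15 (by decide)
    refine fin s₂ _ h₂ hv₂ rfl ?_ hl₂ ?_ (.ite_true _ _ _ _ _ _ hc he₂) (Or.inl ⟨?_, ?_⟩)
    · rw [hs₂]; simp only [Function.update_apply, Fin.reduceEq, reduceIte]; rfl
    · rw [ht₂]; rfl
    · rwa [← h13, ← h15]
    · rw [hs₂, Function.update_self, ← h13, ← h15]; rfl
  · obtain ⟨s₂, he₂, h₂, hv₂, hs₂, hl₂, ht₂⟩ := arith_exec e htick .add (d := 16) 1 0 (by decide)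
    refine fin s₂ _ h₂ hv₂ rfl ?_ hl₂ ?_ (.ite_false _ _ _ _ _ _ hc he₂) (Or.inr ⟨?_, ?_⟩)
    · rw [hs₂]; simp only [Function.update_apply, Fin.reduceEq, reduceIte]; rfl
    · rw [ht₂]; rfl
    · rw [← h13, ← h15]; exact not_le.1 hc
    · rw [hs₂, Function.update_self, htick.one, htick.zero]; simp [Arith.eval]

end Projection

/-! ### Termination and cost of the projection loops -/

section ProjectionLoops

variable {n ρ : ℕ} {P : Params} {S : Matrix (Fin (ρ + 1)) (Fin n) ℝ} {c : ℝ}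
  {lg : List (Vec n × Vec n)} {𝒦 : Set (Vec n)}

theorem ProjInv.tick {s : State 17 n ρ} (h : ProjInv P S c lg s) (k : ℕ) :
    ProjInv P S c lg (s.tick k) :=
  ⟨⟨h.zero, h.one, h.step, h.eps, h.epsI, h.blockLen, h.blocks, h.eps3, h.pull,
    h.negOne, h.vzero⟩, h.mat, h.cnt, h.log⟩

/-- The time for one iteration of Frank-Wolfe. -/
def fwCost (n ρ : ℕ) : ℕ := 8 * ((ρ + 1) * n) + 17 * n + 6

/-- Raising the flag ends the Frank-Wolfe loop. -/
theorem halt_exec (e : Env n ρ) {s : State 17 n ρ} (h : ProjInv P S c lg s) :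
    ∃ s', Exec e haltProg s s' ∧ ProjInv P S c lg s' ∧ s'.vec = s.vec ∧ s'.sc 14 = 1 ∧
      s'.sc 12 = s.sc 12 ∧ s'.looCalls = s.looCalls ∧ s'.time = s.time + 1 := by
  obtain ⟨s', he, h', hv, hs, hl, ht⟩ := arith_exec e h .add (d := 14) 1 0 (by decide)
  refine ⟨s', he, h', hv, ?_, ?_, hl, ht⟩
  · rw [hs, Function.update_self, h.one, h.zero]; simp [Arith.eval]
  · rw [hs]; simp only [Function.update_apply, Fin.reduceEq, reduceIte]

/-- One iteration of Frank-Wolfe. -/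
theorem fwBody_exec (e : Env n ρ) (hloo : ∀ v, IsLOOAnswer 𝒦 v (e.loo v)) (hε : 0 < P.ε)
    {s : State 17 n ρ} (h : ProjInv P S c lg s) {x y : Vec n} (hx : s.vec 1 = x)
    (hy : s.vec 5 = y) :
    ∃ (s' : State 17 n ρ) (v : Vec n), Exec e fwBody s s' ∧ ProjInv P S c lg s' ∧
      s'.vec 5 = y ∧ s'.looCalls = s.looCalls + 1 ∧ s'.time + 1 ≤ s.time + fwCost n ρ ∧
      IsLOOAnswer 𝒦 (mv (sketchA P.εI S) (x - y)) v ∧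
      ((FWStop (sketchA P.εI S) P.ε y x v ∧ s'.vec 1 = x ∧ s'.sc 14 = 1 ∧
          s'.sc 12 = normSqA (sketchA P.εI S) (x - y)) ∨
        (¬ FWStop (sketchA P.εI S) P.ε y x v ∧ s'.sc 14 = s.sc 14 ∧ ∃ σ ∈ Set.Icc (0 : ℝ) 1,
          s'.vec 1 = x + σ • (v - x) ∧ ∀ τ ∈ Set.Icc (0 : ℝ) 1,
            normSqA (sketchA P.εI S) (y - x - σ • (v - x)) ≤
              normSqA (sketchA P.εI S) (y - x - τ • (v - x)))) := by
  obtain ⟨s₁, he₁, h₁, hx₁, hy₁, ha₁, hn₁, hf₁, hl₁, ht₁⟩ := residual_exec e h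
  obtain ⟨s₂, he₂, h₂, hx₂, hy₂, hv₂, hg₂, hn₂, hf₂, hl₂, ht₂⟩ := gap_exec e h₁
  set A := sketchA P.εI S with hA
  rw [hx, hy] at ha₁ hn₁
  rw [hx] at hx₁
  rw [hy] at hy₁
  rw [hx₁] at hx₂ hv₂ hg₂
  rw [hy₁] at hy₂
  rw [hn₁] at hn₂
  rw [ha₁] at hv₂ hg₂
  set v := e.loo (mv A (x - y)) with hv
  have hgap : s₂.sc 13 = bil A (x - y) (x - v) := by
    rw [hg₂, real_inner_comm, ← bil_eq_inner, bil_comm (sketchA_isSymm S)]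
  by_cases c1 : s₂.sc 13 ≤ s₂.sc 3
  · obtain ⟨s₃, he₃, h₃, hv₃, hf₃, hn₃, hl₃, ht₃⟩ := halt_exec e (h₂.tick 1)
    refine ⟨s₃, v, .seq _ _ _ _ _ he₁ (.seq _ _ _ _ _ he₂ (.ite_true _ _ _ _ _ _ c1 he₃)), h₃,
      ?_, ?_, ?_, hloo _, Or.inl ⟨Or.inl ?_, ?_, hf₃, ?_⟩⟩
    · rw [hv₃]; exact hy₂
    · rw [hl₃]; change s₂.looCalls = _; rw [hl₂, hl₁]
    · rw [ht₃]; change s₂.time + 1 + 1 + 1 ≤ _; rw [ht₂, ht₁, fwCost]; omega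
    · rwa [hgap, h₂.eps] at c1
    · rw [hv₃]; exact hx₂
    · rw [hn₃]; exact hn₂
  · by_cases c2 : (s₂.tick 1).sc 12 ≤ (s₂.tick 1).sc 7
    · obtain ⟨s₃, he₃, h₃, hv₃, hf₃, hn₃, hl₃, ht₃⟩ := halt_exec e ((h₂.tick 1).tick 1)
      refine ⟨s₃, v, .seq _ _ _ _ _ he₁ (.seq _ _ _ _ _ he₂ (.ite_false _ _ _ _ _ _ c1
        (.ite_true _ _ _ _ _ _ c2 he₃))), h₃, ?_, ?_, ?_, hloo _, Or.inl ⟨Or.inr ?_, ?_, hf₃, ?_⟩⟩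
      · rw [hv₃]; exact hy₂
      · rw [hl₃]; change s₂.looCalls = _; rw [hl₂, hl₁]
      · rw [ht₃]; change s₂.time + 1 + 1 + 1 + 1 ≤ _; rw [ht₂, ht₁, fwCost]; omega
      · rw [(h₂.tick 1).eps3] at c2
        change s₂.sc 12 ≤ _ at c2
        rwa [hn₂] at c2
      · rw [hv₃]; exact hx₂
      · rw [hn₃]; exact hn₂
    · have hns : ¬ FWStop A P.ε y x v := by
        rintro (hs | hs)
        · exact c1 (by rw [hgap, h₂.eps]; exact hs)
        · refine c2 ?_
          rw [(h₂.tick 1).eps3]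
          change s₂.sc 12 ≤ _
          rw [hn₂]; exact hs
      have hpos : 0 < bil A (x - y) (x - v) := by
        rw [hgap, h₂.eps] at c1
        linarith [not_le.1 c1]
      obtain ⟨s₃, σ, he₃, h₃, hx₃, hy₃, hf₃, hl₃, ht₃, hσ, hmin⟩ :=
        step_exec e ((h₂.tick 1).tick 1) (x := x) (y := y) (v := v) hx₂ hy₂ hv₂ hgap hpos
      refine ⟨s₃, v, .seq _ _ _ _ _ he₁ (.seq _ _ _ _ _ he₂ (.ite_false _ _ _ _ _ _ c1
        (.ite_false _ _ _ _ _ _ c2 he₃))), h₃, hy₃, ?_, ?_, hloo _, Or.inr ⟨hns, ?_, σ, hσ, hx₃, hmin⟩⟩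
      · rw [hl₃]; change s₂.looCalls = _; rw [hl₂, hl₁]
      · rw [ht₃]
        change s₂.time + 1 + 1 + _ + 1 ≤ _
        rw [ht₂, ht₁, fwCost]; omega
      · rw [hf₃]; change s₂.sc 14 = _; rw [hf₂, hf₁]

/-- Termination measure: each step lowers `‖x - y‖_A²` by at least `ε² / D`, and at level `0` the
distance test stops the loop. -/
theorem fwLoop_exec (e : Env n ρ) (hloo : ∀ v, IsLOOAnswer 𝒦 v (e.loo v)) (hε : 0 < P.ε)
    {D : ℝ} (hD : FWData 𝒦 (sketchA P.εI S) D) (hεD : P.ε ≤ D) (y : Vec n) (N : ℕ) :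
    ∀ s : State 17 n ρ, ProjInv P S c lg s → s.vec 1 ∈ 𝒦 → s.vec 5 = y → s.sc 14 = 0 →
      normSqA (sketchA P.εI S) (s.vec 1 - y) ≤ N * (P.ε ^ 2 / D) →
      ∃ (s' : State 17 n ρ) (k : ℕ), Exec e (.loop 14 1 fwBody) s s' ∧ ProjInv P S c lg s' ∧
        s'.vec 5 = y ∧ FWRun 𝒦 (sketchA P.εI S) P.ε y (s.vec 1) (s'.vec 1) k ∧
        s'.sc 12 = normSqA (sketchA P.εI S) (s'.vec 1 - y) ∧
        s'.looCalls = s.looCalls + k ∧ s'.time ≤ s.time + k * fwCost n ρ + 1 := by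
  set A := sketchA P.εI S with hA
  have hD0 : 0 < D := hε.trans_le hεD
  induction N with
  | zero =>
    intro s h hx hy hf hN
    obtain ⟨s₁, v, he, h₁, hy₁, hl₁, ht₁, hv, hcase⟩ := fwBody_exec (𝒦 := 𝒦) e hloo hε (h.tick 1)
      (x := s.vec 1) (y := y) rfl hy
    rcases hcase with ⟨hs, hx₁, hf₁, hn₁⟩ | ⟨hns, -⟩
    · have hlt : s.sc 14 < s.sc 1 := by rw [hf, h.one]; exact zero_lt_one
      have hge : ¬ s₁.sc 14 < s₁.sc 1 := by rw [hf₁, h₁.one]; exact lt_irrefl _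
      refine ⟨s₁.tick 1, 1, .loop_true _ _ _ _ _ _ hlt he (.loop_false _ _ _ _ hge), h₁.tick 1,
        hy₁, ?_, ?_, hl₁, ?_⟩
      · change FWRun 𝒦 A P.ε y (s.vec 1) (s₁.vec 1) 1
        rw [hx₁]; exact .finish _ v hv hs
      · change s₁.sc 12 = normSqA A (s₁.vec 1 - y)
        rw [hn₁, hx₁]
      · change s₁.time + 1 ≤ _
        have : s₁.time + 1 ≤ s.time + 1 + fwCost n ρ := ht₁
        omega
    · refine absurd (Or.inr ?_) hns
      simp only [Nat.cast_zero, zero_mul] at hN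
      linarith
  | succ N ih =>
    intro s h hx hy hf hN
    obtain ⟨s₁, v, he, h₁, hy₁, hl₁, ht₁, hv, hcase⟩ := fwBody_exec (𝒦 := 𝒦) e hloo hε (h.tick 1)
      (x := s.vec 1) (y := y) rfl hy
    have hlt : s.sc 14 < s.sc 1 := by rw [hf, h.one]; exact zero_lt_one
    rcases hcase with ⟨hs, hx₁, hf₁, hn₁⟩ | ⟨hns, hf₁, σ, hσ, hx₁, hmin⟩
    · have hge : ¬ s₁.sc 14 < s₁.sc 1 := by rw [hf₁, h₁.one]; exact lt_irrefl _
      refine ⟨s₁.tick 1, 1, .loop_true _ _ _ _ _ _ hlt he (.loop_false _ _ _ _ hge), h₁.tick 1,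
        hy₁, ?_, ?_, hl₁, ?_⟩
      · change FWRun 𝒦 A P.ε y (s.vec 1) (s₁.vec 1) 1
        rw [hx₁]; exact .finish _ v hv hs
      · change s₁.sc 12 = normSqA A (s₁.vec 1 - y)
        rw [hn₁, hx₁]
      · change s₁.time + 1 ≤ _
        have : s₁.time + 1 ≤ s.time + 1 + fwCost n ρ := ht₁
        omega
    · have hx₁m : s₁.vec 1 ∈ 𝒦 := by rw [hx₁]; exact convex_step_mem hD.convex hx hv.1 hσ
      have hprog : normSqA A (s₁.vec 1 - y) ≤ N * (P.ε ^ 2 / D) := by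
        have hns' := hns
        unfold FWStop at hns'
        push Not at hns'
        have := linear_progress (w := normSqA A (s.vec 1 - y) / 2)
          (w' := normSqA A (s₁.vec 1 - y) / 2) hε hεD hns'.1 (fun τ hτ => by
            have := lineSearch_le hD.symm (hD.diam _ hx v hv.1) hmin hτ
            rw [hx₁]
            linarith)
        have e1 : P.ε ^ 2 / (2 * D) = P.ε ^ 2 / D / 2 := by field_simp
        push_cast at hN
        linarith
      obtain ⟨s', k, he', h', hy', hrun, hn', hl', ht'⟩ := ih s₁ h₁ hx₁m hy₁ (hf₁.trans hf) hprog
      refine ⟨s', k + 1, .loop_true _ _ _ _ _ _ hlt he he', h', hy', ?_, hn', ?_, ?_⟩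
      · rw [hx₁] at hrun
        exact .step _ v _ σ k hv hns hσ hmin hrun
      · rw [hl', hl₁]; change s.looCalls + 1 + k = _; omega
      · have h3 : s₁.time + 1 ≤ s.time + 1 + fwCost n ρ := ht₁
        have h4 : (k + 1) * fwCost n ρ = k * fwCost n ρ + fwCost n ρ := by ring
        omega

theorem fw_exec (e : Env n ρ) (hloo : ∀ v, IsLOOAnswer 𝒦 v (e.loo v)) (hε : 0 < P.ε)
    {D : ℝ} (hD : FWData 𝒦 (sketchA P.εI S) D) (hεD : P.ε ≤ D) {s : State 17 n ρ}
    (h : ProjInv P S c lg s) (hx : s.vec 1 ∈ 𝒦) :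
    ∃ (s' : State 17 n ρ) (k : ℕ), Exec e fwProg s s' ∧ ProjInv P S c lg s' ∧
      s'.vec 5 = s.vec 5 ∧ FWRun 𝒦 (sketchA P.εI S) P.ε (s.vec 5) (s.vec 1) (s'.vec 1) k ∧
      s'.sc 12 = normSqA (sketchA P.εI S) (s'.vec 1 - s.vec 5) ∧
      s'.looCalls = s.looCalls + k ∧ s'.time ≤ s.time + k * fwCost n ρ + 2 := by
  have hD0 : 0 < D := hε.trans_le hεD
  obtain ⟨s₁, he₁, h₁, hv₁, hs₁, hl₁, ht₁⟩ := arith_exec e h .add (d := 14) 0 0 (by decide)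
  obtain ⟨N, hN⟩ := exists_nat_ge (normSqA (sketchA P.εI S) (s.vec 1 - s.vec 5) / (P.ε ^ 2 / D))
  rw [div_le_iff₀ (by positivity)] at hN
  have hf : s₁.sc 14 = 0 := by
    rw [hs₁, Function.update_self, h.zero]; simp [Arith.eval]
  obtain ⟨s', k, he', h', hy', hrun, hn', hl', ht'⟩ :=
    fwLoop_exec (𝒦 := 𝒦) e hloo hε hD hεD (s.vec 5) N s₁ h₁ (by rwa [hv₁]) (by rw [hv₁]) hf
      (by rwa [hv₁])
  refine ⟨s', k, .seq _ _ _ _ _ he₁ he', h', hy', ?_, hn', by rw [hl', hl₁], by omega⟩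
  rwa [hv₁] at hrun

/-- The time charged to one LOO call. -/
def callCost (n ρ : ℕ) : ℕ := fwCost n ρ + 4 * n + 6

/-- After a pull, scalar 12 still holds the distance measured before it, so the loop test succeeds
and Frank-Wolfe runs again, as `AFPLoop` demands. Termination is by the same level count `N` as in
`AFPLoop.calls_le`. -/
theorem afpLoop_exec (e : Env n ρ) (hloo : ∀ v, IsLOOAnswer 𝒦 v (e.loo v)) (hε : 0 < P.ε)
    {D : ℝ} (hD : FWData 𝒦 (sketchA P.εI S) D) (hεD : P.ε ≤ D) (N : ℕ) :
    ∀ s : State 17 n ρ, ProjInv P S c lg s → s.vec 1 ∈ 𝒦 → 3 * P.ε < s.sc 12 →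
      (∃ z ∈ 𝒦, normSqA (sketchA P.εI S) (s.vec 5 - z) ≤ (9 / 5) ^ N * P.ε) →
      ∃ (s' : State 17 n ρ) (k : ℕ), Exec e (.loop 7 12 afpBody) s s' ∧ ProjInv P S c lg s' ∧
        AFPLoop 𝒦 (sketchA P.εI S) P.ε (2 / 3) (s.vec 1) (s.vec 5) (s'.vec 1) (s'.vec 5) k ∧
        s'.looCalls = s.looCalls + k ∧ s'.time ≤ s.time + k * callCost n ρ := by
  set A := sketchA P.εI S with hA
  have hbody : ∀ s : State 17 n ρ, ProjInv P S c lg s → s.vec 1 ∈ 𝒦 → 3 * P.ε < s.sc 12 →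
      ∃ (s' : State 17 n ρ) (k : ℕ), Exec e afpBody (s.tick 1) s' ∧ ProjInv P S c lg s' ∧
        FWRun 𝒦 A P.ε (s.vec 5) (s.vec 1) (s'.vec 1) k ∧
        s'.looCalls = s.looCalls + k ∧ s'.time + 1 ≤ s.time + k * callCost n ρ ∧
        s'.sc 12 = normSqA A (s'.vec 1 - s.vec 5) ∧
        ((s'.sc 12 ≤ 3 * P.ε ∧ s'.vec 5 = s.vec 5) ∨
          (3 * P.ε < s'.sc 12 ∧
            s'.vec 5 = s.vec 5 - (2 / 3 : ℝ) • (s.vec 5 - s'.vec 1))) := by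
    intro s h hx hfar
    obtain ⟨s₁, k, he₁, h₁, hy₁, hrun, hn₁, hl₁, ht₁⟩ :=
      fw_exec (𝒦 := 𝒦) e hloo hε hD hεD (h.tick 1) hx
    -- Each Frank-Wolfe run makes at least one call, to which the overhead of tests and pull can be
    -- charged.
    have hk := hrun.one_le
    have hkc : k * callCost n ρ = k * fwCost n ρ + k * (4 * n + 6) := by rw [callCost]; ring
    have hk4 : 4 * n + 6 ≤ k * (4 * n + 6) := Nat.le_mul_of_pos_left _ hk
    have ht₁' : s₁.time ≤ s.time + 1 + k * fwCost n ρ + 2 := ht₁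
    by_cases hc : s₁.sc 12 ≤ s₁.sc 7
    · obtain ⟨s₂, he₂, h₂, hv₂, hs₂, hl₂, ht₂⟩ :=
        arith_exec e (h₁.tick 1) .add (d := 14) 0 0 (by decide)
      have h12 : s₂.sc 12 = s₁.sc 12 := by
        rw [hs₂]; simp only [Function.update_apply, Fin.reduceEq, reduceIte]; rfl
      have hv₂' : s₂.vec = s₁.vec := hv₂
      refine ⟨s₂, k, .seq _ _ _ _ _ he₁ (.ite_true _ _ _ _ _ _ hc he₂), h₂, ?_, ?_, ?_, ?_,
        Or.inl ⟨?_, ?_⟩⟩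
      · rw [hv₂']; exact hrun
      · rw [hl₂]; exact hl₁
      · rw [ht₂]; change s₁.time + 1 + 1 + 1 ≤ _; omega
      · rw [h12, hn₁, hv₂']; rfl
      · rw [h12, ← h₁.eps3]; exact hc
      · rw [hv₂', hy₁]; rfl
    · obtain ⟨s₂, he₂, h₂, hx₂, hy₂, hn₂, hl₂, ht₂⟩ := pull_exec e (h₁.tick 1)
      have hx₂' : s₂.vec 1 = s₁.vec 1 := hx₂
      have hn₂' : s₂.sc 12 = s₁.sc 12 := hn₂
      refine ⟨s₂, k, .seq _ _ _ _ _ he₁ (.ite_false _ _ _ _ _ _ hc he₂), h₂, ?_, ?_, ?_, ?_,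
        Or.inr ⟨?_, ?_⟩⟩
      · rw [hx₂']; exact hrun
      · rw [hl₂]; exact hl₁
      · rw [ht₂]; change s₁.time + 1 + 4 * n + 1 ≤ _; omega
      · rw [hn₂', hn₁, hx₂']; rfl
      · rw [hn₂', ← h₁.eps3]; exact not_le.1 hc
      · rw [hy₂, hx₂']
        change s₁.vec 5 - (2 / 3 : ℝ) • (s₁.vec 5 - s₁.vec 1) = _
        rw [hy₁]; rfl
  induction N with
  | zero =>
    intro s h hx hfar hN
    obtain ⟨s₁, k, he₁, h₁, hrun, hl₁, ht₁, hn₁, hcase⟩ := hbody s h hx hfar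
    have hlt : s.sc 7 < s.sc 12 := by rwa [h.eps3]
    rcases hcase with ⟨hc, hy₁⟩ | ⟨hc, hy₁⟩
    · have hge : ¬ s₁.sc 7 < s₁.sc 12 := by rw [h₁.eps3]; exact not_lt.2 hc
      refine ⟨s₁.tick 1, k, .loop_true _ _ _ _ _ _ hlt he₁ (.loop_false _ _ _ _ hge), h₁.tick 1,
        ?_, hl₁, ht₁⟩
      change AFPLoop 𝒦 A P.ε (2 / 3) (s.vec 1) (s.vec 5) (s₁.vec 1) (s₁.vec 5) k
      rw [hy₁]
      exact .done _ _ _ _ hrun (by rwa [← hn₁])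
    · obtain ⟨z, hz, hzN⟩ := hN
      rw [hn₁] at hc
      have := near_of_far hD.symm hD.nonneg hc (hrun.gap_le_of_far hD.symm hc hz)
      simp only [pow_zero, one_mul] at hzN
      linarith
  | succ N ih =>
    intro s h hx hfar hN
    obtain ⟨s₁, k, he₁, h₁, hrun, hl₁, ht₁, hn₁, hcase⟩ := hbody s h hx hfar
    have hlt : s.sc 7 < s.sc 12 := by rwa [h.eps3]
    rcases hcase with ⟨hc, hy₁⟩ | ⟨hc, hy₁⟩
    · have hge : ¬ s₁.sc 7 < s₁.sc 12 := by rw [h₁.eps3]; exact not_lt.2 hc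
      refine ⟨s₁.tick 1, k, .loop_true _ _ _ _ _ _ hlt he₁ (.loop_false _ _ _ _ hge), h₁.tick 1,
        ?_, hl₁, ht₁⟩
      change AFPLoop 𝒦 A P.ε (2 / 3) (s.vec 1) (s.vec 5) (s₁.vec 1) (s₁.vec 5) k
      rw [hy₁]
      exact .done _ _ _ _ hrun (by rwa [← hn₁])
    · obtain ⟨z, hz, hzN⟩ := hN
      have hx₁ := hrun.mem hD.convex hx
      have hc' := hc
      rw [hn₁] at hc'
      have hgap := hrun.gap_le_of_far hD.symm hc' hz
      obtain ⟨z', hz', hd⟩ := exists_near_pull hD.symm hx₁ hz hc' hgap (by positivity) hzN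
      rw [← hy₁] at hd
      obtain ⟨s', j, he', h', hrun', hl', ht'⟩ := ih s₁ h₁ hx₁ hc
        ⟨z', hz', hd.trans_eq (by rw [pow_succ]; ring)⟩
      refine ⟨s', k + j, .loop_true _ _ _ _ _ _ hlt he₁ he', h', ?_, ?_, ?_⟩
      · rw [hy₁] at hrun'
        exact .pull _ _ _ _ _ _ _ hrun hc' hrun'
      · rw [hl', hl₁]; omega
      · have : (k + j) * callCost n ρ = k * callCost n ρ + j * callCost n ρ := by ring
        omega

theorem afp_exec (e : Env n ρ) (hloo : ∀ v, IsLOOAnswer 𝒦 v (e.loo v)) (hε : 0 < P.ε)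
    {D : ℝ} (hD : FWData 𝒦 (sketchA P.εI S) D) (hεD : P.ε ≤ D) {s : State 17 n ρ}
    (h : ProjInv P S c lg s) (hx : s.vec 1 ∈ 𝒦) :
    ∃ (s' : State 17 n ρ) (k : ℕ), Exec e afpProg s s' ∧ ProjInv P S c lg s' ∧
      AFPRun 𝒦 (sketchA P.εI S) P.ε (2 / 3) (s.vec 1) (s.vec 5) (s'.vec 1) (s'.vec 5) k ∧
      s'.looCalls = s.looCalls + k ∧
      s'.time ≤ s.time + k * callCost n ρ + (4 * ((ρ + 1) * n) + 6 * n + 1) := by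
  obtain ⟨s₁, he₁, h₁, hx₁, hy₁, -, hn₁, -, hl₁, ht₁⟩ := residual_exec e h
  by_cases hc : s₁.sc 7 < s₁.sc 12
  · have hfar : 3 * P.ε < s₁.sc 12 := by rwa [h₁.eps3] at hc
    obtain ⟨N, hN⟩ := pow_unbounded_of_one_lt
      (normSqA (sketchA P.εI S) (s.vec 5 - s.vec 1) / P.ε) (show (1 : ℝ) < 9 / 5 by norm_num)
    rw [div_lt_iff₀ hε] at hN
    obtain ⟨s', k, he', h', hrun, hl', ht'⟩ := afpLoop_exec (𝒦 := 𝒦) e hloo hε hD hεD N s₁ h₁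
      (by rwa [hx₁]) hfar ⟨s.vec 1, hx, by rw [hy₁]; exact hN.le⟩
    refine ⟨s', k, .seq _ _ _ _ _ he₁ he', h', .loop _ _ _ (by rwa [← hn₁]) ?_, by rw [hl', hl₁],
      by omega⟩
    rwa [hx₁, hy₁] at hrun
  · refine ⟨s₁.tick 1, 0, .seq _ _ _ _ _ he₁ (.loop_false _ _ _ _ hc), h₁.tick 1, ?_, hl₁, ?_⟩
    · change AFPRun 𝒦 (sketchA P.εI S) P.ε (2 / 3) (s.vec 1) (s.vec 5) (s₁.vec 1) (s₁.vec 5) 0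
      rw [hx₁, hy₁]
      refine .immediate ?_
      rw [h₁.eps3, hn₁] at hc
      exact not_lt.1 hc
    · change s₁.time + 1 ≤ _
      omega

end ProjectionLoops

/-! ### Execution of the whole program -/

section Main

variable {n ρ : ℕ} {P : Params} {S : Matrix (Fin (ρ + 1)) (Fin n) ℝ} {c : ℝ}
  {lg : List (Vec n × Vec n)} {𝒦 : Set (Vec n)}

/-- `i` rounds of the block are done and `j` remain; the length of the log supplies the index of the
loss whose gradient is observed. -/
theorem roundsLoop_exec (e : Env n ρ) (x y : Vec n) (j : ℕ) :
    ∀ (i : ℕ) (s : State 17 n ρ), i + j = P.K →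
      ProjInv P S c (lg ++ List.replicate i (x, y)) s → s.vec 1 = x → s.vec 2 = y →
      s.sc 11 = i → s.vec 3 = ∑ k ∈ Finset.range i, e.grad (lg.length + k) y →
      ∃ s', Exec e (.loop 11 5 roundProg) s s' ∧
        ProjInv P S c (lg ++ List.replicate P.K (x, y)) s' ∧ s'.vec 1 = x ∧ s'.vec 2 = y ∧
        s'.vec 3 = ∑ k ∈ Finset.range P.K, e.grad (lg.length + k) y ∧
        s'.looCalls = s.looCalls ∧ s'.time = s.time + (j * (3 * n + 2) + 1) := by
  induction j with
  | zero =>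
    intro i s hi h hx hy hc hg
    have hiK : i = P.K := by omega
    subst hiK
    have hge : ¬ s.sc 11 < s.sc 5 := by rw [hc, h.blockLen]; exact lt_irrefl _
    exact ⟨s.tick 1, .loop_false _ _ _ _ hge, h.tick 1, hx, hy, hg, rfl, by
      change s.time + 1 = _; omega⟩
  | succ j ih =>
    intro i s hi h hx hy hc hg
    have hlt : s.sc 11 < s.sc 5 := by
      rw [hc, h.blockLen]
      exact_mod_cast (by omega : i < P.K)
    obtain ⟨s₁, he₁, h₁, hx₁, hy₁, hg₁, hc₁, hl₁, ht₁⟩ := round_exec e (h.tick 1)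
    have hx' : (s.tick 1).vec 1 = x := hx
    have hy' : (s.tick 1).vec 2 = y := hy
    have hlog : lg ++ List.replicate i (x, y) ++ [((s.tick 1).vec 1, (s.tick 1).vec 2)] =
        lg ++ List.replicate (i + 1) (x, y) := by
      rw [hx', hy', List.append_assoc, List.replicate_succ']
    rw [hlog] at h₁
    obtain ⟨s', he', h', hx'', hy'', hg', hl', ht'⟩ := ih (i + 1) s₁ (by omega) h₁ (hx₁.trans hx')
      (hy₁.trans hy') (by rw [hc₁]; change s.sc 11 + 1 = _; rw [hc]; push_cast; rfl) (by
        rw [hg₁, hy', Finset.sum_range_succ, List.length_append, List.length_replicate, add_comm]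
        change s.vec 3 + _ = _
        rw [hg])
    refine ⟨s', .loop_true _ _ _ _ _ _ hlt he₁ he', h', hx'', hy'', hg', by rw [hl', hl₁]; rfl, ?_⟩
    rw [ht', ht₁]
    change s.time + 1 + (3 * n + 1) + _ = _
    ring

theorem rounds_exec (e : Env n ρ) {s : State 17 n ρ} (h : ProjInv P S c lg s) :
    ∃ s', Exec e roundsProg s s' ∧
      ProjInv P S c (lg ++ List.replicate P.K (s.vec 1, s.vec 2)) s' ∧ s'.vec 1 = s.vec 1 ∧
      s'.vec 2 = s.vec 2 ∧
      s'.vec 3 = ∑ k ∈ Finset.range P.K, e.grad (lg.length + k) (s.vec 2) ∧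
      s'.looCalls = s.looCalls ∧ s'.time = s.time + (P.K * (3 * n + 2) + 2 * n + 2) := by
  obtain ⟨s₁, he₁, h₁, hx₁, hy₁, hg₁, hc₁, hl₁, ht₁⟩ := roundInit_exec e h
  obtain ⟨s', he', h', hx', hy', hg', hl', ht'⟩ := roundsLoop_exec (P := P) (S := S) (c := c)
    (lg := lg) e (s.vec 1) (s.vec 2) P.K 0 s₁ (by omega) (by simpa using h₁) hx₁ hy₁
    (by simpa using hc₁) (by simpa using hg₁)
  exact ⟨s', .seq _ _ _ _ _ he₁ he', h', hx', hy', hg', by rw [hl', hl₁], by rw [ht', ht₁]; ring⟩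

theorem norm_sq_mv_le (S : Matrix (Fin (ρ + 1)) (Fin n) ℝ) (x : Vec n) :
    ‖mv S x‖ ^ 2 ≤ (∑ i, ‖(WithLp.toLp 2 (S i) : Vec n)‖ ^ 2) * ‖x‖ ^ 2 := by
  rw [EuclideanSpace.real_norm_sq_eq, Finset.sum_mul]
  refine Finset.sum_le_sum fun i _ => ?_
  have := inner_sq_le (WithLp.toLp 2 (S i) : Vec n) x
  rwa [inner_eq_dotProduct] at this

/-- A crude `D` is enough here: it only ensures termination, since the time is measured in oracle
calls, which are counted separately. -/
theorem exists_fwData (h𝒦 : Convex ℝ 𝒦) {R : ℝ} (hsub : 𝒦 ⊆ Metric.closedBall 0 R) {εI : ℝ}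
    (hεI : 0 < εI) (S : Matrix (Fin (ρ + 1)) (Fin n) ℝ) (ε : ℝ) :
    ∃ D, FWData 𝒦 (sketchA εI S) D ∧ ε ≤ D := by
  set B := ∑ i, ‖(WithLp.toLp 2 (S i) : Vec n)‖ ^ 2
  have hB : 0 ≤ B := by positivity
  refine ⟨max ε ((εI + B) * (2 * R) ^ 2), ⟨h𝒦, sketchA_isSymm S, normSqA_sketchA_nonneg S hεI,
    fun u hu v hv => le_trans ?_ (le_max_right _ _)⟩, le_max_left _ _⟩
  have h6 : ‖u‖ ≤ R := by simpa using hsub hu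
  have h7 : ‖v‖ ≤ R := by simpa using hsub hv
  have h5 : ‖u - v‖ ≤ 2 * R := by linarith [norm_sub_le u v]
  have h8 : ‖u - v‖ ^ 2 ≤ (2 * R) ^ 2 := pow_le_pow_left₀ (norm_nonneg _) h5 2
  rw [normSqA_sketchA]
  calc εI * ‖u - v‖ ^ 2 + ‖mv S (u - v)‖ ^ 2 ≤ (εI + B) * ‖u - v‖ ^ 2 := by
        linarith [norm_sq_mv_le S (u - v)]
    _ ≤ _ := by gcongr

/-- The time for one block, apart from the LOO calls. -/
def blockCost (n ρ K : ℕ) : ℕ :=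
  K * (3 * n + 2) + (4 * ((ρ + 1) ^ 2 * n) + (ρ + 1) ^ 3 + 9 * ((ρ + 1) * n) + 15 * n
    + 7 * (ρ + 1) + 6)

theorem block_exec (e : Env n ρ) (hloo : ∀ v, IsLOOAnswer 𝒦 v (e.loo v))
    (heig : IsEigenSolver e.eig) (hρ : ρ ≤ n) (h𝒦 : Convex ℝ 𝒦) {R : ℝ}
    (hsub : 𝒦 ⊆ Metric.closedBall 0 R) (hε : 0 < P.ε) (hεI : 0 < P.εI) {s : State 17 n ρ}
    (h : ProjInv P S c lg s) (hx : s.vec 1 ∈ 𝒦) {b : Vec n}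
    (hb : b = ∑ k ∈ Finset.range P.K, e.grad (lg.length + k) (s.vec 2)) :
    ∃ (s' : State 17 n ρ) (S' : Matrix (Fin (ρ + 1)) (Fin n) ℝ) (y : Vec n) (k : ℕ),
      Exec e blockProg s s' ∧
      ProjInv P S' (c + 1) (lg ++ List.replicate P.K (s.vec 1, s.vec 2)) s' ∧
      FDStep S b S' ∧ y = s.vec 2 - P.η • mv (sketchA P.εI S')⁻¹ b ∧
      AFPRun 𝒦 (sketchA P.εI S') P.ε (2 / 3) (s.vec 1) y (s'.vec 1) (s'.vec 2) k ∧
      s'.looCalls = s.looCalls + k ∧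
      s'.time + 1 ≤ s.time + blockCost n ρ P.K + k * callCost n ρ := by
  obtain ⟨s₁, he₁, h₁, hx₁, hy₁, hg₁, hl₁, ht₁⟩ := rounds_exec e h
  rw [← hb] at hg₁
  obtain ⟨s₂, he₂, h₂, hv₂, hev₂, hl₂, ht₂⟩ := sketch_exec e h₁ rfl
  rw [hg₁] at h₂ hev₂
  set M := S.updateRow (Fin.last ρ) b.ofLp with hM
  obtain ⟨s₃, he₃, h₃, hx₃, hy₃, hl₃, ht₃⟩ := newton_exec e h₂
  have hfd : FDStep S b (eigSketch e.eig M) := fdStep_eigSketch hρ heig S b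
  obtain ⟨hev, hdiag⟩ := eigSketch_mul_transpose heig M
  set S' := eigSketch e.eig M with hS'
  have hy₃' : s₃.vec 5 = s.vec 2 - P.η • mv (sketchA P.εI S')⁻¹ b := by
    rw [hy₃, woodbury hev hdiag hεI, hv₂, hg₁, hy₁, hev₂, div_eq_mul_inv]
    module
  have hx₃' : s₃.vec 1 = s.vec 1 := by rw [hx₃, hv₂, hx₁]
  obtain ⟨D, hD, hεD⟩ := exists_fwData h𝒦 hsub hεI S' P.ε
  obtain ⟨s₄, k, he₄, h₄, hrun, hl₄, ht₄⟩ := afp_exec (𝒦 := 𝒦) e hloo hε hD hεD h₃ (by rwa [hx₃'])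
  obtain ⟨s₅, he₅, h₅, hx₅, hy₅, hl₅, ht₅⟩ := next_exec e h₄
  refine ⟨s₅, S', _, k, .seq _ _ _ _ _ he₁ (.seq _ _ _ _ _ he₂ (.seq _ _ _ _ _ he₃
    (.seq _ _ _ _ _ he₄ he₅))), h₅, hfd, rfl, ?_, ?_, ?_⟩
  · rw [hx₅, hy₅, ← hx₃', ← hy₃']; exact hrun
  · rw [hl₅, hl₄, hl₃, hl₂, hl₁]
  · rw [ht₅]
    rw [ht₃, ht₂, ht₁] at ht₄
    rw [blockCost]
    omega

theorem protocol_succ (r : Run n ρ) (m : ℕ) {K : ℕ} :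
    r.protocol ((m + 1) * K) K = r.protocol (m * K) K ++ List.replicate K (r.x m, r.yt m) := by
  rw [Run.protocol, Nat.succ_mul, List.range_add, List.map_append, List.map_map]
  congr 1
  rw [← List.length_range (n := K), ← List.map_const', List.length_range]
  refine List.map_congr_left fun s hs => ?_
  simp only [Function.comp_apply, block_div m (List.mem_range.1 hs)]

theorem protocol_congr {r r' : Run n ρ} {m K : ℕ} (hx : ∀ j < m, r'.x j = r.x j)
    (hy : ∀ j < m, r'.yt j = r.yt j) : r'.protocol (m * K) K = r.protocol (m * K) K := by
  refine List.map_congr_left fun t ht => ?_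
  have : t / K < m := Nat.div_lt_of_lt_mul (by rw [mul_comm]; exact List.mem_range.1 ht)
  rw [hx _ this, hy _ this]

/-- The parameters for the first `m` blocks. -/
def Params.truncate (P : Params) (m : ℕ) : Params := { P with M := m }

theorem Setting.truncate {f : ℕ → Vec n → ℝ} {g : ℕ → Vec n → Vec n} {R G α β : ℝ}
    (hs : Setting ρ 𝒦 f g R G α β P) {m : ℕ} (hm : m ≤ P.M) :
    Setting ρ 𝒦 f g R G α β (P.truncate m) :=
  { hs with loss := fun t ht => hs.loss t (lt_of_lt_of_le ht (Nat.mul_le_mul_right _ hm)) }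

/-- A run is extended by one block. -/
theorem IsRun.extend {g : ℕ → Vec n → Vec n} {x₁ : Vec n} {r : Run n ρ} {m : ℕ}
    (hr : IsRun 𝒦 g x₁ (P.truncate m) r) {S' : Matrix (Fin (ρ + 1)) (Fin n) ℝ} {x' y y' : Vec n}
    {k : ℕ} (hS : FDStep (r.S m) (r.blockGrad P.K g m) S')
    (hy : y = r.yt m - P.η • mv (sketchA P.εI S')⁻¹ (r.blockGrad P.K g m))
    (hp : AFPRun 𝒦 (sketchA P.εI S') P.ε (2 / 3) (r.x m) y x' y' k) :
    ∃ r' : Run n ρ, IsRun 𝒦 g x₁ (P.truncate (m + 1)) r' ∧ r'.x (m + 1) = x' ∧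
      r'.yt (m + 1) = y' ∧ r'.S (m + 1) = S' ∧ (∀ j ≤ m, r'.x j = r.x j) ∧
      (∀ j ≤ m, r'.yt j = r.yt j) ∧ r'.totalCalls (m + 1) = r.totalCalls m + k := by
  set r' : Run n ρ :=
    { x := Function.update r.x (m + 1) x'
      yt := Function.update r.yt (m + 1) y'
      y := Function.update r.y (m + 1) y
      S := Function.update r.S (m + 1) S'
      calls := Function.update r.calls m k } with hr'
  have hx : ∀ j ≤ m, r'.x j = r.x j := fun j hj => Function.update_of_ne (by omega) _ _
  have hyt : ∀ j ≤ m, r'.yt j = r.yt j := fun j hj => Function.update_of_ne (by omega) _ _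
  have hyy : ∀ j ≤ m, r'.y j = r.y j := fun j hj => Function.update_of_ne (by omega) _ _
  have hSS : ∀ j ≤ m, r'.S j = r.S j := fun j hj => Function.update_of_ne (by omega) _ _
  have hc : ∀ j < m, r'.calls j = r.calls j := fun j hj => Function.update_of_ne (by omega) _ _
  have hx1 : r'.x (m + 1) = x' := Function.update_self _ _ _
  have hyt1 : r'.yt (m + 1) = y' := Function.update_self _ _ _
  have hyy1 : r'.y (m + 1) = y := Function.update_self _ _ _
  have hS1 : r'.S (m + 1) = S' := Function.update_self _ _ _
  have hc1 : r'.calls m = k := Function.update_self _ _ _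
  have hbg : ∀ j ≤ m, r'.blockGrad P.K g j = r.blockGrad P.K g j := by
    intro j hj; rw [Run.blockGrad, hyt j hj]; rfl
  refine ⟨r', ⟨?_, ?_, ?_, ?_, ?_, ?_⟩, hx1, hyt1, hS1, hx, hyt, ?_⟩
  · rw [hx 0 (by omega)]; exact hr.x_init
  · rw [hyt 0 (by omega)]; exact hr.yt_init
  · rw [hSS 0 (by omega)]; exact hr.S_init
  · intro j hj
    change FDStep (r'.S j) (r'.blockGrad P.K g j) (r'.S (j + 1))
    have hj' : j ≤ m := Nat.lt_succ_iff.1 hj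
    rw [hSS j hj', hbg j hj']
    rcases hj'.lt_or_eq with h | h
    · rw [hSS (j + 1) h]; exact hr.sketch j h
    · subst h; rwa [hS1]
  · intro j hj
    change r'.y (j + 1) =
      r'.yt j - P.η • mv (sketchA P.εI (r'.S (j + 1)))⁻¹ (r'.blockGrad P.K g j)
    have hj' : j ≤ m := Nat.lt_succ_iff.1 hj
    rw [hyt j hj', hbg j hj']
    rcases hj'.lt_or_eq with h | h
    · rw [hSS (j + 1) h, hyy (j + 1) h]; exact hr.newton j h
    · subst h; rwa [hS1, hyy1]
  · intro j hj
    change AFPRun 𝒦 (sketchA P.εI (r'.S (j + 1))) P.ε (2 / 3) (r'.x j) (r'.y (j + 1))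
      (r'.x (j + 1)) (r'.yt (j + 1)) (r'.calls j)
    have hj' : j ≤ m := Nat.lt_succ_iff.1 hj
    rw [hx j hj']
    rcases hj'.lt_or_eq with h | h
    · rw [hSS (j + 1) h, hyy (j + 1) h, hx (j + 1) h, hyt (j + 1) h, hc j h]
      exact hr.project j h
    · subst h; rwa [hS1, hyy1, hx1, hyt1, hc1]
  · rw [Run.totalCalls, Finset.sum_range_succ, hc1]
    congr 1
    exact Finset.sum_congr rfl fun j hj => hc j (Finset.mem_range.1 hj)

/-- The run is built alongside the execution: after `m` blocks there is a run for the parameters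
truncated to `m`, whose invariant provides `x_m ∈ 𝒦` for the next projection. -/
theorem blocksLoop_exec {f : ℕ → Vec n → ℝ} {g : ℕ → Vec n → Vec n} {R G α β : ℝ}
    (hs : Setting ρ 𝒦 f g R G α β P) (e : Env n ρ) (hg : e.grad = g)
    (hloo : ∀ v, IsLOOAnswer 𝒦 v (e.loo v)) (heig : IsEigenSolver e.eig) {x₁ : Vec n}
    (hx₁ : x₁ ∈ 𝒦) (t₀ : ℕ) (j : ℕ) :
    ∀ (m : ℕ) (s : State 17 n ρ) (r : Run n ρ), m + j = P.M → IsRun 𝒦 g x₁ (P.truncate m) r →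
      ProjInv P (r.S m) m (r.protocol (m * P.K) P.K) s → s.vec 1 = r.x m → s.vec 2 = r.yt m →
      s.looCalls = r.totalCalls m →
      s.time ≤ t₀ + m * blockCost n ρ P.K + r.totalCalls m * callCost n ρ →
      ∃ (s' : State 17 n ρ) (r' : Run n ρ), Exec e (.loop 10 6 blockProg) s s' ∧
        IsRun 𝒦 g x₁ P r' ∧ s'.log = r'.protocol (P.M * P.K) P.K ∧
        s'.looCalls = r'.totalCalls P.M ∧
        s'.time ≤ t₀ + P.M * blockCost n ρ P.K + r'.totalCalls P.M * callCost n ρ + 1 := by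
  induction j with
  | zero =>
    intro m s r hm hr h hx hy hl ht
    have hmM : m = P.M := by omega
    subst hmM
    have hge : ¬ s.sc 10 < s.sc 6 := by rw [h.cnt, h.blocks]; exact lt_irrefl _
    exact ⟨s.tick 1, r, .loop_false _ _ _ _ hge, hr, h.log, hl, Nat.add_le_add_right ht 1⟩
  | succ j ih =>
    intro m s r hm hr h hx hy hl ht
    have hmM : m < P.M := by omega
    have hlt : s.sc 10 < s.sc 6 := by
      rw [h.cnt, h.blocks]; exact_mod_cast hmM
    have hxm : r.x m ∈ 𝒦 := (hr.invariant (hs.truncate hmM.le) hx₁ m le_rfl).x_mem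
    have hb : r.blockGrad P.K g m = ∑ k ∈ Finset.range P.K,
        e.grad ((r.protocol (m * P.K) P.K).length + k) ((s.tick 1).vec 2) := by
      change _ = ∑ k ∈ Finset.range P.K, e.grad ((r.protocol (m * P.K) P.K).length + k) (s.vec 2)
      rw [hy, hg, Run.protocol, List.length_map, List.length_range]; rfl
    obtain ⟨s₁, S', y, k, he₁, h₁, hfd, hny, hafp, hl₁, ht₁⟩ := block_exec (𝒦 := 𝒦) e hloo heig
      hs.rank_le hs.convex hs.subset hs.ε_pos hs.εI_pos (h.tick 1) (by
        change s.vec 1 ∈ 𝒦; rwa [hx]) hb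
    have e1 : (s.tick 1).vec 1 = r.x m := hx
    have e2 : (s.tick 1).vec 2 = r.yt m := hy
    rw [e2] at hny
    rw [e1] at hafp
    rw [e1, e2] at h₁
    obtain ⟨r', hr', hx', hy', hS', hxx, hyy, hcalls⟩ := hr.extend hfd hny hafp
    have hprot : r'.protocol ((m + 1) * P.K) P.K =
        r.protocol (m * P.K) P.K ++ List.replicate P.K (r.x m, r.yt m) := by
      rw [protocol_succ, hxx m le_rfl, hyy m le_rfl,
        protocol_congr (fun j hj => hxx j hj.le) (fun j hj => hyy j hj.le)]
    obtain ⟨s', r'', he', hr'', hlog, hl', ht'⟩ := ih (m + 1) s₁ r' (by omega) hr'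
      (by rw [hS', hprot]; push_cast; exact h₁) hx'.symm hy'.symm
      (by rw [hl₁, hcalls, ← hl]; rfl) (by
        have h3 : s₁.time + 1 ≤ s.time + 1 + blockCost n ρ P.K + k * callCost n ρ := ht₁
        rw [hcalls, Nat.succ_mul, Nat.add_mul]
        omega)
    exact ⟨s', r'', .loop_true _ _ _ _ _ _ hlt he₁ he', hr'', hlog, hl', ht'⟩

theorem main_exec {f : ℕ → Vec n → ℝ} {g : ℕ → Vec n → Vec n} {R G α β : ℝ}
    (hs : Setting ρ 𝒦 f g R G α β P) (e : Env n ρ) (hP : e.params = P) (hg : e.grad = g)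
    (hloo : ∀ v, IsLOOAnswer 𝒦 v (e.loo v)) (heig : IsEigenSolver e.eig) (hx₁ : e.x₁ ∈ 𝒦) :
    ∃ (s : State 17 n ρ) (r : Run n ρ), Exec e mainProg (State.init 17 n ρ) s ∧
      IsRun 𝒦 g e.x₁ P r ∧ s.log = r.protocol (P.M * P.K) P.K ∧
      s.looCalls = r.totalCalls P.M ∧
      s.time ≤ 2 * n + 12 + P.M * blockCost n ρ P.K + r.totalCalls P.M * callCost n ρ + 1 := by
  obtain ⟨s₁, he₁, h₁, hx, hy, hl, ht⟩ := init_exec e hP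
  set r₀ : Run n ρ :=
    { x := fun _ => e.x₁, yt := fun _ => e.x₁, y := fun _ => 0, S := fun _ => 0,
      calls := fun _ => 0 }
  have hr₀ : IsRun 𝒦 g e.x₁ (P.truncate 0) r₀ :=
    ⟨rfl, rfl, rfl, fun m hm => absurd hm (Nat.not_lt_zero m),
      fun m hm => absurd hm (Nat.not_lt_zero m), fun m hm => absurd hm (Nat.not_lt_zero m)⟩
  obtain ⟨s', r', he', hr', hlog, hl', ht'⟩ := blocksLoop_exec hs e hg hloo heig hx₁ (2 * n + 12)
    P.M 0 s₁ r₀ (by omega) hr₀ (by simpa [Run.protocol] using h₁) hx hy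
    (by rw [hl]; simp [Run.totalCalls]) (by rw [ht]; omega)
  exact ⟨s', r', .seq _ _ _ _ _ he₁ he', hr', hlog, hl', ht'⟩

theorem memoryCells_le (hρ : 1 ≤ ρ) (hρn : ρ ≤ n) : memoryCells 17 n ρ ≤ 170 * (ρ * n) := by
  have hn : 1 ≤ n := hρ.trans hρn
  have h1 : n ≤ ρ * n := Nat.le_mul_of_pos_left _ hρ
  have h2 : ρ ≤ ρ * n := Nat.le_mul_of_pos_right _ hn
  have h3 : ρ * ρ ≤ ρ * n := Nat.mul_le_mul_left _ hρn
  rw [memoryCells]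
  nlinarith

theorem callCost_le (hρ : 1 ≤ ρ) (hρn : ρ ≤ n) : callCost n ρ ≤ 49 * (ρ * n) := by
  have hn : 1 ≤ n := hρ.trans hρn
  have h1 : n ≤ ρ * n := Nat.le_mul_of_pos_left _ hρ
  rw [callCost, fwCost]
  nlinarith

theorem blockCost_le (hρ : 1 ≤ ρ) (hρn : ρ ≤ n) (K : ℕ) :
    blockCost n ρ K ≤ K * (5 * (ρ * n)) + 77 * (ρ ^ 2 * n) := by
  have hn : 1 ≤ n := hρ.trans hρn
  have h1 : n ≤ ρ * n := Nat.le_mul_of_pos_left _ hρ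
  have h2 : ρ + 1 ≤ 2 * ρ := by omega
  have h3 : (ρ + 1) ^ 2 * n ≤ (2 * ρ) ^ 2 * n := by gcongr
  have h4 : (ρ + 1) ^ 3 ≤ 8 * (ρ ^ 2 * n) := by
    calc (ρ + 1) ^ 3 ≤ (2 * ρ) ^ 3 := by gcongr
      _ = 8 * (ρ ^ 2 * ρ) := by ring
      _ ≤ 8 * (ρ ^ 2 * n) := by gcongr
  have h5 : ρ * n ≤ ρ ^ 2 * n := by
    gcongr; exact Nat.le_self_pow (by norm_num) ρ
  have h6 : (ρ + 1) * n ≤ 2 * ρ * n := by gcongr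
  have h7 : ρ ≤ ρ * n := Nat.le_mul_of_pos_right _ hn
  have h8 : K * (3 * n + 2) ≤ K * (5 * (ρ * n)) := by gcongr; omega
  rw [blockCost]
  nlinarith

end Main

end LooOns

/-! ### Assembly of the bounds with explicit constants -/

theorem mainTheorem2 :
    ∃ c : ℝ, 0 < c ∧ ∃ C : ℝ, 0 < C ∧ ∃ (r : ℕ) (prog : Prog r),
      ∀ (n ρ T K : ℕ) (R G α β : ℝ) (𝒦 : Set (Vec n)) (f : ℕ → Vec n → ℝ)
        (g : ℕ → Vec n → Vec n),
        1 ≤ ρ → ρ ≤ n → 0 < R → 0 < G → 0 < α → 0 ≤ β →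
        Convex ℝ 𝒦 → IsCompact 𝒦 → 𝒦.Nonempty → 𝒦 ⊆ Metric.closedBall 0 R →
        (∀ t < T, IsAdmissibleLoss R G α β (f t) (g t)) →
        horizonThreshold c ρ T R G α ≤ (T : ℝ) →
        (K : ℝ) = 4 * (ρ : ℝ) ^ (-(1 / 3) : ℝ) * (T : ℝ) ^ (2 / 3 : ℝ) → K ∣ T →
        -- the parameters are admissible
        (max (12 * K * G * R) (2 * K / α) ≤ etaChoice ρ T R G α ∧
          (K * G) ^ 2 ≤ epsIChoice T G ∧
          3 * epsChoice ρ T R G α / epsIChoice T G ≤ 4 * R ^ 2) ∧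
        -- regret and number of LOO calls of every run
        (∀ x₁ ∈ 𝒦, ∀ run : Run n ρ, IsRun 𝒦 g x₁ (paramChoice ρ T K R G α) run →
          (∀ t < T, run.x (t / K) ∈ 𝒦 ∧ run.yt (t / K) ∈ Metric.closedBall 0 (3 * R)) ∧
          run.regret 𝒦 f T K ≤
            regretBound c ρ T R G α β (tailEigen (run.grad K g) T ρ) ∧
          (run.totalCalls (T / K) : ℝ) ≤
            0.65 * (8 * (ρ : ℝ) ^ (1 / 3 : ℝ) * (T : ℝ) ^ (2 / 3 : ℝ) + T)) ∧
        -- space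
        (memoryCells r n ρ : ℝ) ≤ C * (ρ * n) ∧
        -- the program performs such a run, within the stated additional running time
        (∀ e : Env n ρ, e.params = paramChoice ρ T K R G α → e.grad = g → e.x₁ ∈ 𝒦 →
          (∀ v, IsLOOAnswer 𝒦 v (e.loo v)) → IsEigenSolver e.eig →
          ∃ (s : State r n ρ) (run : Run n ρ),
            Exec e prog (State.init r n ρ) s ∧
            IsRun 𝒦 g e.x₁ (paramChoice ρ T K R G α) run ∧
            s.log = run.protocol T K ∧
            s.looCalls = run.totalCalls (T / K) ∧
            (s.time : ℝ) ≤ C * (ρ * n * T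
              + (ρ : ℝ) ^ (4 / 3 : ℝ) * n * (T : ℝ) ^ (2 / 3 : ℝ)
              + (ρ : ℝ) ^ (7 / 3 : ℝ) * n * (T : ℝ) ^ (1 / 3 : ℝ))) := by
  refine ⟨1000, by norm_num, 400, by norm_num, 17, mainProg, ?_⟩
  intro n ρ T K R G α β 𝒦 f g hρ hρn hR hG hα hβ h𝒦 _ _ hsub hloss hT hK hKT
  obtain ⟨p, s, L, q, h⟩ := exists_scale hρ hR hG hα hT hK hKT
  have hs := h.setting hρ hρn hR hG hα hβ h𝒦 hsub hloss
  have hs0 := h.s_pos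
  have hp1 := h.one_le_p
  have hp0 : 0 < p := by linarith
  have hs2 : (T : ℝ) ^ (2 / 3 : ℝ) = s ^ 2 := by
    rw [h.s_eq]; exact rpow_third_mul (Nat.cast_nonneg T) 2 _ (by norm_num)
  have hn0 : (0 : ℝ) ≤ n := Nat.cast_nonneg n
  refine ⟨⟨h.max_le_eta, ?_, h.ratio_le hG⟩, ?_, ?_, ?_⟩
  · have h1 := h.sq_le hG
    have h2 : 0 < epsIChoice T G := hs.εI_pos
    linarith
  · intro x₁ hx₁ run hrun
    refine ⟨fun t ht => ?_, h.regret_le hs hrun hx₁, ?_⟩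
    · have hi := hrun.invariant hs hx₁ (t / K) (Nat.div_le_div_right ht.le)
      exact ⟨hi.x_mem, hi.yt_mem⟩
    · rw [hs2, ← h.p_eq]
      exact h.totalCalls_le hs hrun hx₁
  · have h1 : (memoryCells 17 n ρ : ℝ) ≤ 170 * (ρ * n) := by
      exact_mod_cast memoryCells_le hρ hρn
    have h2 : (0 : ℝ) ≤ (ρ : ℝ) * n := by positivity
    linarith
  · intro e hP hg hx₁ hloo heig
    obtain ⟨st, run, hex, hrun, hlog, hl, ht⟩ := main_exec hs e hP hg hloo heig hx₁
    have hMK : (paramChoice ρ T K R G α).M * (paramChoice ρ T K R G α).K = T := h.mul_eq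
    rw [hMK] at hlog
    refine ⟨st, run, hex, hrun, hlog, hl, ?_⟩
    have hcalls := h.totalCalls_le hs hrun hx₁
    have hblock := blockCost_le hρ hρn K
    have hcall := callCost_le hρ hρn
    have ht' : st.time ≤ 2 * n + 13 + T / K * (K * (5 * (ρ * n)) + 77 * (ρ ^ 2 * n))
        + run.totalCalls (T / K) * (49 * (ρ * n)) := by
      have h1 : T / K * blockCost n ρ K ≤ T / K * (K * (5 * (ρ * n)) + 77 * (ρ ^ 2 * n)) :=
        Nat.mul_le_mul_left _ hblock
      have h2 : run.totalCalls (T / K) * callCost n ρ ≤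
          run.totalCalls (T / K) * (49 * (ρ * n)) := Nat.mul_le_mul_left _ hcall
      have h3 : st.time ≤ 2 * n + 12 + T / K * blockCost n ρ K
        + run.totalCalls (T / K) * callCost n ρ + 1 := ht
      omega
    have ht'' : (st.time : ℝ) ≤ 2 * n + 13
        + ((T / K : ℕ) : ℝ) * (K * (5 * (ρ * n)) + 77 * ((ρ : ℝ) ^ 2 * n))
        + (run.totalCalls (T / K) : ℝ) * (49 * (ρ * n)) := by exact_mod_cast ht'
    have e4 : (ρ : ℝ) ^ (4 / 3 : ℝ) = p ^ 4 := by
      rw [h.p_eq]; exact rpow_third_mul (Nat.cast_nonneg ρ) 4 _ (by norm_num)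
    have e7 : (ρ : ℝ) ^ (7 / 3 : ℝ) = p ^ 7 := by
      rw [h.p_eq]; exact rpow_third_mul (Nat.cast_nonneg ρ) 7 _ (by norm_num)
    have hMK' : ((T / K : ℕ) : ℝ) * K = T := by exact_mod_cast h.mul_eq
    have hρn1 : (1 : ℝ) ≤ ρ * n := by
      have : 1 ≤ ρ * n := Nat.mul_pos hρ (hρ.trans hρn)
      exact_mod_cast this
    have hnX : (n : ℝ) ≤ ρ * n := by
      have : n ≤ ρ * n := Nat.le_mul_of_pos_left _ hρ
      exact_mod_cast this
    have hT1 : (1 : ℝ) ≤ T := by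
      rw [h.s_cube]; exact one_le_pow₀ (by linarith [h.L_le, h.two_le_L])
    have hXT : (ρ : ℝ) * n ≤ ρ * n * T := le_mul_of_one_le_right (by linarith) hT1
    -- The rounds contribute `M K = T` times `ρ n`. The sketches contribute `M = p s / 4` times `ρ²
    -- n = p⁶ n`, the term in `ρ^{7/3} T^{1/3}`. The oracle calls, charged `49 ρ n` each, give the
    -- term in `ρ^{4/3} T^{2/3}` and another multiple of `ρ n T`.
    have f1 : ((T / K : ℕ) : ℝ) * (K * (5 * (ρ * n)) + 77 * ((ρ : ℝ) ^ 2 * n)) =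
        5 * (ρ * n * T) + 77 / 4 * (p ^ 7 * n * s) := by
      have : ((T / K : ℕ) : ℝ) * (K * (5 * (ρ * n)) + 77 * ((ρ : ℝ) ^ 2 * n)) =
          ((T / K : ℕ) : ℝ) * K * (5 * (ρ * n)) + ((T / K : ℕ) : ℝ) * (77 * ((ρ : ℝ) ^ 2 * n)) := by
        ring
      rw [this, hMK', h.M_eq, h.p_cube]; ring
    have f2 : (run.totalCalls (T / K) : ℝ) * (49 * (ρ * n)) ≤
        0.65 * (8 * p * s ^ 2 + T) * (49 * (ρ * n)) := by gcongr
    have f3 : 0.65 * (8 * p * s ^ 2 + T) * (49 * (ρ * n)) =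
        254.8 * (p ^ 4 * n * s ^ 2) + 31.85 * (ρ * n * T) := by
      rw [h.p_cube]; ring
    rw [e4, e7, hs2, ← h.s_eq]
    have g1 : 0 ≤ p ^ 7 * n * s := by positivity
    have g2 : 0 ≤ p ^ 4 * n * s ^ 2 := by positivity
    linarith
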